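/- **Setting.** Let $\Omega=(\omega_{ij})$ be a symmetric positive definite $p\times p$ matrix ($p\ge 2$), and let $\mathbf X$ be an $n\times p$ data matrix ($n\ge 1$) whose rows are i.i.d. $\mathcal N(0,\Omega^{-1})$. For $A=\{i,j\}$, $i\ne j$, put $$\Theta_{A,A}=(\theta_{kl})_{k,l\in A}=\Omega_{A,A}^{-1},\qquad \beta_{A^c,A}=-\Omega_{A^c,A}\Omega_{A,A}^{-1},\qquad \epsilon_A=\mathbf X_A-\mathbf X_{A^c}\beta_{A^c,A},$$ and let the oracle MLEs be $\Theta^{\rm ora}_{A,A}=(\theta^{\rm ora}_{kl})=\epsilon_A^T\epsilon_A/n$ and $\Omega^{\rm ora}_{A,A}=(\omega^{\rm ora}_{kl})=(\Theta^{\rm ora}_{A,A})^{-1}$. For an estimator $\hat\beta_{A^c,A}$ (a function of $\mathbf X$) let $\hat\epsilon_A=\mathbf X_A-\mathbf X_{A^c}\hat\beta_{A^c,A}$, $\hat\Theta_{A,A}=(\hat\theta_{kl})=\hat\epsilon_A^T\hat\epsilon_A/n$ and $\hat\Omega_{A,A}=\hat\Theta_{A,A}^{-1}$. Matrix norms $\|\cdot\|$,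 $\|\cdot\|_1$, $\|\cdot\|_\infty$ are the $\ell_2$, $\ell_1$, $\ell_\infty$ norms of the vector of entries; $\bar D=\mathrm{diag}(\mathbf X^T\mathbf X/n)$. For $\delta\ge1$, the *error conditions* with $C_0,s,\epsilon_\Omega$ are: for all $A=\{i,j\}$, $i\neq j$, $$\mathbb P\{\|\mathbf X_{A^c}(\hat\beta_{A^c,A}-\beta_{A^c,A})\|^2\ge C_0s\delta\log p\}\le p^{-\delta+1}\epsilon_\Omega,$$ $$\mathbb P\{\|\bar D_{A^c}^{1/2}(\hat\beta_{A^c,A}-\beta_{A^c,A})\|_1\ge C_0s\sqrt{\delta(\log p)/n}\}\le p^{-\delta+1}\epsilon_\Omega,$$ $$\mathbb P\{|\hat\theta_{mm}/\theta^{\rm ora}_{mm}-1|\ge C_0s\delta(\log p)/n\}\le p^{-\delta+1}\epsilon_\Omega\qquad(m\in A).$$ **(i)** Let $C_0>0$ and $\delta\ge 1$, and suppose that the error conditions hold with $C_0,s,\epsilon_\Omega$. Then, for every $A=\{i,j\}$, $$\mathbb P\{\|\hat\Theta_{A,A}-\Theta^{\rm ora}_{A,A}\|_\infty>C_1s\tfrac{\delta\log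 p}{n}\}\le 6\epsilon_\Omega p^{-\delta+1}+\frac{4p^{-\delta+1}}{\sqrt{2\log p}}$$ with a constant $C_1>0$ depending only on $C_0$ and (an upper bound for) $\max_{m\in A}\theta_{mm}$. If moreover $s\ge1$ and $\delta s\le c_0n/\log p$ with a sufficiently small $c_0>0$, then $$\mathbb P\{\|\hat\Omega_{A,A}-\Omega^{\rm ora}_{A,A}\|_\infty>C_1's\tfrac{\delta\log p}{n}\}\le 6\epsilon_\Omega p^{-\delta+1}+\frac{4p^{-\delta+1}}{\sqrt{2\log p}},$$ where $c_0$ and $C_1'>0$ depend only on $C_0$ and (upper bounds for) $\max_{m\in A}\omega_{mm}$ and $\max_{m\in A}\theta_{mm}$. **(ii)** Let $M>1$, $\varepsilon>0$. There are constants $c_0,C_0,C_1,C_1'>0$ depending only on $(M,\varepsilon)$ such that for every $\delta\ge1$ there is a sequence $e_p\to0$ ($p\to\infty$) with the following property. Let $n\ge1$, $p\ge2$, $\delta s\le c_0n/\log p$, $\lambda=(1+\varepsilon)\sqrt{2\delta(\log p)/n}$, and let $\Omega$ be in $$\mathcal G^*(M,s,\lambda)=\Big\{\Omega:\ \max_j\sum_{i=1}^p\min\{1,|\omega_{ij}|/\lambda\}\le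 s,\ 1/M\le\lambda_{\min}(\Omega)\le\lambda_{\max}(\Omega)\le M\Big\}.$$ Let $\hat\beta_{A^c,A}$ be either the scaled lasso, whose columns $\hat\beta_m$, $m\in A$, satisfy $$\{\hat\beta_m,\hat\sigma_m\}=\mathop{\rm arg\,min}_{b\in\mathbb R^{A^c},\,\sigma>0}\Big\{\frac{\|\mathbf X_m-\mathbf X_{A^c}b\|^2}{2n\sigma}+\frac\sigma2+\lambda\sum_{k\in A^c}\frac{\|\mathbf X_k\|}{\sqrt n}|b_k|\Big\},$$ or the least squares estimator after scaled lasso selection, whose columns minimize $\|\mathbf X_m-\mathbf X_{A^c}b\|^2/(2n\sigma)+\sigma/2$ over $\sigma>0$ and $b$ supported in the support of the scaled lasso solution (with any choice of a minimizer, and any value where no minimizer exists). Then the error conditions hold with $C_0$, $s$ and $\epsilon_\Omega=e_p$, and so do both bounds of (i) with the constants $C_1,C_1'$, for all $A=\{i,j\}$. In particular $\epsilon_\Omega=o(1)$ uniformly over $\mathcal G^*(M,s,\lambda)$. **(iii)** There are absolute constants $D_1,\vartheta\in(0,\infty)$ such that for all $n\ge2$, all positive definite $\Omega$ and all $i\ne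 j$, with $\kappa^{\rm ora}_{ij}=\sqrt n(\omega^{\rm ora}_{ij}-\omega_{ij})/\sqrt{\omega_{ii}\omega_{jj}+\omega_{ij}^2}$, there exist four marginally standard normal random variables $Z'$, $Z_{ii}$, $Z_{ij}$, $Z_{jj}$, $Z'$ being a linear combination of the other three with deterministic coefficients, such that almost surely, whenever $|Z_{kl}|\le\vartheta\sqrt n$ for $kl=ii,ij,jj$, $$|\kappa^{\rm ora}_{ij}-Z'|\le\frac{D_1}{\sqrt n}\big(1+Z_{ii}^2+Z_{ij}^2+Z_{jj}^2\big).$$ -/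

import Mathlib

open MeasureTheory ProbabilityTheory Filter Topology

namespace PrecisionInference

noncomputable section

variable {n p : ℕ}

/-- The rows of the random `n × p` data matrix `X` are i.i.d. `N(0, Ω⁻¹)`. -/
structure IsGaussianSample {S : Type*} [MeasurableSpace S] (P : Measure S)
    (X : S → Matrix (Fin n) (Fin p) ℝ) (Ω : Matrix (Fin p) (Fin p) ℝ) : Prop where
  law : ∀ r : Fin n, HasLaw (fun ω => (WithLp.toLp 2 (X ω r) : EuclideanSpace ℝ (Fin p)))
    (multivariateGaussian 0 Ω⁻¹) P
  indep : iIndepFun (fun (r : Fin n) ω => (WithLp.toLp 2 (X ω r) : EuclideanSpace ℝ (Fin p))) P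

/-! ### Norms of vectors and matrices, viewed entrywise -/

/-- Squared Euclidean norm of a vector. -/
def sqNorm {ι : Type*} [Fintype ι] (v : ι → ℝ) : ℝ := ∑ r, v r ^ 2

/-- Squared `ℓ₂` norm of the entries of a matrix. -/
def matSqNorm {ι κ : Type*} [Fintype ι] [Fintype κ] (B : Matrix ι κ ℝ) : ℝ :=
  ∑ a, ∑ b, B a b ^ 2

/-- `ℓ₁` norm of the entries of a matrix. -/
def matL1 {ι κ : Type*} [Fintype ι] [Fintype κ] (B : Matrix ι κ ℝ) : ℝ :=
  ∑ a, ∑ b, |B a b|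

/-- Entrywise maximum norm of a (finite) matrix. -/
def matSup {ι κ : Type*} [Fintype ι] [Fintype κ] (B : Matrix ι κ ℝ) : ℝ :=
  ⨆ q : ι × κ, |B q.1 q.2|

/-! ### The regression of the columns in `A` on the columns outside `A` -/

/-- The columns `X_A`. -/
def colsIn (X : Matrix (Fin n) (Fin p) ℝ) (A : Finset (Fin p)) :
    Matrix (Fin n) {m // m ∈ A} ℝ :=
  X.submatrix id Subtype.val

/-- The columns `X_{Aᶜ}`. -/
def colsOut (X : Matrix (Fin n) (Fin p) ℝ) (A : Finset (Fin p)) :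
    Matrix (Fin n) {k // k ∉ A} ℝ :=
  X.submatrix id Subtype.val

/-- The block `Ω_{A,A}`. -/
def block (Ω : Matrix (Fin p) (Fin p) ℝ) (A : Finset (Fin p)) :
    Matrix {m // m ∈ A} {m // m ∈ A} ℝ :=
  Ω.submatrix Subtype.val Subtype.val

/-- `Θ_{A,A} = Ω_{A,A}⁻¹`, the covariance of the regression errors. -/
def theta (Ω : Matrix (Fin p) (Fin p) ℝ) (A : Finset (Fin p)) :
    Matrix {m // m ∈ A} {m // m ∈ A} ℝ :=
  (block Ω A)⁻¹

/-- `β_{Aᶜ,A} = -Ω_{Aᶜ,A} Ω_{A,A}⁻¹`, the true regression coefficients. -/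
def beta (Ω : Matrix (Fin p) (Fin p) ℝ) (A : Finset (Fin p)) :
    Matrix {k // k ∉ A} {m // m ∈ A} ℝ :=
  -(Ω.submatrix (Subtype.val : {k // k ∉ A} → Fin p) (Subtype.val : {m // m ∈ A} → Fin p)
    * (block Ω A)⁻¹)

/-- The residuals `X_A - X_{Aᶜ} b`. -/
def resid (X : Matrix (Fin n) (Fin p) ℝ) (A : Finset (Fin p))
    (b : Matrix {k // k ∉ A} {m // m ∈ A} ℝ) : Matrix (Fin n) {m // m ∈ A} ℝ :=
  colsIn X A - colsOut X A * b

/-- The residual covariance `(X_A - X_{Aᶜ} b)ᵀ (X_A - X_{Aᶜ} b) / n`. -/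
def residCov (X : Matrix (Fin n) (Fin p) ℝ) (A : Finset (Fin p))
    (b : Matrix {k // k ∉ A} {m // m ∈ A} ℝ) : Matrix {m // m ∈ A} {m // m ∈ A} ℝ :=
  (1 / (n : ℝ)) • ((resid X A b).transpose * resid X A b)

/-- The oracle estimator `Θ^ora_{A,A} = ε_Aᵀ ε_A / n`, with `ε_A = X_A - X_{Aᶜ} β_{Aᶜ,A}`. -/
def thetaOra (Ω : Matrix (Fin p) (Fin p) ℝ) (X : Matrix (Fin n) (Fin p) ℝ)
    (A : Finset (Fin p)) : Matrix {m // m ∈ A} {m // m ∈ A} ℝ :=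
  residCov X A (beta Ω A)

/-- The oracle estimator `Ω^ora_{A,A} = (Θ^ora_{A,A})⁻¹`. -/
def omegaOra (Ω : Matrix (Fin p) (Fin p) ℝ) (X : Matrix (Fin n) (Fin p) ℝ)
    (A : Finset (Fin p)) : Matrix {m // m ∈ A} {m // m ∈ A} ℝ :=
  (thetaOra Ω X A)⁻¹

variable (n p) in
/-- An estimator of the coefficient matrices `β_{Aᶜ,A}`: a function of the data matrix. -/
abbrev CoefEstimator : Type :=
  Matrix (Fin n) (Fin p) ℝ → (A : Finset (Fin p)) → Matrix {k // k ∉ A} {m // m ∈ A} ℝ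

/-- The plug-in estimator `Θ̂_{A,A}` built from the estimated residuals. -/
def thetaHat (βhat : CoefEstimator n p) (X : Matrix (Fin n) (Fin p) ℝ)
    (A : Finset (Fin p)) : Matrix {m // m ∈ A} {m // m ∈ A} ℝ :=
  residCov X A (βhat X A)

/-- The plug-in estimator `Ω̂_{A,A} = Θ̂_{A,A}⁻¹`. -/
def omegaHat (βhat : CoefEstimator n p) (X : Matrix (Fin n) (Fin p) ℝ)
    (A : Finset (Fin p)) : Matrix {m // m ∈ A} {m // m ∈ A} ℝ :=
  (thetaHat βhat X A)⁻¹

/-- The diagonal matrix `D̄_{Aᶜ}^{1/2}`, where `D̄ = diag(Xᵀ X / n)`. -/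
def rootDiag (X : Matrix (Fin n) (Fin p) ℝ) (A : Finset (Fin p)) :
    Matrix {k // k ∉ A} {k // k ∉ A} ℝ :=
  Matrix.diagonal fun k => √(sqNorm (fun r => X r k.1) / n)

/-- The three regression error conditions, for all `A = {i, j}` with `i ≠ j`, at a given `δ`, with
constant `C₀`, complexity `s` and remainder `ε`. -/
structure ErrorConditions {S : Type*} [MeasurableSpace S] (P : Measure S)
    (X : S → Matrix (Fin n) (Fin p) ℝ) (Ω : Matrix (Fin p) (Fin p) ℝ) (βhat : CoefEstimator n p)
    (C₀ s δ ε : ℝ) : Prop where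
  prediction : ∀ A : Finset (Fin p), A.card = 2 →
    P.real {ω | C₀ * s * δ * Real.log p ≤
        matSqNorm (colsOut (X ω) A * (βhat (X ω) A - beta Ω A))}
      ≤ (p : ℝ) ^ (-δ + 1) * ε
  coefficients : ∀ A : Finset (Fin p), A.card = 2 →
    P.real {ω | C₀ * s * √(δ * Real.log p / n) ≤
        matL1 (rootDiag (X ω) A * (βhat (X ω) A - beta Ω A))}
      ≤ (p : ℝ) ^ (-δ + 1) * ε
  noise : ∀ A : Finset (Fin p), A.card = 2 → ∀ i : {m // m ∈ A},
    P.real {ω | C₀ * s * δ * Real.log p / n ≤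
        |thetaHat βhat (X ω) A i i / thetaOra Ω (X ω) A i i - 1|}
      ≤ (p : ℝ) ^ (-δ + 1) * ε

/-! ### Scaled lasso and least squares after scaled lasso selection -/

/-- The loss `‖X_m - X_{Aᶜ} b‖² / (2 n σ) + σ / 2`. -/
def scaledLoss (X : Matrix (Fin n) (Fin p) ℝ) (A : Finset (Fin p)) (m : Fin p)
    (b : {k // k ∉ A} → ℝ) (σ : ℝ) : ℝ :=
  sqNorm (fun r => X r m - ∑ k : {k // k ∉ A}, X r k.1 * b k) / (2 * n * σ) + σ / 2

/-- The weighted `ℓ₁` penalty `∑_{k ∉ A} (‖X_k‖ / √n) |b_k|`. -/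
def weightedL1 (X : Matrix (Fin n) (Fin p) ℝ) (A : Finset (Fin p))
    (b : {k // k ∉ A} → ℝ) : ℝ :=
  ∑ k : {k // k ∉ A}, √(sqNorm (fun r => X r k.1)) / √n * |b k|

/-- `(b, σ)` minimizes the scaled lasso objective over `b ∈ ℝ^{Aᶜ}` and `σ > 0`. -/
def IsScaledLassoSol (lam : ℝ) (X : Matrix (Fin n) (Fin p) ℝ) (A : Finset (Fin p)) (m : Fin p)
    (b : {k // k ∉ A} → ℝ) (σ : ℝ) : Prop :=
  0 < σ ∧ ∀ (b' : {k // k ∉ A} → ℝ) (σ' : ℝ), 0 < σ' →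
    scaledLoss X A m b σ + lam * weightedL1 X A b
      ≤ scaledLoss X A m b' σ' + lam * weightedL1 X A b'

/-- `(b, σ)` minimizes the loss over `σ > 0` and vectors `b` supported in `T`. -/
def IsLSESol (T : Set (Fin p)) (X : Matrix (Fin n) (Fin p) ℝ) (A : Finset (Fin p)) (m : Fin p)
    (b : {k // k ∉ A} → ℝ) (σ : ℝ) : Prop :=
  0 < σ ∧ (∀ k, b k ≠ 0 → k.1 ∈ T) ∧
    ∀ (b' : {k // k ∉ A} → ℝ) (σ' : ℝ), 0 < σ' → (∀ k, b' k ≠ 0 → k.1 ∈ T) →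
      scaledLoss X A m b σ ≤ scaledLoss X A m b' σ'

/-- For each `A = {i, j}` and `m ∈ A`, the column `m` of `βhat X A` is a scaled lasso solution,
whenever the minimum is attained (no convention is imposed on the other data matrices, nor on the
choice among several minimizers). -/
def IsScaledLasso (lam : ℝ) (βhat : CoefEstimator n p) : Prop :=
  ∀ (X : Matrix (Fin n) (Fin p) ℝ) (A : Finset (Fin p)), A.card = 2 → ∀ m : {m // m ∈ A},
    (∃ b σ, IsScaledLassoSol lam X A m.1 b σ) →
      ∃ σ, IsScaledLassoSol lam X A m.1 (fun k => βhat X A k m) σ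

/-- The support of the column `m` of a coefficient matrix, as a set of variables. -/
def colSupport {A : Finset (Fin p)} (B : Matrix {k // k ∉ A} {m // m ∈ A} ℝ)
    (m : {m // m ∈ A}) : Set (Fin p) :=
  {k | ∃ h : k ∉ A, B ⟨k, h⟩ m ≠ 0}

/-- `βhat` is the least squares estimator in the model selected by a scaled lasso estimator. -/
def IsLSEAfterScaledLasso (lam : ℝ) (βhat : CoefEstimator n p) : Prop :=
  ∃ βsel : CoefEstimator n p, IsScaledLasso lam βsel ∧
    ∀ (X : Matrix (Fin n) (Fin p) ℝ) (A : Finset (Fin p)), A.card = 2 → ∀ m : {m // m ∈ A},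
      (∃ b σ, IsLSESol (colSupport (βsel X A) m) X A m.1 b σ) →
        ∃ σ, IsLSESol (colSupport (βsel X A) m) X A m.1 (fun k => βhat X A k m) σ

/-- The penalty level `(1 + ε) √(2 δ log p / n)`. -/
def penalty (ε δ : ℝ) (n p : ℕ) : ℝ := (1 + ε) * √(2 * δ * Real.log p / n)

/-! ### The capped `ℓ₁` class -/

/-- `s_λ(Ω) = max_j ∑_i min {1, |ω_ij| / λ}`. -/
def cappedL1 (lam : ℝ) (Ω : Matrix (Fin p) (Fin p) ℝ) : ℝ :=
  ⨆ j, ∑ i, min 1 (|Ω i j| / lam)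

/-- The class `G*(M, s, λ)` of symmetric matrices with `s_λ(Ω) ≤ s` and spectrum in `[1/M, M]`. -/
def cappedBall (p : ℕ) (M s lam : ℝ) : Set (Matrix (Fin p) (Fin p) ℝ) :=
  {Ω | cappedL1 lam Ω ≤ s ∧
    ∃ h : Ω.IsHermitian, ∀ k, 1 / M ≤ h.eigenvalues k ∧ h.eigenvalues k ≤ M}

/-! ### Tail bound and standardized oracle -/

/-- The tail probability bound `6 ε p^{-δ+1} + 4 p^{-δ+1} / √(2 log p)`. -/
def tailBound (ε δ : ℝ) (p : ℕ) : ℝ :=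
  6 * ε * (p : ℝ) ^ (-δ + 1) + 4 * (p : ℝ) ^ (-δ + 1) / √(2 * Real.log p)

/-- `κ^ora_ij = √n (ω^ora_ij - ω_ij) / √(ω_ii ω_jj + ω_ij²)`, where `ω^ora_ij` is the `(i, j)`
entry of `Ω^ora_{A,A}` for `A = {i, j}`. -/
def kappaOra (Ω : Matrix (Fin p) (Fin p) ℝ) (X : Matrix (Fin n) (Fin p) ℝ) (i j : Fin p) : ℝ :=
  √n * (omegaOra Ω X {i, j} ⟨i, by simp⟩ ⟨j, by simp⟩ - Ω i j)
    / √(Ω i i * Ω j j + Ω i j ^ 2)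

end

end PrecisionInference

open PrecisionInference

/-! Everything rests on one orthogonality. The regression errors are the linear combinations `X *
residDir Ω A` of the columns, their covariance is `theta Ω A`, and they are uncorrelated with the
columns outside `A` (`inclOut_cov_residDir`), hence independent of them.

(i) The plug-in and oracle covariances differ by cross terms between the errors and the prediction
error, plus a quadratic term bounded by the squared prediction error. By Hölder, a cross term is at
most the largest correlation of the errors with a normalized column times the weighted ℓ₁ error
(`abs_residCov_sub_le`). Conditionally on a column its correlation is Gaussian, so the level `√(4 δ
log p)` is exceeded with a probability that fits into the last term of `tailBound` (`tail_slack`).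
The precision bound follows by perturbing the inverse of a 2 × 2 matrix, once the smallest
eigenvalue of the oracle covariance is bounded below with high probability.

(ii) Minimizing the scaled lasso criterion over `σ` leaves the square-root lasso. Its analysis is
deterministic on an event (`LassoEvent`) that asks for two-sided restricted eigenvalue bounds with
an ℓ₁ slack and for noise correlations at most `ρ λ` with `ρ < 1`. Minimality gives a cone
inequality; capped ℓ₁ sparsity and the restricted eigenvalues turn it into the usual rates.
Stationarity on the support bounds the size of the selected model by a multiple of `s`, so least
squares on it keeps the rates (`sqrtLasso_and_leastSquares`). The restricted eigenvalue bounds come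
from concentration at finitely many sums of signed coordinate vectors, extended to all vectors by
Maurey's empirical method (`quadForm_ge_of_signedSum`). The factor `1 + ε` in the penalty pays for
`ρ < 1` and for a failure probability `o(p^{1-δ})`.

(iii) A suitable factor of `Ω_{A,A}` writes the oracle through the Gram matrix of two independent
standard normal vectors `W₁`, `W₂`. To first order it is a fixed combination of their centred
squared norms; the inner product enters only quadratically. What remains is a normal `T` with `‖W‖²
= n + √(2n) T + O(1 + T²)` (`exists_normal_approx_sqNorm`). Take `T` to be the quantile transform of
the norm. The chi density is compared with the density of a variable whose signed log-likelihood
root is exactly normal: the likelihood ratios are monotone, and this traps `T` between the signed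
roots at scales `√n` and `√(n-1)`. -/

namespace PrecisionInference

open Matrix

/-! ### Linear statistics of a Gaussian sample. -/

section GaussianSample

variable {n p : ℕ}

/-- Two uncorrelated linear statistics of a centred Gaussian vector are independent Gaussians. -/
lemma hasLaw_inner_pair_multivariateGaussian {S : Matrix (Fin p) (Fin p) ℝ} (hS : S.PosSemidef)
    (u v : Fin p → ℝ) (huv : u ⬝ᵥ S *ᵥ v = 0) :
    HasLaw (fun x : EuclideanSpace ℝ (Fin p) => (x.ofLp ⬝ᵥ u, x.ofLp ⬝ᵥ v))
      ((gaussianReal 0 (u ⬝ᵥ S *ᵥ u).toNNReal).prod (gaussianReal 0 (v ⬝ᵥ S *ᵥ v).toNNReal))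
      (multivariateGaussian 0 S) := by
  set μ := multivariateGaussian (0 : EuclideanSpace ℝ (Fin p)) S with hμ
  have key : ∀ w : Fin p → ℝ, (fun x : EuclideanSpace ℝ (Fin p) => x.ofLp ⬝ᵥ w)
      = fun x => inner ℝ (WithLp.toLp 2 w) x := by
    intro w
    ext x
    simp [PiLp.inner_apply, dotProduct]
  have hcov : ∀ w w' : Fin p → ℝ, cov[fun x : EuclideanSpace ℝ (Fin p) => x.ofLp ⬝ᵥ w,
      fun x => x.ofLp ⬝ᵥ w'; μ] = w ⬝ᵥ S *ᵥ w' := by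
    intro w w'
    rw [key, key, ← covarianceBilin_apply_eq_cov, covarianceBilin_multivariateGaussian hS]
    exact IsGaussian.memLp_two_id
  have hid : HasGaussianLaw (id : EuclideanSpace ℝ (Fin p) → _) μ := IsGaussian.hasGaussianLaw_id
  have hpair : HasGaussianLaw (fun x : EuclideanSpace ℝ (Fin p) =>
      (x.ofLp ⬝ᵥ u, x.ofLp ⬝ᵥ v)) μ := by
    have := hid.map_fun ((innerSL ℝ (WithLp.toLp 2 u : EuclideanSpace ℝ (Fin p))).prod
      (innerSL ℝ (WithLp.toLp 2 v : EuclideanSpace ℝ (Fin p))))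
    refine this.congr (ae_of_all _ fun x => ?_)
    simp only [ContinuousLinearMap.prod_apply, innerSL_apply_apply, id]
    rw [congrFun (key u) x, congrFun (key v) x]
  have hlaw : ∀ w : Fin p → ℝ, HasLaw (fun x : EuclideanSpace ℝ (Fin p) => x.ofLp ⬝ᵥ w)
      (gaussianReal 0 (w ⬝ᵥ S *ᵥ w).toNNReal) μ := by
    intro w
    have hw : HasGaussianLaw (fun x : EuclideanSpace ℝ (Fin p) => x.ofLp ⬝ᵥ w) μ := by
      rw [key]
      exact hid.map_fun (innerSL ℝ (WithLp.toLp 2 w : EuclideanSpace ℝ (Fin p)))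
    refine ⟨hw.aemeasurable, ?_⟩
    rw [hw.map_eq_gaussianReal, ← covariance_self hw.aemeasurable, hcov]
    congr 1
    rw [key]
    have := (innerSL ℝ (WithLp.toLp 2 w : EuclideanSpace ℝ (Fin p))).integral_comp_id_comm
      (μ := μ) IsGaussian.integrable_id
    simp only [innerSL_apply_apply, hμ] at this
    rw [hμ, this]
    simp
  exact (indepFun_iff_hasLaw_prodMk_prod (hlaw u) (hlaw v)).1
    (hpair.indepFun_of_covariance_eq_zero (by rw [hcov, huv]))

/-- Two `Ω⁻¹`-orthogonal linear combinations of the columns of a Gaussian sample are independent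
vectors with i.i.d. centred Gaussian entries. -/
lemma IsGaussianSample.hasLaw_mulVec_pair {S : Type*} [MeasurableSpace S] {P : Measure S}
    [IsProbabilityMeasure P] {X : S → Matrix (Fin n) (Fin p) ℝ} {Ω : Matrix (Fin p) (Fin p) ℝ}
    (hX : IsGaussianSample P X Ω) (hΩ : Ω.PosDef) (u v : Fin p → ℝ)
    (huv : u ⬝ᵥ Ω⁻¹ *ᵥ v = 0) :
    HasLaw (fun ω => (X ω *ᵥ u, X ω *ᵥ v))
      ((Measure.pi fun _ : Fin n => gaussianReal 0 (u ⬝ᵥ Ω⁻¹ *ᵥ u).toNNReal).prod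
        (Measure.pi fun _ : Fin n => gaussianReal 0 (v ⬝ᵥ Ω⁻¹ *ᵥ v).toNNReal)) P := by
  have hrow := fun r : Fin n =>
    (hasLaw_inner_pair_multivariateGaussian hΩ.inv.posSemidef u v huv).fun_comp (hX.law r)
  have hind := hX.indep.comp (fun _ x => ((x.ofLp ⬝ᵥ u, x.ofLp ⬝ᵥ v) : ℝ × ℝ))
    (fun _ => by simp only [dotProduct]; fun_prop)
  exact (measurePreserving_arrowProdEquivProdArrow ℝ ℝ (Fin n) _ _).hasLaw.fun_comp
    (iIndepFun.hasLaw_pi hrow hind)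

lemma IsGaussianSample.hasLaw_mulVec {S : Type*} [MeasurableSpace S] {P : Measure S}
    [IsProbabilityMeasure P] {X : S → Matrix (Fin n) (Fin p) ℝ} {Ω : Matrix (Fin p) (Fin p) ℝ}
    (hX : IsGaussianSample P X Ω) (hΩ : Ω.PosDef) (u : Fin p → ℝ) :
    HasLaw (fun ω => X ω *ᵥ u)
      (Measure.pi fun _ : Fin n => gaussianReal 0 (u ⬝ᵥ Ω⁻¹ *ᵥ u).toNNReal) P := by
  -- The zero vector is orthogonal to every `u`, so the first marginal of the pair is the law
  -- sought.
  have h := hX.hasLaw_mulVec_pair hΩ u 0 (by simp)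
  have h2 : HasLaw Prod.fst _ _ := (measurePreserving_fst
    (μ := Measure.pi fun _ : Fin n => gaussianReal 0 (u ⬝ᵥ Ω⁻¹ *ᵥ u).toNNReal)
    (ν := Measure.pi fun _ : Fin n =>
      gaussianReal 0 ((0 : Fin p → ℝ) ⬝ᵥ Ω⁻¹ *ᵥ 0).toNNReal)).hasLaw
  exact h2.fun_comp h

end GaussianSample

/-! ### Gaussian linear forms and chi-square tails. -/

section GaussianTails

variable {n : ℕ}

/-- A linear form of i.i.d. centred Gaussians is Gaussian. -/
lemma hasLaw_dotProduct_pi_gaussianReal (s : NNReal) (v : Fin n → ℝ) :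
    HasLaw (fun g : Fin n → ℝ => v ⬝ᵥ g) (gaussianReal 0 (s * (sqNorm v).toNNReal))
      (Measure.pi fun _ : Fin n => gaussianReal 0 s) := by
  have hm : Measurable fun g : Fin n → ℝ => v ⬝ᵥ g := by simp only [dotProduct]; fun_prop
  refine ⟨hm.aemeasurable, ?_⟩
  -- The characteristic function of the linear form factors over the coordinates.
  apply Measure.ext_of_charFun
  ext t
  rw [charFun_apply_real, integral_map hm.aemeasurable
    (Measurable.aestronglyMeasurable (by fun_prop))]
  have h1 : ∀ g : Fin n → ℝ, Complex.exp (t * ((v ⬝ᵥ g : ℝ) : ℂ) * Complex.I)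
      = ∏ r, Complex.exp (((t * v r : ℝ) : ℂ) * (g r : ℂ) * Complex.I) := by
    intro g
    rw [← Complex.exp_sum]
    congr 1
    simp only [dotProduct]
    push_cast
    rw [Finset.mul_sum, Finset.sum_mul]
    exact Finset.sum_congr rfl fun r _ => by ring
  simp_rw [h1]
  rw [integral_fintype_prod_eq_prod
    (f := fun r (x : ℝ) => Complex.exp (((t * v r : ℝ) : ℂ) * (x : ℂ) * Complex.I))]
  simp_rw [← charFun_apply_real, charFun_gaussianReal]
  rw [← Complex.exp_sum]
  congr 1
  have hs : 0 ≤ sqNorm v := Finset.sum_nonneg fun r _ => sq_nonneg _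
  have : ((s * (sqNorm v).toNNReal : NNReal) : ℝ) = s * ∑ r, v r ^ 2 := by
    rw [NNReal.coe_mul, Real.coe_toNNReal _ hs]; rfl
  rw [this]
  push_cast
  simp only [mul_zero, zero_mul, zero_sub, Finset.sum_neg_distrib, Finset.mul_sum,
    Finset.sum_mul, Finset.sum_div]
  congr 1
  exact Finset.sum_congr rfl fun r _ => by ring

lemma gaussianReal_real_abs_gt_le (v : NNReal) {t : ℝ} (ht : 0 ≤ t) :
    (gaussianReal 0 v).real {x | t < |x|} ≤ 2 * Real.exp (-t ^ 2 / (2 * v)) := by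
  have hsub : HasSubgaussianMGF id v (gaussianReal 0 v) :=
    ⟨fun t => by simpa using integrable_exp_mul_gaussianReal t, fun t => by
      rw [mgf_id_gaussianReal]; simp⟩
  have h1 := hsub.measure_ge_le ht
  have h2 := hsub.neg.measure_ge_le ht
  have hle : {x : ℝ | t < |x|} ⊆ {x | t ≤ id x} ∪ {x | t ≤ (-id) x} := by
    intro x hx
    rcases lt_abs.1 (show t < |x| from hx) with h | h
    · exact Or.inl h.le
    · exact Or.inr (by simpa using h.le)
  calc _ ≤ (gaussianReal 0 v).real ({x | t ≤ id x} ∪ {x | t ≤ (-id) x}) := measureReal_mono hle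
    _ ≤ _ := measureReal_union_le _ _
    _ ≤ _ := by linarith

/-- A self-normalized linear form of i.i.d. Gaussians has a Gaussian tail. -/
lemma real_dotProduct_gt_le {S : Type*} [MeasurableSpace S] {P : Measure S}
    [IsProbabilityMeasure P] {V g : S → Fin n → ℝ} {μ : Measure (Fin n → ℝ)}
    [IsProbabilityMeasure μ] {s : NNReal}
    (h : HasLaw (fun ω => (V ω, g ω)) (μ.prod (Measure.pi fun _ : Fin n => gaussianReal 0 s)) P)
    {t : ℝ} (ht : 0 ≤ t) :
    P.real {ω | t * √(sqNorm (V ω)) < |V ω ⬝ᵥ g ω|} ≤ 2 * Real.exp (-t ^ 2 / (2 * s)) := by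
  have hms : MeasurableSet
      {q : (Fin n → ℝ) × (Fin n → ℝ) | t * √(sqNorm q.1) < |q.1 ⬝ᵥ q.2|} := by
    apply measurableSet_lt
    · simp only [sqNorm]; fun_prop
    · simp only [dotProduct]; fun_prop
  rw [h.measureReal_eq (p := fun q => t * √(sqNorm q.1) < |q.1 ⬝ᵥ q.2|) hms, measureReal_def,
    Measure.prod_apply hms]
  -- For a fixed first vector `v` the form is normal with variance `s ‖v‖²`, so the bound does not
  -- depend on `v` and survives integration over `v`. For `v = 0` the strict inequality defining the
  -- event fails.
  have hb : ∀ v : Fin n → ℝ, (Measure.pi fun _ : Fin n => gaussianReal 0 s)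
      (Prod.mk v ⁻¹' {q : (Fin n → ℝ) × (Fin n → ℝ) | t * √(sqNorm q.1) < |q.1 ⬝ᵥ q.2|})
      ≤ ENNReal.ofReal (2 * Real.exp (-t ^ 2 / (2 * s))) := by
    intro v
    have hs : 0 ≤ sqNorm v := Finset.sum_nonneg fun r _ => sq_nonneg _
    rw [ENNReal.le_ofReal_iff_toReal_le (by finiteness) (by positivity)]
    rcases hs.eq_or_lt with h0 | hpos
    · have hv : v = 0 := by
        ext r
        have := (Finset.sum_eq_zero_iff_of_nonneg (fun r _ => sq_nonneg (v r))).1 h0.symm r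
          (Finset.mem_univ _)
        simpa using this
      have : (Prod.mk v ⁻¹' {q : (Fin n → ℝ) × (Fin n → ℝ) | t * √(sqNorm q.1) < |q.1 ⬝ᵥ q.2|})
          = ∅ := by
        ext g
        simp [hv, sqNorm]
      rw [this]
      simp only [measure_empty, ENNReal.toReal_zero]
      positivity
    · have hl := hasLaw_dotProduct_pi_gaussianReal s v
      have := hl.measureReal_eq (p := fun x => t * √(sqNorm v) < |x|)
        (measurableSet_lt (by fun_prop) (by fun_prop))
      change (Measure.pi fun _ : Fin n => gaussianReal 0 s).real
        {g | t * √(sqNorm v) < |v ⬝ᵥ g|} ≤ _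
      rw [this]
      refine (gaussianReal_real_abs_gt_le _ (by positivity)).trans (le_of_eq ?_)
      rw [NNReal.coe_mul, Real.coe_toNNReal _ hs, mul_pow, Real.sq_sqrt hs]
      congr 2
      rw [← mul_assoc, ← neg_mul, mul_div_mul_right _ _ hpos.ne']
  refine ENNReal.toReal_le_of_le_ofReal (by positivity) ?_
  calc _ ≤ ∫⁻ _, ENNReal.ofReal (2 * Real.exp (-t ^ 2 / (2 * s))) ∂μ := lintegral_mono hb
    _ = _ := by simp

/-- A self-normalized linear form of i.i.d. standard Gaussians is standard Gaussian. -/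
lemma hasLaw_dotProduct_div_norm {S : Type*} [MeasurableSpace S] {P : Measure S}
    {V g : S → Fin n → ℝ} {μ : Measure (Fin n → ℝ)} [IsProbabilityMeasure μ]
    (h : HasLaw (fun ω => (V ω, g ω)) (μ.prod (Measure.pi fun _ : Fin n => gaussianReal 0 1)) P)
    (hμ : ∀ᵐ v ∂μ, 0 < sqNorm v) :
    HasLaw (fun ω => V ω ⬝ᵥ g ω / √(sqNorm (V ω))) (gaussianReal 0 1) P := by
  have hm : Measurable fun q : (Fin n → ℝ) × (Fin n → ℝ) => q.1 ⬝ᵥ q.2 / √(sqNorm q.1) := by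
    simp only [sqNorm, dotProduct]; fun_prop
  refine HasLaw.fun_comp (Y := fun q : (Fin n → ℝ) × (Fin n → ℝ) => q.1 ⬝ᵥ q.2 / √(sqNorm q.1))
    ⟨hm.aemeasurable, ?_⟩ h
  ext B hB
  rw [Measure.map_apply hm hB, Measure.prod_apply (hm hB)]
  -- The conditional law given `v` is standard normal for almost every `v`, hence so is the mixture.
  have : ∀ᵐ v ∂μ, (Measure.pi fun _ : Fin n => gaussianReal 0 1) (Prod.mk v ⁻¹'
      ((fun q : (Fin n → ℝ) × (Fin n → ℝ) => q.1 ⬝ᵥ q.2 / √(sqNorm q.1)) ⁻¹' B))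
      = gaussianReal 0 1 B := by
    filter_upwards [hμ] with v hv
    have hl := gaussianReal_div_const (hasLaw_dotProduct_pi_gaussianReal 1 v) (√(sqNorm v))
    have h1 : (1 * (sqNorm v).toNNReal / NNReal.mk (√(sqNorm v) ^ 2) (sq_nonneg _)) = 1 := by
      apply NNReal.eq
      simp [Real.sq_sqrt hv.le, Real.coe_toNNReal _ hv.le, hv.ne']
    rw [h1, zero_div] at hl
    exact hl.measure_eq (p := fun x => x ∈ B) hB
  rw [lintegral_congr_ae this]
  simp

lemma integral_exp_mul_sq_gaussianReal {l : ℝ} (hl : 2 * l < 1) :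
    Integrable (fun x => Real.exp (l * x ^ 2)) (gaussianReal 0 1) ∧
      ∫ x, Real.exp (l * x ^ 2) ∂(gaussianReal 0 1) = (√(1 - 2 * l))⁻¹ := by
  have hb : 0 < 1 / 2 - l := by linarith
  have hfun : ∀ x : ℝ, gaussianPDFReal 0 1 x * Real.exp (l * x ^ 2)
      = (√(2 * Real.pi))⁻¹ * Real.exp (-(1 / 2 - l) * x ^ 2) := by
    intro x
    simp only [gaussianPDFReal, NNReal.coe_one, mul_one, sub_zero]
    rw [mul_assoc, ← Real.exp_add]
    ring_nf
  constructor
  · rw [gaussianReal_of_var_ne_zero _ one_ne_zero,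
      integrable_withDensity_iff (measurable_gaussianPDF 0 1) (by simp [gaussianPDF_lt_top])]
    simp only [toReal_gaussianPDF]
    have : (fun x : ℝ => Real.exp (l * x ^ 2) * gaussianPDFReal 0 1 x)
        = fun x => (√(2 * Real.pi))⁻¹ * Real.exp (-(1 / 2 - l) * x ^ 2) := by
      ext x; rw [mul_comm, hfun]
    rw [this]
    exact (integrable_exp_neg_mul_sq hb).const_mul _
  · rw [integral_gaussianReal_eq_integral_smul one_ne_zero]
    simp only [smul_eq_mul, hfun]
    rw [integral_const_mul, integral_gaussian]
    rw [← Real.sqrt_inv, ← Real.sqrt_inv, ← Real.sqrt_mul (by positivity)]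
    congr 1
    have : (1 : ℝ) - 2 * l ≠ 0 := by linarith
    have h2 : (1 : ℝ) / 2 - l ≠ 0 := by linarith
    field_simp

/-- A bound on the chi-square moment generating function. Squared, it reads `1 ≤ (1 - 2l) exp(2l +
4l²)`; the quadratic lower bound of `exp` gives this for `l ≥ 0` and the linear one for `l < 0`. -/
lemma neg_half_log_bound {l : ℝ} (h2 : l ≤ 1 / 4) :
    (√(1 - 2 * l))⁻¹ ≤ Real.exp (l + 2 * l ^ 2) := by
  have hpos : 0 < 1 - 2 * l := by linarith
  have key : 1 ≤ (1 - 2 * l) * Real.exp (2 * (l + 2 * l ^ 2)) := by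
    by_cases hl : 0 ≤ l
    · have hq := Real.quadratic_le_exp_of_nonneg (x := 2 * (l + 2 * l ^ 2)) (by positivity)
      nlinarith [mul_le_mul_of_nonneg_left hq hpos.le, sq_nonneg l, mul_nonneg hl (sq_nonneg l),
        mul_nonneg hl hl,
        mul_nonneg (mul_nonneg hl hl) (sub_nonneg.2 h2),
        mul_nonneg (mul_nonneg (mul_nonneg hl hl) hl) (sub_nonneg.2 h2)]
    · push Not at hl
      have := Real.add_one_le_exp (2 * (l + 2 * l ^ 2))
      have h3 := mul_le_mul_of_nonneg_left this hpos.le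
      nlinarith [mul_nonneg (neg_nonneg.2 hl.le) (sq_nonneg l)]
  have hsq : Real.exp (l + 2 * l ^ 2) = √(Real.exp (2 * (l + 2 * l ^ 2))) := by
    rw [two_mul (l + 2 * l ^ 2), Real.exp_add (l + 2 * l ^ 2), Real.sqrt_mul_self (Real.exp_pos _).le]
  rw [inv_le_iff_one_le_mul₀ (Real.sqrt_pos.2 hpos), hsq, ← Real.sqrt_mul (Real.exp_pos _).le]
  exact Real.one_le_sqrt.2 (by linarith)

lemma integral_exp_sqNorm_le {l : ℝ} (h2 : l ≤ 1 / 4) :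
    Integrable (fun g : Fin n → ℝ => Real.exp (l * sqNorm g))
        (Measure.pi fun _ : Fin n => gaussianReal 0 1) ∧
    ∫ g : Fin n → ℝ, Real.exp (l * sqNorm g) ∂(Measure.pi fun _ : Fin n => gaussianReal 0 1)
      ≤ Real.exp (n * (l + 2 * l ^ 2)) := by
  have hi := integral_exp_mul_sq_gaussianReal (l := l) (by linarith)
  have he : (fun g : Fin n → ℝ => Real.exp (l * sqNorm g))
      = fun g => ∏ r, Real.exp (l * g r ^ 2) := by
    ext g
    rw [← Real.exp_sum, sqNorm, Finset.mul_sum]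
  rw [he]
  constructor
  · exact Integrable.fintype_prod (f := fun _ x => Real.exp (l * x ^ 2)) fun _ => hi.1
  · rw [integral_fintype_prod_eq_prod (f := fun _ (x : ℝ) => Real.exp (l * x ^ 2))]
    simp only [hi.2, Finset.prod_const, Finset.card_univ, Fintype.card_fin]
    rw [Real.exp_nat_mul]
    exact pow_le_pow_left₀ (by positivity) (neg_half_log_bound h2) n

/-- Chi-square concentration. -/
lemma pi_gaussianReal_sqNorm_tails {t : ℝ} (ht0 : 0 < t) (ht1 : t ≤ 1) :
    (Measure.pi fun _ : Fin n => gaussianReal 0 1).real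
        {g | n * (1 + t) ≤ sqNorm g} ≤ Real.exp (-(n * t ^ 2 / 8)) ∧
    (Measure.pi fun _ : Fin n => gaussianReal 0 1).real
        {g | sqNorm g ≤ n * (1 - t)} ≤ Real.exp (-(n * t ^ 2 / 8)) := by
  set ν := Measure.pi fun _ : Fin n => gaussianReal 0 1
  constructor
  -- The Chernoff exponent is at most `n (2 l² - l t)`, which is smallest at `l = t / 4`, with value
  -- `-n t² / 8`; `t ≤ 1` keeps `l ≤ 1 / 4`.
  · have h := integral_exp_sqNorm_le (n := n) (l := t / 4) (by linarith)
    refine (measure_ge_le_exp_mul_mgf (μ := ν) (X := sqNorm) (n * (1 + t)) (t := t / 4)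
      (by positivity) h.1).trans ?_
    refine (mul_le_mul_of_nonneg_left h.2 (Real.exp_pos _).le).trans ?_
    rw [← Real.exp_add]
    exact Real.exp_le_exp.2 (by nlinarith)
  · have h := integral_exp_sqNorm_le (n := n) (l := -(t / 4)) (by linarith)
    refine (measure_le_le_exp_mul_mgf (μ := ν) (X := sqNorm) (n * (1 - t)) (t := -(t / 4))
      (by linarith) h.1).trans ?_
    refine (mul_le_mul_of_nonneg_left h.2 (Real.exp_pos _).le).trans ?_
    rw [← Real.exp_add]
    exact Real.exp_le_exp.2 (by nlinarith)

end GaussianTails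

end PrecisionInference

namespace PrecisionInference

open Matrix

lemma sqNorm_nonneg {ι : Type*} [Fintype ι] (v : ι → ℝ) : 0 ≤ sqNorm v :=
  Finset.sum_nonneg fun _ _ => sq_nonneg _

lemma sqNorm_eq_dotProduct {ι : Type*} [Fintype ι] (v : ι → ℝ) : sqNorm v = v ⬝ᵥ v := by
  simp [sqNorm, dotProduct, sq]

lemma sqNorm_smul {ι : Type*} [Fintype ι] (c : ℝ) (v : ι → ℝ) :
    sqNorm (c • v) = c ^ 2 * sqNorm v := by
  simp [sqNorm, mul_pow, Finset.mul_sum]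

/-! ### Concentration of `‖X u‖²`. -/

section Concentration

variable {n p : ℕ} {S : Type*} [MeasurableSpace S] {P : Measure S}
    [IsProbabilityMeasure P] {X : S → Matrix (Fin n) (Fin p) ℝ} {Ω : Matrix (Fin p) (Fin p) ℝ}

lemma covForm_pos (hΩ : Ω.PosDef) {u : Fin p → ℝ} (hu : u ≠ 0) : 0 < u ⬝ᵥ Ω⁻¹ *ᵥ u := by
  simpa using hΩ.inv.dotProduct_mulVec_pos hu

lemma covForm_nonneg (hΩ : Ω.PosDef) (u : Fin p → ℝ) : 0 ≤ u ⬝ᵥ Ω⁻¹ *ᵥ u := by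
  simpa using hΩ.inv.posSemidef.dotProduct_mulVec_nonneg u

/-- Concentration of the squared norm of a linear combination of the columns of a sample. -/
lemma IsGaussianSample.real_sqNorm_tails (hX : IsGaussianSample P X Ω) (hΩ : Ω.PosDef)
    (u : Fin p → ℝ) {t : ℝ} (ht0 : 0 < t) (ht1 : t ≤ 1) :
    P.real {ω | (1 + t) * (n * (u ⬝ᵥ Ω⁻¹ *ᵥ u)) < sqNorm (X ω *ᵥ u)}
      ≤ Real.exp (-(n * t ^ 2 / 8)) ∧
    P.real {ω | sqNorm (X ω *ᵥ u) < (1 - t) * (n * (u ⬝ᵥ Ω⁻¹ *ᵥ u))}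
      ≤ Real.exp (-(n * t ^ 2 / 8)) := by
  -- The zero direction cannot be normalized, but there both strict events are empty.
  by_cases hu : u = 0
  · subst hu
    simp only [mulVec_zero, dotProduct_zero, mul_zero, sqNorm, Pi.zero_apply, ne_eq,
      OfNat.ofNat_ne_zero, not_false_eq_true, zero_pow, Finset.sum_const_zero, lt_self_iff_false,
      Set.ofPred_false, measureReal_empty]
    exact ⟨(Real.exp_pos _).le, (Real.exp_pos _).le⟩
  have hpos := covForm_pos hΩ hu
  set v := u ⬝ᵥ Ω⁻¹ *ᵥ u with hv
  have hw : ((√v)⁻¹ • u) ⬝ᵥ Ω⁻¹ *ᵥ ((√v)⁻¹ • u) = 1 := by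
    rw [mulVec_smul, smul_dotProduct, dotProduct_smul, ← hv, smul_eq_mul, smul_eq_mul,
      ← mul_assoc, ← mul_inv, Real.mul_self_sqrt hpos.le, inv_mul_cancel₀ hpos.ne']
  have hl := hX.hasLaw_mulVec hΩ ((√v)⁻¹ • u)
  rw [hw, Real.toNNReal_one] at hl
  have hs : ∀ ω, sqNorm (X ω *ᵥ ((√v)⁻¹ • u)) = sqNorm (X ω *ᵥ u) / v := by
    intro ω
    rw [mulVec_smul, sqNorm_smul, inv_pow, Real.sq_sqrt hpos.le, div_eq_inv_mul]
  have ht := pi_gaussianReal_sqNorm_tails (n := n) ht0 ht1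
  have hms : Measurable fun g : Fin n → ℝ => sqNorm g := by simp only [sqNorm]; fun_prop
  rw [← hl.measureReal_eq (p := fun g => n * (1 + t) ≤ sqNorm g)
      (measurableSet_le (by fun_prop) hms),
    ← hl.measureReal_eq (p := fun g => sqNorm g ≤ n * (1 - t))
      (measurableSet_le hms (by fun_prop))] at ht
  refine ⟨(measureReal_mono fun ω hω => ?_).trans ht.1, (measureReal_mono fun ω hω => ?_).trans ht.2⟩
  · simp only [Set.mem_ofPred_eq] at hω ⊢
    rw [hs, le_div_iff₀ hpos]
    linarith
  · simp only [Set.mem_ofPred_eq] at hω ⊢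
    rw [hs, div_le_iff₀ hpos]
    linarith

end Concentration

/-! ### Maurey's empirical method for quadratic forms. -/

section Maurey

variable {J : Type*} [Fintype J] [DecidableEq J]

/-- A signed coordinate vector. -/
def signedUnit (q : J × Bool) : J → ℝ := Pi.single q.1 (if q.2 then 1 else -1)

/-- A sum of `k` signed coordinate vectors. -/
def signedSum {k : ℕ} (f : Fin k → J × Bool) : J → ℝ := ∑ i, signedUnit (f i)

/-- Sequential averaging: a sum of `k` signed coordinate vectors, drawn from a distribution with
mean `m`, is at best as good for a quadratic form as on average. -/
lemma exists_signedSum_quadForm_le (M : Matrix J J ℝ) (q : J → ℝ) (hq : ∀ j, 0 ≤ q j)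
    (hq1 : ∑ j, q j = 1) (σ : J → Bool) {m : J → ℝ} (hm : m = ∑ j, q j • signedUnit (j, σ j))
    (k : ℕ) (c : J → ℝ) :
    ∃ f : Fin k → J × Bool, (c + signedSum f) ⬝ᵥ M *ᵥ (c + signedSum f)
      ≤ (c + (k : ℝ) • m) ⬝ᵥ M *ᵥ (c + (k : ℝ) • m)
        + k * ((∑ j, q j * (signedUnit (j, σ j) ⬝ᵥ M *ᵥ signedUnit (j, σ j))) - m ⬝ᵥ M *ᵥ m) := by
  induction k generalizing c with
  | zero => exact ⟨Fin.elim0, by simp [signedSum]⟩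
  | succ k ih =>
    -- The offset `c` is free in the induction: one copy of `m` waits in it while the other `k` are
    -- replaced by signed coordinate vectors, and is replaced last.
    obtain ⟨f, hf⟩ := ih (c + m)
    set V := (∑ j, q j * (signedUnit (j, σ j) ⬝ᵥ M *ᵥ signedUnit (j, σ j))) - m ⬝ᵥ M *ᵥ m with hV
    set d := c + signedSum f with hd
    have hexp : ∀ x y : J → ℝ, (x + y) ⬝ᵥ M *ᵥ (x + y)
        = x ⬝ᵥ M *ᵥ x + (x ⬝ᵥ M *ᵥ y + y ⬝ᵥ M *ᵥ x) + y ⬝ᵥ M *ᵥ y := by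
      intro x y
      simp only [mulVec_add, add_dotProduct, dotProduct_add]
      ring
    -- Averaged over the random signed unit, the form at `d + unit` is the form at the mean plus the
    -- variance `V`; some coordinate does no worse than the average.
    have havg : ∑ j, q j * ((d + signedUnit (j, σ j)) ⬝ᵥ M *ᵥ (d + signedUnit (j, σ j)))
        = (d + m) ⬝ᵥ M *ᵥ (d + m) + V := by
      have h1 : d ⬝ᵥ M *ᵥ m = ∑ j, q j * (d ⬝ᵥ M *ᵥ signedUnit (j, σ j)) := by
        rw [hm, mulVec_sum, dotProduct_sum]
        exact Finset.sum_congr rfl fun j _ => by rw [mulVec_smul, dotProduct_smul, smul_eq_mul]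
      have h2 : m ⬝ᵥ M *ᵥ d = ∑ j, q j * (signedUnit (j, σ j) ⬝ᵥ M *ᵥ d) := by
        rw [hm, sum_dotProduct]
        exact Finset.sum_congr rfl fun j _ => by rw [smul_dotProduct, smul_eq_mul]
      rw [hexp d m, h1, h2, hV]
      simp only [hexp d, mul_add, Finset.sum_add_distrib]
      rw [← Finset.sum_mul, hq1]
      ring
    obtain ⟨j, hj⟩ : ∃ j, (d + signedUnit (j, σ j)) ⬝ᵥ M *ᵥ (d + signedUnit (j, σ j))
        ≤ (d + m) ⬝ᵥ M *ᵥ (d + m) + V := by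
      by_contra! hcon
      have hlt : ∑ j, q j * ((d + m) ⬝ᵥ M *ᵥ (d + m) + V)
          < ∑ j, q j * ((d + signedUnit (j, σ j)) ⬝ᵥ M *ᵥ (d + signedUnit (j, σ j))) := by
        obtain ⟨j, hj, hjpos⟩ : ∃ j ∈ Finset.univ, 0 < q j := by
          by_contra! hcon
          linarith [Finset.sum_nonpos hcon]
        exact Finset.sum_lt_sum (fun j _ => mul_le_mul_of_nonneg_left (hcon j).le (hq j))
          ⟨j, hj, mul_lt_mul_of_pos_left (hcon j) hjpos⟩
      rw [havg, ← Finset.sum_mul, hq1, one_mul] at hlt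
      exact lt_irrefl _ hlt
    refine ⟨Fin.snoc f (j, σ j), ?_⟩
    have hs : c + signedSum (Fin.snoc f (j, σ j)) = d + signedUnit (j, σ j) := by
      simp only [signedSum, Fin.sum_univ_castSucc, Fin.snoc_castSucc, Fin.snoc_last, hd, add_assoc]
    rw [hs]
    have he1 : d + m = c + m + signedSum f := by rw [hd]; abel
    have he2 : c + ((k + 1 : ℕ) : ℝ) • m = c + m + (k : ℝ) • m := by
      push_cast; rw [add_smul, one_smul]; abel
    rw [he2]
    rw [he1] at hj
    push_cast
    linarith

lemma signedUnit_quadForm (M : Matrix J J ℝ) (j : J) (b : Bool) :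
    signedUnit (j, b) ⬝ᵥ M *ᵥ signedUnit (j, b) = M j j := by
  cases b <;> simp [signedUnit, single_dotProduct]

/-- A quadratic form that is nonnegative on sums of `k` signed coordinate vectors is almost
nonnegative everywhere. -/
lemma quadForm_ge_of_signedSum {M : Matrix J J ℝ} {D : ℝ} {k : ℕ} (hk : 2 ≤ k)
    (hM : ∀ f : Fin k → J × Bool, 0 ≤ signedSum f ⬝ᵥ M *ᵥ signedSum f)
    (hD : ∀ j, M j j ≤ D) (v : J → ℝ) :
    -(D / (k - 1) * (∑ j, |v j|) ^ 2) ≤ v ⬝ᵥ M *ᵥ v := by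
  set L := ∑ j, |v j| with hL
  rcases (Finset.sum_nonneg fun j _ => abs_nonneg (v j) : 0 ≤ L).eq_or_lt with h0 | hpos
  · have hv : v = 0 := by
      ext j
      have := (Finset.sum_eq_zero_iff_of_nonneg (fun j _ => abs_nonneg (v j))).1 h0.symm j
        (Finset.mem_univ _)
      simpa using this
    rw [hL, ← h0, hv]
    simp
  -- After division by its ℓ₁ norm, `v` is a convex combination of signed units.
  have hm : L⁻¹ • v = ∑ j, (|v j| / L) • signedUnit (j, decide (0 ≤ v j)) := by
    ext i
    rw [Finset.sum_apply, Finset.sum_eq_single i]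
    · simp only [signedUnit, Pi.smul_apply, Pi.single_eq_same, smul_eq_mul, decide_eq_true_eq]
      split_ifs with h
      · rw [abs_of_nonneg h]; ring
      · rw [abs_of_neg (not_le.1 h)]; ring
    · intro j _ hj
      simp [signedUnit, Pi.single_eq_of_ne hj.symm]
    · simp
  obtain ⟨f, hf⟩ := exists_signedSum_quadForm_le M (fun j => |v j| / L)
    (fun j => by positivity) (by rw [← Finset.sum_div, ← hL, div_self hpos.ne'])
    (fun j => decide (0 ≤ v j)) hm k 0
  simp only [zero_add, signedUnit_quadForm] at hf
  have h1 : ∑ j, |v j| / L * M j j ≤ D := by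
    calc _ ≤ ∑ j, |v j| / L * D :=
          Finset.sum_le_sum fun j _ => mul_le_mul_of_nonneg_left (hD j) (by positivity)
      _ = D := by rw [← Finset.sum_mul, ← Finset.sum_div, ← hL, div_self hpos.ne', one_mul]
  have h2 := (hM f).trans hf
  have hk' : (2 : ℝ) ≤ k := by exact_mod_cast hk
  have hsc : ∀ a : ℝ, (a • v) ⬝ᵥ M *ᵥ (a • v) = a ^ 2 * (v ⬝ᵥ M *ᵥ v) := by
    intro a
    rw [mulVec_smul, smul_dotProduct, dotProduct_smul, smul_eq_mul, smul_eq_mul]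
    ring
  rw [smul_smul, hsc, hsc] at h2
  set F := v ⬝ᵥ M *ᵥ v
  -- With `x = L⁻² F`, the form at the `k`-fold mean is `k² x` and the variance is at most `D - x`;
  -- the sum `k² x + k (D - x)` explains the factor `k - 1`.
  have h3 : 0 ≤ (k : ℝ) * ((k - 1) * (L⁻¹ ^ 2 * F) + D) := by nlinarith
  have h4 : 0 ≤ (k - 1) * (L⁻¹ ^ 2 * F) + D := by
    by_contra! hcon
    nlinarith
  have h5 : F = L ^ 2 * (L⁻¹ ^ 2 * F) := by
    rw [← mul_assoc, ← mul_pow, mul_inv_cancel₀ hpos.ne', one_pow, one_mul]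
  rw [h5]
  have hk1 : (0 : ℝ) < k - 1 := by linarith
  have h6 : -(D / (k - 1)) ≤ L⁻¹ ^ 2 * F := by
    rw [neg_le_iff_add_nonneg, ← mul_le_mul_iff_of_pos_left hk1]
    rw [mul_zero, mul_add, mul_div_cancel₀ _ hk1.ne']
    exact h4
  nlinarith [sq_nonneg L]

end Maurey

/-! ### Restricted eigenvalues of a Gaussian design. -/

section RestrictedEigenvalue

variable {n p : ℕ} {S : Type*} [MeasurableSpace S] {P : Measure S}
    [IsProbabilityMeasure P] {X : S → Matrix (Fin n) (Fin p) ℝ} {Ω : Matrix (Fin p) (Fin p) ℝ}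

lemma gram_quadForm {m ι : Type*} [Fintype m] [Fintype ι] (Y : Matrix m ι ℝ) (v : ι → ℝ) :
    v ⬝ᵥ (Yᵀ * Y) *ᵥ v = sqNorm (Y *ᵥ v) := by
  rw [sqNorm_eq_dotProduct, ← mulVec_mulVec, dotProduct_mulVec, vecMul_transpose]

/-- The design satisfies two-sided restricted eigenvalue bounds with slack `K ‖v‖₁²`. -/
def RestrictedBounds {m ι : Type*} [Fintype m] [Fintype ι] (N : ℝ) (Y : Matrix m ι ℝ)
    (T : Matrix ι ι ℝ) (K : ℝ) : Prop :=
  ∀ v : ι → ℝ, 1 / 2 * (v ⬝ᵥ T *ᵥ v) - K * (∑ j, |v j|) ^ 2 ≤ sqNorm (Y *ᵥ v) / N ∧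
    sqNorm (Y *ᵥ v) / N ≤ 2 * (v ⬝ᵥ T *ᵥ v) + K * (∑ j, |v j|) ^ 2

/-- Restricted eigenvalue bounds for linear combinations of the columns of a Gaussian sample. -/
lemma IsGaussianSample.real_not_restrictedBounds_le (hX : IsGaussianSample P X Ω)
    (hΩ : Ω.PosDef) (hn : 1 ≤ n) {J : Type*} [Fintype J] [DecidableEq J]
    (U : Matrix (Fin p) J ℝ) {D : ℝ} (hD : ∀ j, (Uᵀ * Ω⁻¹ * U) j j ≤ D) {k : ℕ} (hk : 2 ≤ k) :
    P.real {ω | ¬ RestrictedBounds n (X ω * U) (Uᵀ * Ω⁻¹ * U) (2 * D / (k - 1))}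
      ≤ (2 * (2 * Fintype.card J) ^ k + Fintype.card J) * Real.exp (-(n / 32 : ℝ)) := by
  have hn0 : (0 : ℝ) < n := by exact_mod_cast hn
  set T := Uᵀ * Ω⁻¹ * U with hT
  have hTq : ∀ v, v ⬝ᵥ T *ᵥ v = (U *ᵥ v) ⬝ᵥ Ω⁻¹ *ᵥ (U *ᵥ v) := by
    intro v
    rw [hT, ← mulVec_mulVec, ← mulVec_mulVec, dotProduct_mulVec, vecMul_transpose]
  have hlow : ∀ v : J → ℝ, P.real {ω | sqNorm ((X ω * U) *ᵥ v) < 1 / 2 * (n * (v ⬝ᵥ T *ᵥ v))}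
      ≤ Real.exp (-(n / 32 : ℝ)) := by
    intro v
    have := (hX.real_sqNorm_tails hΩ (U *ᵥ v) (t := 1 / 2) (by norm_num) (by norm_num)).2
    rw [hTq]
    simp only [← mulVec_mulVec]
    rw [show (1 : ℝ) / 2 = 1 - 1 / 2 by norm_num]
    refine this.trans (Real.exp_le_exp.2 ?_)
    linarith
  have hup : ∀ v : J → ℝ, P.real {ω | 2 * (n * (v ⬝ᵥ T *ᵥ v)) < sqNorm ((X ω * U) *ᵥ v)}
      ≤ Real.exp (-(n / 32 : ℝ)) := by
    intro v
    have := (hX.real_sqNorm_tails hΩ (U *ᵥ v) (t := 1) (by norm_num) (by norm_num)).1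
    rw [hTq]
    simp only [← mulVec_mulVec]
    rw [show (2 : ℝ) = 1 + 1 by norm_num]
    refine this.trans (Real.exp_le_exp.2 ?_)
    linarith
  -- Off finitely many events both forms `YᵀY/n - T/2` and `2T - YᵀY/n` are nonnegative on the
  -- `(2|J|)^k` signed sums, and the transfer to all vectors applies. The extra events for single
  -- coordinates bound the diagonal of the first form by `2 D`.
  have hsub : {ω | ¬ RestrictedBounds n (X ω * U) T (2 * D / (k - 1))} ⊆
      (⋃ f : Fin k → J × Bool, ({ω | sqNorm ((X ω * U) *ᵥ signedSum f)
          < 1 / 2 * (n * (signedSum f ⬝ᵥ T *ᵥ signedSum f))} ∪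
        {ω | 2 * (n * (signedSum f ⬝ᵥ T *ᵥ signedSum f)) < sqNorm ((X ω * U) *ᵥ signedSum f)})) ∪
      ⋃ j : J, {ω | 2 * (n * (signedUnit (j, true) ⬝ᵥ T *ᵥ signedUnit (j, true)))
        < sqNorm ((X ω * U) *ᵥ signedUnit (j, true))} := by
    intro ω hω
    by_contra hcon
    apply hω
    simp only [Set.mem_union, Set.mem_iUnion, Set.mem_ofPred_eq, not_or, not_exists, not_lt] at hcon
    obtain ⟨h1, h2⟩ := hcon
    set Y := X ω * U
    intro v
    have hgram : ∀ z, z ⬝ᵥ ((1 / (n : ℝ)) • (Yᵀ * Y)) *ᵥ z = sqNorm (Y *ᵥ z) / n := by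
      intro z
      rw [smul_mulVec, dotProduct_smul, gram_quadForm, smul_eq_mul]
      ring
    have hTjj : ∀ j, T j j = signedUnit (j, true) ⬝ᵥ T *ᵥ signedUnit (j, true) := fun j =>
      (signedUnit_quadForm T j true).symm
    have hT0 : ∀ j, 0 ≤ T j j := fun j => by
      rw [hTjj, hTq]; exact covForm_nonneg hΩ _
    constructor
    · have := quadForm_ge_of_signedSum (M := (1 / (n : ℝ)) • (Yᵀ * Y) - (1 / 2 : ℝ) • T)
        (D := 2 * D) hk (fun f => ?_) (fun j => ?_) v
      · rw [sub_mulVec, dotProduct_sub, hgram, smul_mulVec, dotProduct_smul, smul_eq_mul] at this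
        linarith
      · rw [sub_mulVec, dotProduct_sub, hgram, smul_mulVec, dotProduct_smul, smul_eq_mul,
          sub_nonneg, le_div_iff₀ hn0]
        linarith [(h1 f).1]
      · have h3 := h2 j
        rw [← hTjj] at h3
        refine (signedUnit_quadForm _ j true).symm.trans_le ?_
        rw [sub_mulVec, dotProduct_sub, hgram, smul_mulVec,
          dotProduct_smul, smul_eq_mul, ← hTjj]
        have h4 : sqNorm (Y *ᵥ signedUnit (j, true)) / n ≤ 2 * T j j := by
          rw [div_le_iff₀ hn0]; linarith
        linarith [hD j, hT0 j]
    · have := quadForm_ge_of_signedSum (M := (2 : ℝ) • T - (1 / (n : ℝ)) • (Yᵀ * Y))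
        (D := 2 * D) hk (fun f => ?_) (fun j => ?_) v
      · rw [sub_mulVec, dotProduct_sub, hgram, smul_mulVec, dotProduct_smul, smul_eq_mul] at this
        linarith
      · rw [sub_mulVec, dotProduct_sub, hgram, smul_mulVec, dotProduct_smul, smul_eq_mul,
          sub_nonneg, div_le_iff₀ hn0]
        linarith [(h1 f).2]
      · refine (signedUnit_quadForm _ j true).symm.trans_le ?_
        rw [sub_mulVec, dotProduct_sub, hgram, smul_mulVec,
          dotProduct_smul, smul_eq_mul, ← hTjj]
        have h4 : 0 ≤ sqNorm (Y *ᵥ signedUnit (j, true)) / n := by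
          have := sqNorm_nonneg (Y *ᵥ signedUnit (j, true))
          positivity
        linarith [hD j, hT0 j]
  refine (measureReal_mono hsub).trans ((measureReal_union_le _ _).trans ?_)
  have hA := measureReal_iUnion_fintype_le (μ := P) fun f : Fin k → J × Bool =>
    ({ω | sqNorm ((X ω * U) *ᵥ signedSum f)
          < 1 / 2 * (n * (signedSum f ⬝ᵥ T *ᵥ signedSum f))} ∪
        {ω | 2 * (n * (signedSum f ⬝ᵥ T *ᵥ signedSum f)) < sqNorm ((X ω * U) *ᵥ signedSum f)})
  have hB := measureReal_iUnion_fintype_le (μ := P) fun j : J =>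
    {ω | 2 * (n * (signedUnit (j, true) ⬝ᵥ T *ᵥ signedUnit (j, true)))
        < sqNorm ((X ω * U) *ᵥ signedUnit (j, true))}
  have hA' := hA.trans (Finset.sum_le_sum fun f _ => (measureReal_union_le _ _).trans
    (add_le_add (hlow (signedSum f)) (hup (signedSum f))))
  have hB' := hB.trans (Finset.sum_le_sum fun j _ => hup (signedUnit (j, true)))
  simp only [Finset.sum_const, Finset.card_univ, nsmul_eq_mul, Fintype.card_fun,
    Fintype.card_prod, Fintype.card_bool, Fintype.card_fin] at hA' hB'
  push_cast at hA' hB'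
  calc _ ≤ _ := add_le_add hA' hB'
    _ = _ := by rw [mul_comm (Fintype.card J : ℝ) 2]; ring

end RestrictedEigenvalue

end PrecisionInference

namespace PrecisionInference

open Matrix

/-! ### Algebra of the regression of `X_A` on the other columns. -/

section RegressionAlgebra

variable {n p : ℕ}

/-- The inclusion of the coordinates in `A`. -/
def inclIn (A : Finset (Fin p)) : Matrix (Fin p) {m // m ∈ A} ℝ :=
  (1 : Matrix (Fin p) (Fin p) ℝ).submatrix id Subtype.val

/-- The inclusion of the coordinates outside `A`. -/
def inclOut (A : Finset (Fin p)) : Matrix (Fin p) {k // k ∉ A} ℝ :=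
  (1 : Matrix (Fin p) (Fin p) ℝ).submatrix id Subtype.val

/-- The coefficients of the regression errors: `ε_A = X * residDir Ω A`. -/
noncomputable def residDir (Ω : Matrix (Fin p) (Fin p) ℝ) (A : Finset (Fin p)) :
    Matrix (Fin p) {m // m ∈ A} ℝ :=
  Ω * inclIn A * theta Ω A

lemma mul_inclIn {ι : Type*} (X : Matrix ι (Fin p) ℝ) (A : Finset (Fin p)) :
    X * inclIn A = X.submatrix id Subtype.val := by
  ext r m
  simp [inclIn, Matrix.mul_apply, Matrix.one_apply]

lemma mul_inclOut {ι : Type*} (X : Matrix ι (Fin p) ℝ) (A : Finset (Fin p)) :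
    X * inclOut A = X.submatrix id Subtype.val := by
  ext r m
  simp [inclOut, Matrix.mul_apply, Matrix.one_apply]

lemma inclIn_transpose_mul {ι : Type*} (X : Matrix (Fin p) ι ℝ) (A : Finset (Fin p)) :
    (inclIn A)ᵀ * X = X.submatrix Subtype.val id := by
  ext r m
  simp [inclIn, Matrix.mul_apply, Matrix.one_apply]

lemma inclOut_transpose_mul {ι : Type*} (X : Matrix (Fin p) ι ℝ) (A : Finset (Fin p)) :
    (inclOut A)ᵀ * X = X.submatrix Subtype.val id := by
  ext r m
  simp [inclOut, Matrix.mul_apply, Matrix.one_apply]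

lemma incl_resolution (A : Finset (Fin p)) :
    inclIn A * (inclIn A)ᵀ + inclOut A * (inclOut A)ᵀ = 1 := by
  ext i j
  simp only [Matrix.add_apply, Matrix.mul_apply, Matrix.transpose_apply, inclIn, inclOut,
    Matrix.submatrix_apply]
  trans ∑ k, (1 : Matrix (Fin p) (Fin p) ℝ) i k * (1 : Matrix (Fin p) (Fin p) ℝ) j k
  · convert Fintype.sum_subtype_add_sum_subtype (fun k => k ∈ A)
      (fun k => (1 : Matrix (Fin p) (Fin p) ℝ) i k * (1 : Matrix (Fin p) (Fin p) ℝ) j k) using 2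
    all_goals exact Finset.sum_congr (by ext; simp) fun _ _ => rfl
  · simp [Matrix.one_apply]

lemma block_eq (Ω : Matrix (Fin p) (Fin p) ℝ) (A : Finset (Fin p)) :
    block Ω A = (inclIn A)ᵀ * Ω * inclIn A := by
  rw [inclIn_transpose_mul, mul_inclIn]; rfl

lemma block_posDef {Ω : Matrix (Fin p) (Fin p) ℝ} (hΩ : Ω.PosDef) (A : Finset (Fin p)) :
    (block Ω A).PosDef := hΩ.submatrix Subtype.val_injective

lemma block_mul_theta {Ω : Matrix (Fin p) (Fin p) ℝ} (hΩ : Ω.PosDef) (A : Finset (Fin p)) :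
    block Ω A * theta Ω A = 1 :=
  Matrix.mul_nonsing_inv _ ((Matrix.isUnit_iff_isUnit_det _).1 (block_posDef hΩ A).isUnit)

lemma theta_posDef {Ω : Matrix (Fin p) (Fin p) ℝ} (hΩ : Ω.PosDef) (A : Finset (Fin p)) :
    (theta Ω A).PosDef := (block_posDef hΩ A).inv

lemma inclIn_transpose_mul_residDir {Ω : Matrix (Fin p) (Fin p) ℝ} (hΩ : Ω.PosDef)
    (A : Finset (Fin p)) : (inclIn A)ᵀ * residDir Ω A = 1 := by
  rw [residDir, ← Matrix.mul_assoc, ← Matrix.mul_assoc, ← block_eq, block_mul_theta hΩ]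

lemma inv_mul_residDir {Ω : Matrix (Fin p) (Fin p) ℝ} (hΩ : Ω.PosDef) (A : Finset (Fin p)) :
    Ω⁻¹ * residDir Ω A = inclIn A * theta Ω A := by
  rw [residDir, ← Matrix.mul_assoc, ← Matrix.mul_assoc,
    Matrix.nonsing_inv_mul _ ((Matrix.isUnit_iff_isUnit_det _).1 hΩ.isUnit), Matrix.one_mul]

lemma residDir_cov {Ω : Matrix (Fin p) (Fin p) ℝ} (hΩ : Ω.PosDef) (A : Finset (Fin p)) :
    (residDir Ω A)ᵀ * Ω⁻¹ * residDir Ω A = theta Ω A := by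
  rw [Matrix.mul_assoc, inv_mul_residDir hΩ, ← Matrix.mul_assoc]
  have := congrArg Matrix.transpose (inclIn_transpose_mul_residDir hΩ A)
  rw [Matrix.transpose_mul, Matrix.transpose_transpose, Matrix.transpose_one] at this
  rw [this, Matrix.one_mul]

/-- The matrix `Ω⁻¹ * residDir Ω A` equals `inclIn A * theta Ω A`, whose rows outside `A` vanish.
For Gaussian data this makes the errors independent of the regressors. -/
lemma inclOut_cov_residDir {Ω : Matrix (Fin p) (Fin p) ℝ} (hΩ : Ω.PosDef) (A : Finset (Fin p)) :
    (inclOut A)ᵀ * Ω⁻¹ * residDir Ω A = 0 := by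
  rw [Matrix.mul_assoc, inv_mul_residDir hΩ, ← Matrix.mul_assoc, inclOut_transpose_mul]
  have : (inclIn A).submatrix (Subtype.val : {k // k ∉ A} → Fin p) id = 0 := by
    ext k m
    simp only [inclIn, Matrix.submatrix_apply, id, Matrix.zero_apply]
    exact Matrix.one_apply_ne fun h : k.1 = m.1 => k.2 (h ▸ m.2)
  rw [this, Matrix.zero_mul]

/-- The regression errors are linear combinations of the columns of the data matrix. -/
lemma resid_beta {Ω : Matrix (Fin p) (Fin p) ℝ} (hΩ : Ω.PosDef) (A : Finset (Fin p))
    (X : Matrix (Fin n) (Fin p) ℝ) : resid X A (beta Ω A) = X * residDir Ω A := by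
  have hb : beta Ω A = -((inclOut A)ᵀ * residDir Ω A) := by
    rw [inclOut_transpose_mul, residDir, mul_inclIn]
    rfl
  have h := congrArg (fun Y => X * (Y * residDir Ω A)) (incl_resolution A)
  simp only [Matrix.one_mul, Matrix.add_mul, Matrix.mul_add, Matrix.mul_assoc,
    inclIn_transpose_mul_residDir hΩ, Matrix.mul_one] at h
  rw [resid, hb, ← h, Matrix.mul_neg, sub_neg_eq_add, mul_inclIn, ← Matrix.mul_assoc X,
    mul_inclOut]
  rfl

/-- This and `covForm_cols` hold by definition; they turn matrix identities into the
column-by-column form that the laws of `X *ᵥ u` require. -/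
lemma mulVec_col {ι κ : Type*} [Fintype κ] (X : Matrix ι κ ℝ) {m : Type*} (U : Matrix κ m ℝ) (a : m) :
    X *ᵥ (fun k => U k a) = fun r => (X * U) r a := rfl

lemma covForm_cols {m m' : Type*} (U : Matrix (Fin p) m ℝ)
    (W : Matrix (Fin p) m' ℝ) (T : Matrix (Fin p) (Fin p) ℝ) (a : m) (b : m') :
    (fun k => U k a) ⬝ᵥ T *ᵥ (fun k => W k b) = (Uᵀ * T * W) a b := by
  rw [Matrix.mul_assoc]
  rfl

end RegressionAlgebra

/-! ### Correlations between the errors and the design. -/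

section NoiseEvent

variable {n p : ℕ} {S : Type*} [MeasurableSpace S] {P : Measure S}
    [IsProbabilityMeasure P] {X : S → Matrix (Fin n) (Fin p) ℝ} {Ω : Matrix (Fin p) (Fin p) ℝ}

/-- The correlations of the regression errors with the normalized design columns are at most `t`. -/
def NoiseBound (Ω : Matrix (Fin p) (Fin p) ℝ) (X : Matrix (Fin n) (Fin p) ℝ)
    (A : Finset (Fin p)) (t : ℝ) : Prop :=
  ∀ (k : {k // k ∉ A}) (m : {m // m ∈ A}),
    |∑ r, X r k.1 * resid X A (beta Ω A) r m|
      ≤ t * √(theta Ω A m m) * √(sqNorm fun r => X r k.1)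

lemma IsGaussianSample.real_not_noiseBound_le (hX : IsGaussianSample P X Ω) (hΩ : Ω.PosDef)
    (A : Finset (Fin p)) (hA : A.card = 2) {t : ℝ} (ht : 0 ≤ t) :
    P.real {ω | ¬ NoiseBound Ω (X ω) A t} ≤ 4 * p * Real.exp (-t ^ 2 / 2) := by
  have hsub : {ω | ¬ NoiseBound Ω (X ω) A t} ⊆ ⋃ q : {k // k ∉ A} × {m // m ∈ A},
      {ω | (t * √(theta Ω A q.2 q.2)) * √(sqNorm fun r => X ω r q.1.1)
        < |∑ r, X ω r q.1.1 * resid (X ω) A (beta Ω A) r q.2|} := by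
    intro ω hω
    simp only [NoiseBound, Set.mem_ofPred_eq, not_forall, not_le] at hω
    obtain ⟨k, m, h⟩ := hω
    exact Set.mem_iUnion.2 ⟨(k, m), h⟩
  refine (measureReal_mono hsub).trans ((measureReal_iUnion_fintype_le _).trans ?_)
  have hone : ∀ q : {k // k ∉ A} × {m // m ∈ A},
      P.real {ω | (t * √(theta Ω A q.2 q.2)) * √(sqNorm fun r => X ω r q.1.1)
        < |∑ r, X ω r q.1.1 * resid (X ω) A (beta Ω A) r q.2|} ≤ 2 * Real.exp (-t ^ 2 / 2) := by
    rintro ⟨k, m⟩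
    have hθ : 0 < theta Ω A m m := (theta_posDef hΩ A).diag_pos
    -- A column outside `A` and an error column are independent, so the self-normalized tail bound
    -- applies to their inner product. With two errors, at most `p` columns and two-sided tails, the
    -- union bound has the factor `4 p`.
    have horth := congrFun (congrFun (inclOut_cov_residDir hΩ A) k) m
    rw [← covForm_cols, Matrix.zero_apply] at horth
    have hl := hX.hasLaw_mulVec_pair hΩ _ _ horth
    rw [covForm_cols (residDir Ω A), residDir_cov hΩ] at hl
    simp only [mulVec_col, mul_inclOut, ← resid_beta hΩ] at hl
    have := real_dotProduct_gt_le hl (t := t * √(theta Ω A m m)) (by positivity)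
    refine this.trans (le_of_eq ?_)
    rw [Real.coe_toNNReal _ hθ.le, mul_pow, Real.sq_sqrt hθ.le]
    congr 2
    rw [← neg_mul, mul_div_mul_right _ _ hθ.ne']
  refine (Finset.sum_le_sum fun q _ => hone q).trans ?_
  simp only [Finset.sum_const, Finset.card_univ, Fintype.card_prod, nsmul_eq_mul]
  have h1 : (Fintype.card {m // m ∈ A} : ℝ) = 2 := by rw [Fintype.card_coe, hA]; norm_num
  have h2 : (Fintype.card {k // k ∉ A} : ℝ) ≤ p := by
    have := Fintype.card_subtype_le fun k : Fin p => k ∉ A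
    rw [Fintype.card_fin] at this
    exact_mod_cast this
  push_cast
  rw [h1]
  nlinarith [Real.exp_pos (-t ^ 2 / 2)]

end NoiseEvent

/-! ### Plug-in against oracle residual covariance. -/

section OracleComparison

variable {n p : ℕ}

lemma matSup_le {ι κ : Type*} [Fintype ι] [Fintype κ] {B : Matrix ι κ ℝ} {a : ℝ}
    (h : ∀ i j, |B i j| ≤ a) (ha : 0 ≤ a) : matSup B ≤ a :=
  Real.iSup_le (fun q => h q.1 q.2) ha

lemma resid_eq (X : Matrix (Fin n) (Fin p) ℝ) (A : Finset (Fin p))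
    (b b' : Matrix {k // k ∉ A} {m // m ∈ A} ℝ) :
    resid X A b = resid X A b' - colsOut X A * (b - b') := by
  simp only [resid, Matrix.mul_sub]
  abel

/-- The cross term of the regression errors and a prediction error. -/
lemma abs_cross_le {Ω : Matrix (Fin p) (Fin p) ℝ} {X : Matrix (Fin n) (Fin p) ℝ}
    {A : Finset (Fin p)} {t L : ℝ} (ht : 0 ≤ t) (hn : 1 ≤ n) (hN : NoiseBound Ω X A t)
    (hL : ∀ m, theta Ω A m m ≤ L) (Δ : Matrix {k // k ∉ A} {m // m ∈ A} ℝ)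
    (m l : {m // m ∈ A}) :
    |∑ r, resid X A (beta Ω A) r m * (colsOut X A * Δ) r l|
      ≤ t * √L * √n * matL1 (rootDiag X A * Δ) := by
  have hn0 : (0 : ℝ) < n := by exact_mod_cast hn
  -- Expanding the prediction error over columns prepares Hölder: `NoiseBound` controls the inner
  -- products, and the column norms it leaves become the ℓ₁ weights of `rootDiag`.
  have h1 : ∑ r, resid X A (beta Ω A) r m * (colsOut X A * Δ) r l
      = ∑ k, (∑ r, X r k.1 * resid X A (beta Ω A) r m) * Δ k l := by
    simp only [Matrix.mul_apply, Finset.mul_sum, Finset.sum_mul]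
    rw [Finset.sum_comm]
    refine Finset.sum_congr rfl fun k _ => Finset.sum_congr rfl fun r _ => ?_
    simp only [colsOut, Matrix.submatrix_apply, id]
    ring
  rw [h1]
  calc _ ≤ ∑ k, |(∑ r, X r k.1 * resid X A (beta Ω A) r m) * Δ k l| :=
        Finset.abs_sum_le_sum_abs _ _
    _ ≤ ∑ k : {k // k ∉ A}, t * √L * √n * |(rootDiag X A * Δ) k l| := by
        refine Finset.sum_le_sum fun k _ => ?_
        rw [abs_mul, rootDiag, Matrix.diagonal_mul, abs_mul, abs_of_nonneg (Real.sqrt_nonneg _)]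
        have h2 : √n * √(sqNorm (fun r => X r k.1) / n) = √(sqNorm fun r => X r k.1) := by
          rw [← Real.sqrt_mul hn0.le, mul_div_cancel₀ _ hn0.ne']
        calc _ ≤ t * √L * √(sqNorm fun r => X r k.1) * |Δ k l| := by
              refine mul_le_mul_of_nonneg_right ((hN k m).trans ?_) (abs_nonneg _)
              gcongr
              exact hL m
          _ = _ := by rw [← h2]; ring
    _ = t * √L * √n * ∑ k, |(rootDiag X A * Δ) k l| := by rw [Finset.mul_sum]
    _ ≤ _ := by
        refine mul_le_mul_of_nonneg_left ?_ (by positivity)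
        exact Finset.sum_le_sum fun k _ => Finset.single_le_sum
          (f := fun b => |(rootDiag X A * Δ) k b|) (fun _ _ => abs_nonneg _) (Finset.mem_univ l)

/-- Row by row, `2|xy| ≤ x² + y²` and each square is at most the whole row sum, which also covers `m
= l`. -/
lemma abs_gram_entry_le {ι κ : Type*} [Fintype ι] [Fintype κ] (B : Matrix ι κ ℝ) (m l : κ) :
    |∑ r, B r m * B r l| ≤ matSqNorm B := by
  calc _ ≤ ∑ r, |B r m * B r l| := Finset.abs_sum_le_sum_abs _ _
    _ ≤ ∑ r, ∑ b, B r b ^ 2 := by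
        refine Finset.sum_le_sum fun r _ => ?_
        have h : ∀ a, B r a ^ 2 ≤ ∑ b, B r b ^ 2 := fun a => Finset.single_le_sum
          (f := fun b => B r b ^ 2) (fun _ _ => sq_nonneg _) (Finset.mem_univ a)
        have hm := h m
        have hl := h l
        rw [abs_mul]
        nlinarith [sq_nonneg (|B r m| - |B r l|), sq_abs (B r m), sq_abs (B r l)]

lemma residCov_apply (X : Matrix (Fin n) (Fin p) ℝ) (A : Finset (Fin p))
    (b : Matrix {k // k ∉ A} {m // m ∈ A} ℝ) (m l : {m // m ∈ A}) :
    residCov X A b m l = (∑ r, resid X A b r m * resid X A b r l) / n := by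
  simp only [residCov, Matrix.smul_apply, Matrix.mul_apply, Matrix.transpose_apply, smul_eq_mul]
  ring

/-- Comparison of the plug-in and the oracle residual covariances on the noise event. -/
lemma abs_residCov_sub_le {Ω : Matrix (Fin p) (Fin p) ℝ} {X : Matrix (Fin n) (Fin p) ℝ}
    {A : Finset (Fin p)} {t L : ℝ} (ht : 0 ≤ t) (hn : 1 ≤ n) (hN : NoiseBound Ω X A t)
    (hL : ∀ m, theta Ω A m m ≤ L) (b : Matrix {k // k ∉ A} {m // m ∈ A} ℝ)
    (m l : {m // m ∈ A}) :
    |residCov X A b m l - thetaOra Ω X A m l|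
      ≤ (2 * (t * √L * √n * matL1 (rootDiag X A * (b - beta Ω A)))
        + matSqNorm (colsOut X A * (b - beta Ω A))) / n := by
  have hn0 : (0 : ℝ) < n := by exact_mod_cast hn
  have h1 := abs_cross_le ht hn hN hL (b - beta Ω A) m l
  have h2 := abs_cross_le ht hn hN hL (b - beta Ω A) l m
  have h3 := abs_gram_entry_le (colsOut X A * (b - beta Ω A)) m l
  rw [thetaOra, residCov_apply, residCov_apply, ← sub_div, abs_div, abs_of_pos hn0]
  refine div_le_div_of_nonneg_right ?_ hn0.le
  set E := resid X A (beta Ω A)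
  set D := colsOut X A * (b - beta Ω A)
  have h4 : ∑ r, resid X A b r m * resid X A b r l - ∑ r, E r m * E r l
      = -(∑ r, E r m * D r l) - (∑ r, E r l * D r m) + ∑ r, D r m * D r l := by
    rw [resid_eq X A b (beta Ω A)]
    simp only [Matrix.sub_apply, ← Finset.sum_sub_distrib, ← Finset.sum_neg_distrib,
      ← Finset.sum_add_distrib]
    exact Finset.sum_congr rfl fun r _ => by ring
  rw [h4]
  rw [abs_le] at *
  constructor <;> linarith

end OracleComparison

end PrecisionInference

namespace PrecisionInference

open Matrix

/-! ### Inverses of matrices with bounded quadratic forms. -/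

section InversePerturbation

variable {ι : Type*} [Fintype ι]

lemma sum_abs_sq_le (x : ι → ℝ) : (∑ i, |x i|) ^ 2 ≤ Fintype.card ι * sqNorm x := by
  have := sq_sum_le_card_mul_sum_sq (s := Finset.univ) (f := fun i => |x i|)
  simpa [sqNorm] using this

lemma abs_quadForm_le {B : Matrix ι ι ℝ} {η : ℝ} (hB : ∀ i j, |B i j| ≤ η) (x : ι → ℝ) :
    |x ⬝ᵥ B *ᵥ x| ≤ η * (∑ i, |x i|) ^ 2 := by
  simp only [dotProduct, mulVec, Finset.mul_sum]
  calc _ ≤ ∑ i, |∑ j, x i * (B i j * x j)| := Finset.abs_sum_le_sum_abs _ _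
    _ ≤ ∑ i, ∑ j, |x i * (B i j * x j)| :=
        Finset.sum_le_sum fun i _ => Finset.abs_sum_le_sum_abs _ _
    _ ≤ ∑ i, ∑ j, η * (|x i| * |x j|) := by
        refine Finset.sum_le_sum fun i _ => Finset.sum_le_sum fun j _ => ?_
        rw [abs_mul, abs_mul]
        nlinarith [mul_le_mul_of_nonneg_right (hB i j)
          (mul_nonneg (abs_nonneg (x i)) (abs_nonneg (x j)))]
    _ = _ := by
        rw [sq, Finset.sum_mul_sum, Finset.mul_sum]
        exact Finset.sum_congr rfl fun i _ => (Finset.mul_sum _ _ _).symm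

variable [DecidableEq ι]

lemma isUnit_det_of_quadForm {Q : Matrix ι ι ℝ} {a : ℝ} (ha : 0 < a)
    (hQ : ∀ x : ι → ℝ, a * sqNorm x ≤ x ⬝ᵥ Q *ᵥ x) : IsUnit Q.det := by
  rw [isUnit_iff_ne_zero]
  intro h0
  obtain ⟨v, hv, hv0⟩ := Matrix.exists_mulVec_eq_zero_iff.2 h0
  have h := hQ v
  rw [hv0, dotProduct_zero] at h
  have hs : sqNorm v = 0 := le_antisymm (by nlinarith) (sqNorm_nonneg v)
  rw [sqNorm_eq_dotProduct] at hs
  exact hv (dotProduct_self_eq_zero.1 hs)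

/-- Entries of the inverse of a matrix whose quadratic form is bounded from below. -/
lemma abs_inv_apply_le {Q : Matrix ι ι ℝ} {a : ℝ} (ha : 0 < a)
    (hQ : ∀ x : ι → ℝ, a * sqNorm x ≤ x ⬝ᵥ Q *ᵥ x) (k l : ι) : |Q⁻¹ k l| ≤ 1 / a := by
  have hu := isUnit_det_of_quadForm ha hQ
  -- For the `l`-th column of the inverse, `x ⬝ᵥ Q *ᵥ x` is just `x l`. Hence `a ‖x‖² ≤ x l`, which
  -- gives first `a x l ≤ 1` and then `(a x k)² ≤ 1`; symmetry of `Q` plays no role.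
  set x : ι → ℝ := fun i => Q⁻¹ i l with hx
  have hQx : Q *ᵥ x = Pi.single l 1 := by
    ext i
    have := congrFun (congrFun (Matrix.mul_nonsing_inv Q hu) i) l
    rw [Matrix.one_apply] at this
    rw [Pi.single_apply]
    exact this
  have h := hQ x
  rw [hQx, dotProduct_single_one] at h
  have hsing : ∀ i, x i ^ 2 ≤ sqNorm x := fun i =>
    Finset.single_le_sum (f := fun i => x i ^ 2) (fun _ _ => sq_nonneg _) (Finset.mem_univ i)
  have hl : a * x l ≤ 1 := by
    by_contra! hcon
    have : 0 < x l := by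
      by_contra! h0
      nlinarith
    nlinarith [hsing l]
  have hk : (a * x k) ^ 2 ≤ 1 := by
    calc (a * x k) ^ 2 = a * (a * x k ^ 2) := by ring
      _ ≤ a * (a * sqNorm x) := by gcongr; exact hsing k
      _ ≤ a * x l := by gcongr
      _ ≤ 1 := hl
  have := abs_le_one_iff_mul_self_le_one.2 (by nlinarith : a * x k * (a * x k) ≤ 1)
  rw [abs_mul, abs_of_pos ha] at this
  rw [le_div_iff₀ ha, mul_comm]
  exact this

/-- Perturbation of the inverse of a `2 × 2` matrix. -/
lemma abs_inv_sub_inv_apply_le (hc : Fintype.card ι = 2) {Q R : Matrix ι ι ℝ} {a η : ℝ}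
    (ha : 0 < a) (hQ : ∀ x : ι → ℝ, a * sqNorm x ≤ x ⬝ᵥ Q *ᵥ x)
    (hQR : ∀ i j, |(R - Q) i j| ≤ η) (hη : 4 * η ≤ a) (k l : ι) :
    |(R⁻¹ - Q⁻¹) k l| ≤ 8 / a ^ 2 * η := by
  -- In dimension two the perturbation changes the form by at most `2 η ‖x‖² ≤ (a / 2) ‖x‖²`.
  have hR : ∀ x : ι → ℝ, a / 2 * sqNorm x ≤ x ⬝ᵥ R *ᵥ x := by
    intro x
    have h1 := abs_quadForm_le hQR x
    have h2 := sum_abs_sq_le x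
    rw [sub_mulVec, dotProduct_sub, abs_le] at h1
    rw [hc] at h2
    push_cast at h2
    have h3 := hQ x
    have hη0 : 0 ≤ η := (abs_nonneg _).trans (hQR k l)
    nlinarith [sqNorm_nonneg x, mul_le_mul_of_nonneg_left h2 hη0]
  have hdec : R⁻¹ - Q⁻¹ = R⁻¹ * (Q - R) * Q⁻¹ := by
    rw [Matrix.mul_sub, Matrix.sub_mul, Matrix.nonsing_inv_mul _ (isUnit_det_of_quadForm
      (by positivity) hR), Matrix.mul_assoc, Matrix.mul_nonsing_inv _ (isUnit_det_of_quadForm ha hQ),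
      Matrix.one_mul, Matrix.mul_one]
  have hη0 : 0 ≤ η := (abs_nonneg _).trans (hQR k l)
  rw [hdec]
  simp only [Matrix.mul_apply, Finset.sum_mul]
  calc _ ≤ ∑ j, |∑ i, R⁻¹ k i * (Q - R) i j * Q⁻¹ j l| := Finset.abs_sum_le_sum_abs _ _
    _ ≤ ∑ j, ∑ i, |R⁻¹ k i * (Q - R) i j * Q⁻¹ j l| :=
        Finset.sum_le_sum fun i _ => Finset.abs_sum_le_sum_abs _ _
    -- Four terms, each at most `(2 / a) η (1 / a)`, give the constant `8 / a²`.
    _ ≤ ∑ _j : ι, ∑ _i : ι, 1 / (a / 2) * η * (1 / a) := by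
        refine Finset.sum_le_sum fun j _ => Finset.sum_le_sum fun i _ => ?_
        rw [abs_mul, abs_mul]
        have h1 := abs_inv_apply_le (by positivity) hR k i
        have h2 := abs_inv_apply_le ha hQ j l
        have h3 : |(Q - R) i j| ≤ η := by
          rw [← neg_sub, Matrix.neg_apply, abs_neg]; exact hQR i j
        gcongr
    _ = 8 / a ^ 2 * η := by
        simp only [Finset.sum_const, Finset.card_univ, hc, nsmul_eq_mul]
        push_cast
        field_simp
        ring

/-- A lower bound for the quadratic form of the inverse of a positive definite matrix. -/
lemma inv_quadForm_ge {B : Matrix ι ι ℝ} (hB : B.PosDef) {L : ℝ} (hL : 0 < L)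
    (hBL : ∀ x : ι → ℝ, x ⬝ᵥ B *ᵥ x ≤ L * sqNorm x) (v : ι → ℝ) :
    1 / L * sqNorm v ≤ v ⬝ᵥ B⁻¹ *ᵥ v := by
  have hu := (Matrix.isUnit_iff_isUnit_det _).1 hB.isUnit
  -- Nonnegativity of the form at `v - L B⁻¹ v` reads `vᵀBv - 2 L ‖v‖² + L² vᵀB⁻¹v ≥ 0`, and `vᵀBv ≤
  -- L ‖v‖²`.
  have h := hB.posSemidef.dotProduct_mulVec_nonneg (v - L • (B⁻¹ *ᵥ v))
  have h1 : B *ᵥ (v - L • (B⁻¹ *ᵥ v)) = B *ᵥ v - L • v := by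
    rw [mulVec_sub, mulVec_smul, mulVec_mulVec, Matrix.mul_nonsing_inv _ hu, one_mulVec]
  have h2 : B⁻¹ *ᵥ v ⬝ᵥ B *ᵥ v = v ⬝ᵥ v := by
    rw [dotProduct_mulVec, ← mulVec_transpose, mulVec_mulVec]
    have : Bᵀ = B := show B.IsSymm by simpa using hB.isHermitian
    rw [this, Matrix.mul_nonsing_inv _ hu, one_mulVec]
  simp only [star_trivial] at h
  rw [h1, sub_dotProduct, dotProduct_sub, dotProduct_sub, smul_dotProduct, smul_dotProduct,
    dotProduct_smul, dotProduct_smul, h2, ← sqNorm_eq_dotProduct, dotProduct_comm _ v] at h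
  simp only [smul_eq_mul] at h
  have h3 := hBL v
  rw [div_mul_eq_mul_div, one_mul, div_le_iff₀ hL]
  nlinarith

/-- The form at `e_i ± e_j` is nonnegative. -/
lemma abs_apply_le_of_posSemidef {B : Matrix ι ι ℝ} (hB : B.PosSemidef) {L : ℝ}
    (hL : ∀ i, B i i ≤ L) (i j : ι) : |B i j| ≤ L := by
  have hsym : B j i = B i j := by
    have := hB.isHermitian.apply i j
    simpa using this
  have h : ∀ c : ℝ, 0 ≤ B i i + 2 * c * B i j + c ^ 2 * B j j := by
    intro c
    have := hB.dotProduct_mulVec_nonneg (Pi.single i 1 + Pi.single j c)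
    simp only [star_trivial, mulVec_add, add_dotProduct, dotProduct_add, single_dotProduct,
      mulVec_single, Pi.smul_apply, Matrix.col_apply, MulOpposite.smul_eq_mul_unop,
      MulOpposite.unop_op, one_mul] at this
    rw [hsym] at this
    linarith
  have h1 := h 1
  have h2 := h (-1)
  rw [abs_le]
  constructor <;> linarith [hL i, hL j]

end InversePerturbation

/-! ### Tail bounds for the plug-in estimators. -/

section OracleBounds

variable {n p : ℕ} {S : Type*} [MeasurableSpace S] {P : Measure S}
    {X : S → Matrix (Fin n) (Fin p) ℝ} {Ω : Matrix (Fin p) (Fin p) ℝ}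

lemma log_natCast_pos {p : ℕ} (hp : 2 ≤ p) : 1 / 2 < Real.log p := by
  have h : Real.log 2 ≤ Real.log p := Real.log_le_log (by norm_num) (by exact_mod_cast hp)
  linarith [Real.log_two_gt_d9]

lemma rpow_eq_exp_log {p : ℕ} (hp : 2 ≤ p) (x : ℝ) :
    (p : ℝ) ^ x = Real.exp (x * Real.log p) := by
  have : (0 : ℝ) < p := by exact_mod_cast (by omega : 0 < p)
  rw [Real.rpow_def_of_pos this, mul_comm]

/-- The noise event at level `√(4 δ log p)` fails with probability at most `4 p · p^{-2δ}`. This,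
and one more `p^{-2δ}` kept for the eigenvalue event of the precision bound, fits into the last term
of `tailBound` because `p^{-δ} ≤ 1 / p` and `√(2 log p) ≤ 4 p / 5`. -/
lemma tail_slack {p : ℕ} (hp : 2 ≤ p) {δ : ℝ} (hδ : 1 ≤ δ) :
    4 * p * Real.exp (-(2 * δ * Real.log p)) + Real.exp (-(2 * δ * Real.log p))
      ≤ 4 * (p : ℝ) ^ (-δ + 1) / √(2 * Real.log p) := by
  have hp' : (2 : ℝ) ≤ p := by exact_mod_cast hp
  have hlog := log_natCast_pos hp
  have hlogp : Real.log p ≤ p - 1 := Real.log_le_sub_one_of_pos (by linarith)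
  have hs : √(2 * Real.log p) ≤ 4 / 5 * p := by
    rw [Real.sqrt_le_left (by positivity)]
    nlinarith [sq_nonneg (p - 3 / 2 : ℝ)]
  have hs0 : 0 < √(2 * Real.log p) := Real.sqrt_pos.2 (by linarith)
  have hexp : Real.exp (-(δ * Real.log p)) ≤ 1 / p := by
    have : Real.exp (-(1 * Real.log p)) = 1 / p := by
      rw [one_mul, Real.exp_neg, Real.exp_log (by linarith), one_div]
    rw [← this]
    refine Real.exp_le_exp.2 ?_
    nlinarith
  have hpp : (p : ℝ) ^ (-δ + 1) = p * Real.exp (-(δ * Real.log p)) := by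
    rw [rpow_eq_exp_log hp, add_mul, one_mul, Real.exp_add, Real.exp_log (by linarith), mul_comm]
    ring_nf
  have h2 : Real.exp (-(2 * δ * Real.log p))
      = Real.exp (-(δ * Real.log p)) * Real.exp (-(δ * Real.log p)) := by
    rw [← Real.exp_add]; ring_nf
  set E := Real.exp (-(δ * Real.log p)) with hE
  have hE0 : 0 < E := Real.exp_pos _
  rw [h2, hpp, le_div_iff₀ hs0]
  have hEp : E * p ≤ 1 := by rwa [le_div_iff₀ (by linarith)] at hexp
  have hE1 : E * 2 ≤ 1 := by nlinarith
  calc (4 * p * (E * E) + E * E) * √(2 * Real.log p)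
      ≤ (4 * p * (E * E) + E * E) * (4 / 5 * p) := by gcongr
    _ = E * (p * (4 / 5 * (4 * (E * p) + E))) := by ring
    _ ≤ E * (p * 4) := by gcongr; linarith
    _ = _ := by ring

/-- The two events on which the plug-in estimator is compared with the oracle estimator. -/
lemma ErrorConditions.real_bad_le {βhat : CoefEstimator n p} {C₀ s δ ε : ℝ}
    (h : ErrorConditions P X Ω βhat C₀ s δ ε) {A : Finset (Fin p)} (hA : A.card = 2) :
    P.real ({ω | C₀ * s * δ * Real.log p ≤
        matSqNorm (colsOut (X ω) A * (βhat (X ω) A - beta Ω A))} ∪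
      {ω | C₀ * s * √(δ * Real.log p / n) ≤
        matL1 (rootDiag (X ω) A * (βhat (X ω) A - beta Ω A))})
      ≤ 6 * ε * (p : ℝ) ^ (-δ + 1) := by
  have h1 := h.prediction A hA
  have h2 := h.coefficients A hA
  -- No sign of `ε` is assumed; the first error condition forces it, and two copies of the bound can
  -- then be enlarged to six.
  have h0 : 0 ≤ (p : ℝ) ^ (-δ + 1) * ε := measureReal_nonneg.trans h1
  refine (measureReal_union_le _ _).trans ?_
  linarith

variable [IsProbabilityMeasure P]

/-- The origin of the constant `C₁ = (4 √Lθ + 1) C₀`: two cross terms at noise level `√(4 x)` and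
one quadratic term. -/
lemma cross_bound_arith {n : ℕ} (hn : 1 ≤ n) {C₀ s L x : ℝ} (hx : 0 ≤ x) :
    (2 * (√(4 * x) * √L * √n * (C₀ * s * √(x / n))) + C₀ * s * x) / n
      = (4 * √L + 1) * C₀ * s * (x / n) := by
  have hn0 : (0 : ℝ) < n := by exact_mod_cast hn
  have h4 : √(4 * x) = 2 * √x := by
    rw [Real.sqrt_mul (by norm_num), show (4 : ℝ) = 2 ^ 2 by norm_num, Real.sqrt_sq (by norm_num)]
  have h5 : √n * √(x / n) = √x := by
    rw [← Real.sqrt_mul hn0.le, mul_div_cancel₀ _ hn0.ne']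
  have h6 : √x * √x = x := Real.mul_self_sqrt hx
  rw [h4]
  have : 2 * (2 * √x * √L * √n * (C₀ * s * √(x / n))) = 4 * √L * C₀ * s * x := by
    calc _ = 4 * √L * C₀ * s * (√x * (√n * √(x / n))) := by ring
      _ = _ := by rw [h5, h6]
  rw [this]
  ring

/-- On the noise event, small prediction and coefficient errors give a small covariance error. -/
lemma abs_thetaHat_sub_thetaOra_le {βhat : CoefEstimator n p} {C₀ s δ L : ℝ} (hn : 1 ≤ n)
    {Y : Matrix (Fin n) (Fin p) ℝ} {A : Finset (Fin p)} (hx : 0 ≤ δ * Real.log p)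
    (hL : ∀ m, theta Ω A m m ≤ L) (hN : NoiseBound Ω Y A √(4 * (δ * Real.log p)))
    (h1 : matSqNorm (colsOut Y A * (βhat Y A - beta Ω A)) ≤ C₀ * s * δ * Real.log p)
    (h2 : matL1 (rootDiag Y A * (βhat Y A - beta Ω A)) ≤ C₀ * s * √(δ * Real.log p / n))
    (m l : {m // m ∈ A}) :
    |(thetaHat βhat Y A - thetaOra Ω Y A) m l|
      ≤ (4 * √L + 1) * C₀ * s * (δ * Real.log p / n) := by
  have h := abs_residCov_sub_le (Real.sqrt_nonneg _) hn hN hL (βhat Y A) m l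
  rw [← cross_bound_arith hn hx]
  refine h.trans ?_
  have : C₀ * s * δ * Real.log p = C₀ * s * (δ * Real.log p) := by ring
  rw [this] at h1
  gcongr

/-- The lower bound for the quadratic form of the oracle covariance estimator. -/
lemma thetaOra_quadForm_ge (hΩ : Ω.PosDef) {A : Finset (Fin p)} (hA : A.card = 2)
    {Y : Matrix (Fin n) (Fin p) ℝ} {Lω K : ℝ} (hLω : 0 < Lω) (hL : ∀ m, block Ω A m m ≤ Lω)
    (hK : 16 * Lω * K ≤ 1)
    (hR : RestrictedBounds n (Y * residDir Ω A) (theta Ω A) K) (x : {m // m ∈ A} → ℝ) :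
    1 / (8 * Lω) * sqNorm x ≤ x ⬝ᵥ thetaOra Ω Y A *ᵥ x := by
  have hc : (Fintype.card {m // m ∈ A} : ℝ) = 2 := by rw [Fintype.card_coe, hA]; norm_num
  have hB := block_posDef hΩ A
  -- A 2 × 2 block with diagonal at most `Lω` has form at most `2 Lω`, so `theta` has form at least
  -- `1 / (2 Lω)`. The restricted bound keeps half of it, and the slack removes at most half of the
  -- rest.
  have h1 : ∀ y : {m // m ∈ A} → ℝ, y ⬝ᵥ block Ω A *ᵥ y ≤ 2 * Lω * sqNorm y := by
    intro y
    have h2 := (le_abs_self _).trans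
      (abs_quadForm_le (abs_apply_le_of_posSemidef hB.posSemidef hL) y)
    have h3 := sum_abs_sq_le y
    rw [hc] at h3
    nlinarith
  have h2 := inv_quadForm_ge hB (by positivity) h1 x
  have h3 := (hR x).1
  have h4 := sum_abs_sq_le x
  rw [hc] at h4
  have h5 : x ⬝ᵥ thetaOra Ω Y A *ᵥ x = sqNorm ((Y * residDir Ω A) *ᵥ x) / n := by
    rw [thetaOra, residCov, resid_beta hΩ, smul_mulVec, dotProduct_smul, gram_quadForm,
      smul_eq_mul]
    ring
  rw [h5]
  refine le_trans ?_ h3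
  change 1 / (2 * Lω) * sqNorm x ≤ x ⬝ᵥ theta Ω A *ᵥ x at h2
  have h6 : K * (∑ j, |x j|) ^ 2 ≤ 1 / (8 * Lω) * sqNorm x := by
    have : K ≤ 1 / (16 * Lω) := by rw [le_div_iff₀ (by positivity)]; linarith
    calc K * (∑ j, |x j|) ^ 2 ≤ 1 / (16 * Lω) * (2 * sqNorm x) := by gcongr
      _ = _ := by field_simp; ring
  have h7 : 1 / 2 * (1 / (2 * Lω) * sqNorm x) = 2 * (1 / (8 * Lω) * sqNorm x) := by
    field_simp; ring
  linarith

/-- If the error bound is not positive, the error conditions are only possible when the remainder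
is large. -/
lemma ErrorConditions.one_le_of_nonpos {βhat : CoefEstimator n p} {C₀ s δ ε : ℝ}
    (h : ErrorConditions P X Ω βhat C₀ s δ ε) {A : Finset (Fin p)} (hA : A.card = 2)
    (hs : C₀ * s * δ * Real.log p ≤ 0) : 1 ≤ (p : ℝ) ^ (-δ + 1) * ε := by
  have h1 := h.prediction A hA
  have : {ω | C₀ * s * δ * Real.log p ≤
      matSqNorm (colsOut (X ω) A * (βhat (X ω) A - beta Ω A))} = Set.univ := by
    refine Set.eq_univ_of_forall fun ω => hs.trans ?_
    exact Finset.sum_nonneg fun _ _ => Finset.sum_nonneg fun _ _ => sq_nonneg _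
  rw [this] at h1
  simpa using h1

/-- Comparison of the plug-in and oracle covariance estimators. -/
lemma ErrorConditions.real_thetaHat_le {βhat : CoefEstimator n p} {C₀ s δ ε L : ℝ} (hC₀ : 0 < C₀)
    (hδ : 1 ≤ δ) (hn : 1 ≤ n) (hp : 2 ≤ p) (hΩ : Ω.PosDef) (hX : IsGaussianSample P X Ω)
    (h : ErrorConditions P X Ω βhat C₀ s δ ε) {A : Finset (Fin p)} (hA : A.card = 2)
    (hL : ∀ m, theta Ω A m m ≤ L) :
    P.real {ω | (4 * √L + 1) * C₀ * s * (δ * Real.log p / n) <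
      matSup (thetaHat βhat (X ω) A - thetaOra Ω (X ω) A)} ≤ tailBound ε δ p := by
  have hlog := log_natCast_pos hp
  have hx : 0 < δ * Real.log p := by nlinarith
  have htb : 0 ≤ 4 * (p : ℝ) ^ (-δ + 1) / √(2 * Real.log p) := by positivity
  -- For `s ≤ 0` the prediction condition concerns an event of full probability, so `tailBound` is
  -- at least one.
  rcases le_or_gt s 0 with hs | hs
  · have h1 := h.one_le_of_nonpos hA (by
      have : C₀ * s * δ * Real.log p = (C₀ * (δ * Real.log p)) * s := by ring
      rw [this]
      exact mul_nonpos_of_nonneg_of_nonpos (by positivity) hs)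
    refine measureReal_le_one.trans ?_
    rw [tailBound]
    linarith
  have hnoise := hX.real_not_noiseBound_le hΩ A hA (t := √(4 * (δ * Real.log p)))
    (Real.sqrt_nonneg _)
  rw [Real.sq_sqrt (by positivity), show -(4 * (δ * Real.log p)) / 2 = -(2 * δ * Real.log p) by
    ring] at hnoise
  have hslack := tail_slack hp hδ
  have hbad := h.real_bad_le hA
  have hexp := Real.exp_pos (-(2 * δ * Real.log p))
  refine (measureReal_mono (s₂ := ({ω | C₀ * s * δ * Real.log p ≤
        matSqNorm (colsOut (X ω) A * (βhat (X ω) A - beta Ω A))} ∪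
      {ω | C₀ * s * √(δ * Real.log p / n) ≤
        matL1 (rootDiag (X ω) A * (βhat (X ω) A - beta Ω A))}) ∪
      {ω | ¬ NoiseBound Ω (X ω) A √(4 * (δ * Real.log p))}) ?_).trans
    ((measureReal_union_le _ _).trans ?_)
  · intro ω hω
    by_contra hcon
    simp only [Set.mem_union, Set.mem_ofPred_eq, not_or, not_le, not_not] at hcon
    refine absurd hω (not_lt.2 (matSup_le (fun m l => abs_thetaHat_sub_thetaOra_le hn hx.le hL
      hcon.2 hcon.1.1.le hcon.1.2.le m l) (by positivity)))
  · rw [tailBound]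
    linarith

/-- Comparison of the plug-in and oracle precision estimators. -/
lemma ErrorConditions.real_omegaHat_le {C₀ Lθ Lω : ℝ} (hC₀ : 0 < C₀) (hLθ : 0 < Lθ)
    (hLω : 0 < Lω) :
    ∃ c₀ : ℝ, 0 < c₀ ∧ ∃ C : ℝ, 0 < C ∧ ∀ {δ : ℝ}, 1 ≤ δ → ∀ {n p : ℕ}, 1 ≤ n → 2 ≤ p →
      ∀ {s ε : ℝ} {Ω : Matrix (Fin p) (Fin p) ℝ}, Ω.PosDef →
      ∀ {S : Type*} [MeasurableSpace S] {P : Measure S} [IsProbabilityMeasure P]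
        {X : S → Matrix (Fin n) (Fin p) ℝ}, IsGaussianSample P X Ω →
      ∀ {βhat : CoefEstimator n p}, ErrorConditions P X Ω βhat C₀ s δ ε →
      ∀ {A : Finset (Fin p)}, A.card = 2 → (∀ m, theta Ω A m m ≤ Lθ) →
        (∀ m, block Ω A m m ≤ Lω) → 1 ≤ s → s ≤ c₀ / δ * n / Real.log p →
          P.real {ω | C * s * (δ * Real.log p / n) <
            matSup (omegaHat βhat (X ω) A - omegaOra Ω (X ω) A)} ≤ tailBound ε δ p := by
  -- The number `k` of draws makes the slack `K = 2 Lθ / (k - 1)` satisfy `16 Lω K ≤ 1`. It depends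
  -- on `Lω` and `Lθ` only, and so does the number `N` of events in the union bound in dimension
  -- two.
  obtain ⟨k₀, hk₀⟩ := exists_nat_ge (32 * Lω * Lθ)
  set k := k₀ + 2 with hk
  set K := 2 * Lθ / ((k : ℝ) - 1) with hKdef
  have hk1 : (0 : ℝ) < (k : ℝ) - 1 := by rw [hk]; push_cast; linarith [Nat.cast_nonneg (α := ℝ) k₀]
  have hK : 16 * Lω * K ≤ 1 := by
    rw [hKdef, mul_div_assoc', div_le_one hk1, hk]
    push_cast
    linarith
  set N : ℝ := 2 * (2 * 2) ^ k + 2 with hN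
  have hN0 : 0 < N := by positivity
  set C₁ := (4 * √Lθ + 1) * C₀ with hC₁
  have hC₁0 : 0 < C₁ := by positivity
  -- The first entry of the minimum yields `N exp(-n/32) ≤ p^{-2δ}`; the second keeps the covariance
  -- error below `a / 4` for the eigenvalue bound `a = 1 / (8 Lω)`. The last constant is `(8 / a²)
  -- C₁`.
  refine ⟨min (1 / (32 * (2 + 2 * N))) (1 / (32 * Lω * C₁)), by positivity,
    512 * Lω ^ 2 * C₁, by positivity, ?_⟩
  intro δ hδ n p hn hp s ε Ω hΩ S _ P _ X hX βhat h A hA hLt hLo hs1 hs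
  have hlog := log_natCast_pos hp
  have hx : 0 < δ * Real.log p := by nlinarith
  have hx2 : 1 / 2 ≤ δ * Real.log p := by nlinarith
  have hn0 : (0 : ℝ) < n := by exact_mod_cast hn
  have hsn : ∀ c, min (1 / (32 * (2 + 2 * N))) (1 / (32 * Lω * C₁)) ≤ c →
      s * (δ * Real.log p) ≤ c * n := by
    intro c hc
    have h1 : s * Real.log p ≤ c / δ * n := by
      rw [le_div_iff₀ (by linarith)] at hs
      refine hs.trans ?_
      gcongr
    rw [div_mul_eq_mul_div, le_div_iff₀ (by linarith)] at h1
    linarith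
  have hA1 := hsn _ (min_le_left _ _)
  have hA2 := hsn _ (min_le_right _ _)
  have hsmall : N * Real.exp (-(n / 32 : ℝ)) ≤ Real.exp (-(2 * δ * Real.log p)) := by
    have h1 : δ * Real.log p * (32 * (2 + 2 * N)) ≤ n := by
      rw [div_mul_eq_mul_div, one_mul, le_div_iff₀ (by positivity)] at hA1
      refine le_trans ?_ hA1
      exact mul_le_mul_of_nonneg_right (by nlinarith) (by positivity)
    have h2 : N ≤ Real.exp N := by linarith [Real.add_one_le_exp N]
    calc _ ≤ Real.exp N * Real.exp (-(n / 32 : ℝ)) := by gcongr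
      _ = Real.exp (N - n / 32) := by rw [← Real.exp_add]; ring_nf
      _ ≤ _ := by
        refine Real.exp_le_exp.2 ?_
        nlinarith
  have hnoise := hX.real_not_noiseBound_le hΩ A hA (t := √(4 * (δ * Real.log p)))
    (Real.sqrt_nonneg _)
  rw [Real.sq_sqrt (by positivity), show -(4 * (δ * Real.log p)) / 2 = -(2 * δ * Real.log p) by
    ring] at hnoise
  have hres := hX.real_not_restrictedBounds_le hΩ hn (residDir Ω A) (D := Lθ) (k := k)
    (by rw [residDir_cov hΩ]; exact hLt) (by omega)
  rw [residDir_cov hΩ, Fintype.card_coe, hA] at hres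
  push_cast at hres
  rw [← hKdef, ← hN] at hres
  have hslack := tail_slack hp hδ
  have hbad := h.real_bad_le hA
  refine (measureReal_mono (s₂ := ({ω | C₀ * s * δ * Real.log p ≤
        matSqNorm (colsOut (X ω) A * (βhat (X ω) A - beta Ω A))} ∪
      {ω | C₀ * s * √(δ * Real.log p / n) ≤
        matL1 (rootDiag (X ω) A * (βhat (X ω) A - beta Ω A))}) ∪
      ({ω | ¬ NoiseBound Ω (X ω) A √(4 * (δ * Real.log p))} ∪
      {ω | ¬ RestrictedBounds n (X ω * residDir Ω A) (theta Ω A) K})) ?_).trans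
    ((measureReal_union_le _ _).trans ?_)
  · intro ω hω
    by_contra hcon
    simp only [Set.mem_union, Set.mem_ofPred_eq, not_or, not_le, not_not] at hcon
    obtain ⟨⟨h1, h2⟩, h3, h4⟩ := hcon
    refine absurd hω (not_lt.2 (matSup_le (fun m l => ?_) (by positivity)))
    have hT := fun m l => abs_thetaHat_sub_thetaOra_le hn hx.le hLt h3 h1.le h2.le m l
    have hQ := thetaOra_quadForm_ge hΩ hA hLω hLo hK h4
    have := abs_inv_sub_inv_apply_le (by rw [Fintype.card_coe, hA]) (by positivity) hQ hT ?_ m l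
    · refine this.trans (le_of_eq ?_)
      rw [hC₁]
      field_simp
      ring
    · rw [← hC₁, show 4 * (C₁ * s * (δ * Real.log p / n)) = 4 * C₁ * (s * (δ * Real.log p)) / n by
        ring, div_le_div_iff₀ hn0 (by positivity)]
      rw [div_mul_eq_mul_div, one_mul, le_div_iff₀ (by positivity)] at hA2
      linarith
  · rw [tailBound]
    have := measureReal_union_le (μ := P) {ω | ¬ NoiseBound Ω (X ω) A √(4 * (δ * Real.log p))}
      {ω | ¬ RestrictedBounds n (X ω * residDir Ω A) (theta Ω A) K}
    linarith

end OracleBounds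

end PrecisionInference

namespace PrecisionInference

open Set

/-! ### The signed root of the log-likelihood. -/

section SignedRoot

/-- The kernel `g` with `u - 1 - log u = (u - 1)² g(u)`. -/
noncomputable def logKernel (u : ℝ) : ℝ := ∫ s in (0 : ℝ)..1, s / (1 + s * (u - 1))

lemma logKernel_denom_pos {u s : ℝ} (hu : 0 < u) (hs : s ∈ Icc (0 : ℝ) 1) :
    0 < 1 + s * (u - 1) := by
  obtain ⟨h0, h1⟩ := hs
  rcases h1.eq_or_lt with rfl | h1
  · linarith
  · nlinarith

lemma logKernel_continuousOn {u : ℝ} (hu : 0 < u) :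
    ContinuousOn (fun s : ℝ => s / (1 + s * (u - 1))) (Icc 0 1) := by
  refine ContinuousOn.div continuousOn_id (by fun_prop) fun s hs => ?_
  exact (logKernel_denom_pos hu hs).ne'

lemma logKernel_intervalIntegrable {u : ℝ} (hu : 0 < u) :
    IntervalIntegrable (fun s : ℝ => s / (1 + s * (u - 1))) volume 0 1 := by
  apply ContinuousOn.intervalIntegrable
  rw [uIcc_of_le zero_le_one]
  exact logKernel_continuousOn hu

/-- This and `mul_logKernel_monotone` hold already for the integrands, as `0 ≤ s ≤ 1`. They yield
the two monotone likelihood ratios and the explicit bounds on `signedRoot`. -/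
lemma logKernel_antitone {u v : ℝ} (hu : 0 < u) (huv : u ≤ v) : logKernel v ≤ logKernel u := by
  refine intervalIntegral.integral_mono_on zero_le_one
    (logKernel_intervalIntegrable (hu.trans_le huv)) (logKernel_intervalIntegrable hu) ?_
  intro s hs
  have h1 := logKernel_denom_pos hu hs
  have h0 := hs.1
  gcongr

lemma mul_logKernel_monotone {u v : ℝ} (hu : 0 < u) (huv : u ≤ v) :
    u * logKernel u ≤ v * logKernel v := by
  rw [logKernel, logKernel, ← intervalIntegral.integral_const_mul,
    ← intervalIntegral.integral_const_mul]
  refine intervalIntegral.integral_mono_on zero_le_one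
    ((logKernel_intervalIntegrable hu).const_mul _)
    ((logKernel_intervalIntegrable (hu.trans_le huv)).const_mul _) ?_
  intro s hs
  have h1 := logKernel_denom_pos hu hs
  have h2 := logKernel_denom_pos (hu.trans_le huv) hs
  rw [mul_div_assoc', mul_div_assoc', div_le_div_iff₀ h1 h2]
  nlinarith [mul_nonneg (mul_nonneg hs.1 (sub_nonneg.2 hs.2)) (sub_nonneg.2 huv)]

lemma logKernel_one : logKernel 1 = 1 / 2 := by
  simp [logKernel]

lemma logKernel_pos {u : ℝ} (hu : 0 < u) : 0 < logKernel u := by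
  rcases le_total u 1 with h | h
  · have := logKernel_antitone hu h
    rw [logKernel_one] at this
    linarith
  · have := mul_logKernel_monotone one_pos h
    rw [logKernel_one] at this
    by_contra! hcon
    nlinarith

/-- Taylor's formula with integral remainder, by the antiderivative `s (u - 1) - log (1 + s (u -
1))`. -/
lemma sq_mul_logKernel {u : ℝ} (hu : 0 < u) :
    (u - 1) ^ 2 * logKernel u = u - 1 - Real.log u := by
  rw [logKernel, ← intervalIntegral.integral_const_mul]
  have h := intervalIntegral.integral_eq_sub_of_hasDerivAt (a := 0) (b := 1)
    (f := fun s : ℝ => s * (u - 1) - Real.log (1 + s * (u - 1)))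
    (f' := fun s => (u - 1) ^ 2 * (s / (1 + s * (u - 1)))) ?_
    ((logKernel_intervalIntegrable hu).const_mul _)
  · rw [h]
    simp
  · intro s hs
    rw [uIcc_of_le zero_le_one] at hs
    have h1 := logKernel_denom_pos hu hs
    have h2 : HasDerivAt (fun s : ℝ => s * (u - 1)) (u - 1) s := by
      simpa using (hasDerivAt_id s).mul_const (u - 1)
    refine (h2.sub ((h2.const_add 1).log h1.ne')).congr_deriv ?_
    have h3 := h1.ne'
    rw [mul_div_assoc', eq_div_iff h3, sub_mul, div_mul_cancel₀ _ h3]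
    ring

/-- The increasing function `κ` of `t > 0` with `κ(t)² = t² - 1 - 2 log t`. -/
noncomputable def signedRoot (t : ℝ) : ℝ := (t ^ 2 - 1) * √(logKernel (t ^ 2))

lemma signedRoot_sq {t : ℝ} (ht : 0 < t) : signedRoot t ^ 2 = t ^ 2 - 1 - 2 * Real.log t := by
  rw [signedRoot, mul_pow, Real.sq_sqrt (logKernel_pos (by positivity)).le,
    sq_mul_logKernel (by positivity), Real.log_pow]
  norm_num

/-- The two monotonicities and the value `1 / 2` at `1` squeeze the kernel between `1 / 2` and `1 /
(2 u)`. This is what differentiability of `signedRoot` at `1` needs. -/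
lemma continuousAt_logKernel_one : ContinuousAt logKernel 1 := by
  have h1 : Tendsto (fun u : ℝ => max (1 / 2) (1 / (2 * u))) (𝓝 1) (𝓝 (1 / 2)) := by
    have : ContinuousAt (fun u : ℝ => max (1 / 2) (1 / (2 * u))) 1 :=
      Filter.Tendsto.max continuousAt_const
        (show ContinuousAt (fun u : ℝ => 1 / (2 * u)) 1 by fun_prop (disch := norm_num))
    simpa [ContinuousAt] using this
  have h2 : Tendsto (fun u : ℝ => min (1 / 2) (1 / (2 * u))) (𝓝 1) (𝓝 (1 / 2)) := by
    have : ContinuousAt (fun u : ℝ => min (1 / 2) (1 / (2 * u))) 1 :=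
      Filter.Tendsto.min continuousAt_const
        (show ContinuousAt (fun u : ℝ => 1 / (2 * u)) 1 by fun_prop (disch := norm_num))
    simpa [ContinuousAt] using this
  rw [ContinuousAt, logKernel_one]
  have hpos : ∀ᶠ u : ℝ in 𝓝 1, 0 < u := lt_mem_nhds one_pos
  have hb : ∀ u : ℝ, 0 < u → min (1 / 2) (1 / (2 * u)) ≤ logKernel u ∧
      logKernel u ≤ max (1 / 2) (1 / (2 * u)) := by
    intro u hu
    rcases le_total u 1 with h | h
    · have h3 := logKernel_antitone hu h
      have h4 := mul_logKernel_monotone hu h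
      rw [logKernel_one] at h3 h4
      exact ⟨(min_le_left _ _).trans h3, le_max_of_le_right
        (by rw [le_div_iff₀ (by positivity)]; linarith)⟩
    · have h3 := logKernel_antitone one_pos h
      have h4 := mul_logKernel_monotone one_pos h
      rw [logKernel_one] at h3 h4
      exact ⟨min_le_of_right_le (by rw [div_le_iff₀ (by positivity)]; linarith),
        h3.trans (le_max_left _ _)⟩
  exact tendsto_of_tendsto_of_tendsto_of_le_of_le' h2 h1
    (hpos.mono fun u hu => (hb u hu).1) (hpos.mono fun u hu => (hb u hu).2)

/-- Away from `1` the function is locally `±√(t² - 1 - 2 log t)`. At `1` the radicand vanishes, and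
the factorization into `t - 1` times a continuous function replaces the chain rule. -/
lemma hasDerivAt_signedRoot {t : ℝ} (ht : 0 < t) :
    HasDerivAt signedRoot (1 / (t * √(logKernel (t ^ 2)))) t := by
  have hg := logKernel_pos (u := t ^ 2) (by positivity)
  have hsq : 0 < √(logKernel (t ^ 2)) := Real.sqrt_pos.2 hg
  by_cases h1 : t = 1
  · subst h1
    have hcont : ContinuousAt (fun t : ℝ => (t + 1) * √(logKernel (t ^ 2))) 1 := by
      refine ContinuousAt.mul (by fun_prop) (ContinuousAt.sqrt ?_)
      exact ContinuousAt.comp (x := (1 : ℝ)) (f := fun t : ℝ => t ^ 2) (g := logKernel)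
        (by simpa using continuousAt_logKernel_one) (by fun_prop)
    have : HasDerivAt (fun t : ℝ => (t - 1) * ((t + 1) * √(logKernel (t ^ 2))))
        ((1 + 1) * √(logKernel (1 ^ 2))) 1 := by
      rw [hasDerivAt_iff_tendsto_slope]
      refine (hcont.tendsto.mono_left nhdsWithin_le_nhds).congr' ?_
      filter_upwards [self_mem_nhdsWithin] with x hx
      have hx' : x - 1 ≠ 0 := sub_ne_zero.2 hx
      simp only [slope, vsub_eq_sub, sub_self, zero_mul, sub_zero, smul_eq_mul]
      field_simp
    have he : signedRoot = fun t : ℝ => (t - 1) * ((t + 1) * √(logKernel (t ^ 2))) := by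
      ext t; simp only [signedRoot]; ring
    rw [he]
    refine this.congr_deriv ?_
    rw [one_pow, logKernel_one, one_mul, eq_div_iff (by positivity), mul_assoc,
      Real.mul_self_sqrt (by norm_num)]
    norm_num
  · have hk : HasDerivAt (fun t : ℝ => t ^ 2 - 1 - 2 * Real.log t) (2 * t - 2 * (1 / t)) t := by
      have := ((hasDerivAt_pow 2 t).sub_const 1).sub ((Real.hasDerivAt_log ht.ne').const_mul 2)
      refine this.congr_deriv ?_
      simp
    have hne : t ^ 2 - 1 - 2 * Real.log t ≠ 0 := by
      rw [← signedRoot_sq ht]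
      refine pow_ne_zero 2 (mul_ne_zero ?_ hsq.ne')
      intro h
      have : (t - 1) * (t + 1) = 0 := by linarith
      rcases mul_eq_zero.1 this with h | h
      · exact h1 (by linarith)
      · linarith
    have hroot := hk.sqrt hne
    have hev : ∀ x : ℝ, 0 < x → √(x ^ 2 - 1 - 2 * Real.log x) = |signedRoot x| := fun x hx => by
      rw [← signedRoot_sq hx, Real.sqrt_sq_eq_abs]
    rw [hev t ht] at hroot
    rcases lt_or_gt_of_ne h1 with hlt | hgt
    · have habs : ∀ x : ℝ, 0 < x → x < 1 → |signedRoot x| = -signedRoot x := fun x h0 hx => by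
        refine abs_of_nonpos ?_
        exact mul_nonpos_of_nonpos_of_nonneg (by nlinarith) (Real.sqrt_nonneg _)
      have heq : signedRoot =ᶠ[𝓝 t] fun x => -√(x ^ 2 - 1 - 2 * Real.log x) := by
        filter_upwards [lt_mem_nhds ht, gt_mem_nhds hlt] with x h0 hx
        rw [hev x h0, habs x h0 hx, neg_neg]
      refine (hroot.neg.congr_of_eventuallyEq heq).congr_deriv ?_
      rw [habs t ht hlt, signedRoot]
      have : t ^ 2 - 1 ≠ 0 := by nlinarith
      field_simp
    · have habs : ∀ x : ℝ, 1 < x → |signedRoot x| = signedRoot x := fun x hx => by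
        refine abs_of_nonneg ?_
        exact mul_nonneg (by nlinarith) (Real.sqrt_nonneg _)
      have heq : signedRoot =ᶠ[𝓝 t] fun x => √(x ^ 2 - 1 - 2 * Real.log x) := by
        filter_upwards [lt_mem_nhds ht, lt_mem_nhds hgt] with x h0 hx
        rw [hev x h0, habs x hx]
      refine (hroot.congr_of_eventuallyEq heq).congr_deriv ?_
      rw [habs t hgt, signedRoot]
      have : t ^ 2 - 1 ≠ 0 := by nlinarith
      field_simp

lemma signedRoot_strictMonoOn : StrictMonoOn signedRoot (Ioi 0) := by
  refine strictMonoOn_of_deriv_pos (convex_Ioi 0)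
    (fun t ht => (hasDerivAt_signedRoot ht).continuousAt.continuousWithinAt) fun t ht => ?_
  rw [interior_Ioi] at ht
  rw [(hasDerivAt_signedRoot ht).deriv]
  have := logKernel_pos (u := t ^ 2) (by have := mem_Ioi.1 ht; positivity)
  have := mem_Ioi.1 ht
  positivity

/-- Intermediate values. At `t = exp(-(x² + 1)/2)` the square of the root is `t² + x²`; at `t = 1 +
|x|` it is at least `(t - 1)² = x²`, by `log t ≤ t - 1`. -/
lemma signedRoot_surjOn (x : ℝ) : ∃ t, 0 < t ∧ signedRoot t = x := by
  have hlow : ∃ t, 0 < t ∧ t ≤ 1 ∧ signedRoot t ≤ x := by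
    refine ⟨Real.exp (-((x ^ 2 + 1) / 2)), Real.exp_pos _,
      Real.exp_le_one_iff.2 (by nlinarith [sq_nonneg x]), ?_⟩
    set t := Real.exp (-((x ^ 2 + 1) / 2)) with ht
    have h0 : 0 < t := Real.exp_pos _
    have h1 : t ≤ 1 := Real.exp_le_one_iff.2 (by nlinarith [sq_nonneg x])
    have hs := signedRoot_sq h0
    rw [ht, Real.log_exp, ← ht] at hs
    have hneg : signedRoot t ≤ 0 :=
      mul_nonpos_of_nonpos_of_nonneg (by nlinarith) (Real.sqrt_nonneg _)
    have h2 : x ^ 2 ≤ signedRoot t ^ 2 := by nlinarith [sq_nonneg t]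
    by_contra! hcon
    nlinarith
  have hhigh : ∃ t, 1 ≤ t ∧ x ≤ signedRoot t := by
    refine ⟨1 + |x|, by linarith [abs_nonneg x], ?_⟩
    set t := 1 + |x|
    have h0 : (1 : ℝ) ≤ t := by linarith [abs_nonneg x]
    have hs := signedRoot_sq (show 0 < t by linarith)
    have hl := Real.log_le_sub_one_of_pos (show 0 < t by linarith)
    have hp : 0 ≤ signedRoot t := mul_nonneg (by nlinarith) (Real.sqrt_nonneg _)
    have h2 : |x| ^ 2 ≤ signedRoot t ^ 2 := by
      have : |x| = t - 1 := by ring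
      rw [this]
      nlinarith
    exact (le_abs_self x).trans ((le_abs_self _).trans (abs_le_of_sq_le_sq h2 hp))
  obtain ⟨a, ha0, ha1, ha⟩ := hlow
  obtain ⟨b, hb1, hb⟩ := hhigh
  have hcont : ContinuousOn signedRoot (Icc a b) := fun t ht =>
    (hasDerivAt_signedRoot (ha0.trans_le ht.1)).continuousAt.continuousWithinAt
  obtain ⟨t, ht, hx⟩ := intermediate_value_Icc (ha1.trans hb1) hcont ⟨ha, hb⟩
  exact ⟨t, ha0.trans_le ht.1, hx⟩

end SignedRoot

end PrecisionInference

namespace PrecisionInference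

open Set

/-! ### The law of the norm of a Gaussian vector. -/

section ChiLaw

variable {n : ℕ}

lemma pi_gaussianReal_eq_withDensity :
    Measure.pi (fun _ : Fin n => gaussianReal 0 1)
      = (volume : Measure (Fin n → ℝ)).withDensity
        (fun x => ENNReal.ofReal (∏ i, gaussianPDFReal 0 1 (x i))) := by
  refine Measure.pi_eq fun s hs => ?_
  rw [withDensity_apply _ (MeasurableSet.univ_pi hs), ← lintegral_indicator (MeasurableSet.univ_pi hs)]
  have h1 : ∀ x : Fin n → ℝ, (univ.pi s).indicator
      (fun x => ENNReal.ofReal (∏ i, gaussianPDFReal 0 1 (x i))) x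
      = ENNReal.ofReal (∏ i, (s i).indicator (gaussianPDFReal 0 1) (x i)) := by
    intro x
    by_cases hx : x ∈ univ.pi s
    · rw [indicator_of_mem hx]
      congr 1
      exact Finset.prod_congr rfl fun i _ => (indicator_of_mem (hx i (mem_univ i)) _).symm
    · rw [indicator_of_notMem hx]
      obtain ⟨i, hi⟩ : ∃ i, x i ∉ s i := by simpa [Set.mem_pi] using hx
      rw [Finset.prod_eq_zero (Finset.mem_univ i) (indicator_of_notMem hi _), ENNReal.ofReal_zero]
  have hIntg : ∀ i, Integrable ((s i).indicator (gaussianPDFReal 0 1)) := fun i =>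
    (integrable_gaussianPDFReal 0 1).indicator (hs i)
  have hnn : ∀ i x, 0 ≤ (s i).indicator (gaussianPDFReal 0 1) x := fun i x =>
    indicator_nonneg (fun _ _ => gaussianPDFReal_nonneg _ _ _) _
  simp_rw [h1]
  rw [← ofReal_integral_eq_lintegral_ofReal]
  · rw [integral_fintype_prod_volume_eq_prod (f := fun i => (s i).indicator (gaussianPDFReal 0 1)),
      ENNReal.ofReal_prod_of_nonneg fun i _ => integral_nonneg (hnn i)]
    refine Finset.prod_congr rfl fun i _ => ?_
    rw [integral_indicator (hs i), gaussianReal_apply_eq_integral _ one_ne_zero]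
  · exact Integrable.fintype_prod (f := fun i => (s i).indicator (gaussianPDFReal 0 1)) hIntg
  · exact ae_of_all _ fun x => Finset.prod_nonneg fun i _ => hnn i _

/-- The density of the norm of a standard Gaussian vector, up to a constant. -/
noncomputable def chiDensity (n : ℕ) (c y : ℝ) : ℝ := c * (y ^ (n - 1) * Real.exp (-y ^ 2 / 2))

/-- Polar coordinates. The constant stays anonymous because likelihood ratio arguments need only the
shape of the density and its total mass. -/
lemma exists_chiDensity (hn : 1 ≤ n) : ∃ c : ℝ, ∀ B : Set ℝ, MeasurableSet B →
    (Measure.pi fun _ : Fin n => gaussianReal 0 1).real {g | √(sqNorm g) ∈ B}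
      = ∫ y in Ioi 0 ∩ B, chiDensity n c y := by
  have : Nonempty (Fin n) := ⟨⟨0, hn⟩⟩
  set k : ℝ := (√(2 * Real.pi))⁻¹ ^ n with hk
  refine ⟨k * (n * volume.real (Metric.ball (0 : EuclideanSpace ℝ (Fin n)) 1)), fun B hB => ?_⟩
  have hms : MeasurableSet {g : Fin n → ℝ | √(sqNorm g) ∈ B} := by
    have : Measurable fun g : Fin n → ℝ => √(sqNorm g) := by simp only [sqNorm]; fun_prop
    exact this hB
  have hnorm : ∀ x : EuclideanSpace ℝ (Fin n), √(sqNorm x.ofLp) = ‖x‖ := by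
    intro x
    rw [EuclideanSpace.norm_eq]
    simp [sqNorm]
  have hdens : ∀ x : EuclideanSpace ℝ (Fin n), ∏ i, gaussianPDFReal 0 1 (x.ofLp i)
      = k * Real.exp (-‖x‖ ^ 2 / 2) := by
    intro x
    simp only [gaussianPDFReal, NNReal.coe_one, mul_one, sub_zero]
    rw [Finset.prod_mul_distrib, ← Real.exp_sum, Finset.prod_const, Finset.card_univ,
      Fintype.card_fin, ← hnorm, Real.sq_sqrt (sqNorm_nonneg _), sqNorm, ← Finset.sum_div,
      Finset.sum_neg_distrib]
  have hmd : Measurable fun x : Fin n → ℝ => ∏ i, gaussianPDFReal 0 1 (x i) := by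
    refine Finset.measurable_prod _ fun i _ => ?_
    exact (measurable_gaussianPDFReal 0 1).comp (measurable_pi_apply i)
  rw [measureReal_def, pi_gaussianReal_eq_withDensity, withDensity_apply _ hms,
    ← lintegral_indicator hms]
  have h1 : ∀ x : Fin n → ℝ, {g : Fin n → ℝ | √(sqNorm g) ∈ B}.indicator
      (fun x => ENNReal.ofReal (∏ i, gaussianPDFReal 0 1 (x i))) x
      = ENNReal.ofReal ({g : Fin n → ℝ | √(sqNorm g) ∈ B}.indicator
        (fun x => ∏ i, gaussianPDFReal 0 1 (x i)) x) := by
    intro x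
    by_cases hx : x ∈ {g : Fin n → ℝ | √(sqNorm g) ∈ B} <;> simp [indicator, hx]
  simp_rw [h1]
  rw [← integral_toReal]
  rotate_left
  · exact (ENNReal.measurable_ofReal.comp (hmd.indicator hms)).aemeasurable
  · exact ae_of_all _ fun x => ENNReal.ofReal_lt_top
  have h2 : ∀ x : Fin n → ℝ, (ENNReal.ofReal ({g : Fin n → ℝ | √(sqNorm g) ∈ B}.indicator
        (fun x => ∏ i, gaussianPDFReal 0 1 (x i)) x)).toReal
      = (fun y : ℝ => B.indicator (fun y => k * Real.exp (-y ^ 2 / 2)) y)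
        ‖(WithLp.toLp 2 x : EuclideanSpace ℝ (Fin n))‖ := by
    intro x
    rw [ENNReal.toReal_ofReal (indicator_nonneg
      (fun x _ => Finset.prod_nonneg fun i _ => gaussianPDFReal_nonneg _ _ _) _)]
    have h3 := hdens (WithLp.toLp 2 x)
    have h4 := hnorm (WithLp.toLp 2 x)
    simp only at h3 h4
    by_cases hx : √(sqNorm x) ∈ B
    · have hx' : x ∈ {g : Fin n → ℝ | √(sqNorm g) ∈ B} := hx
      rw [h4] at hx
      rw [indicator_of_mem hx', h3]
      exact (indicator_of_mem hx (fun y => k * Real.exp (-y ^ 2 / 2))).symm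
    · have hx' : x ∉ {g : Fin n → ℝ | √(sqNorm g) ∈ B} := hx
      rw [h4] at hx
      rw [indicator_of_notMem hx']
      exact (indicator_of_notMem hx _).symm
  simp_rw [h2]
  rw [(PiLp.volume_preserving_toLp (Fin n)).integral_comp
    (MeasurableEquiv.toLp 2 (Fin n → ℝ)).measurableEmbedding
    (fun x : EuclideanSpace ℝ (Fin n) =>
      (fun y : ℝ => B.indicator (fun y => k * Real.exp (-y ^ 2 / 2)) y) ‖x‖),
    integral_fun_norm_addHaar volume
      (fun y : ℝ => B.indicator (fun y => k * Real.exp (-y ^ 2 / 2)) y)]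
  rw [finrank_euclideanSpace_fin, nsmul_eq_mul, smul_eq_mul, ← setIntegral_indicator hB,
    ← integral_const_mul, ← integral_const_mul]
  refine integral_congr_ae (ae_of_all _ fun y => ?_)
  by_cases hy : y ∈ B
  · simp only [indicator_of_mem hy, chiDensity, smul_eq_mul]
    ring
  · simp [indicator_of_notMem hy]

end ChiLaw

/-! ### Stochastic order from a monotone likelihood ratio. -/

section LikelihoodRatio

/-- A monotone likelihood ratio orders the distribution functions. -/
lemma integral_le_of_likelihoodRatio {a b : ℝ → ℝ} (ha : IntegrableOn a (Ioi 0))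
    (hb : IntegrableOn b (Ioi 0)) (hA : ∫ y in Ioi 0, a y = 1) (hB : ∫ y in Ioi 0, b y = 1)
    {r : ℝ} (hr : 0 < r) (h : ∀ y ∈ Ioc 0 r, ∀ z ∈ Ioi r, a z * b y ≤ a y * b z) :
    ∫ y in Ioc 0 r, b y ≤ ∫ y in Ioc 0 r, a y := by
  have hsub1 : Ioc 0 r ⊆ Ioi (0 : ℝ) := fun y hy => hy.1
  have hsub2 : Ioi r ⊆ Ioi (0 : ℝ) := fun y hy => hr.trans hy
  have hsplit : ∀ f : ℝ → ℝ, IntegrableOn f (Ioi 0) → ∫ y in Ioi 0, f y = 1 →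
      ∫ y in Ioi r, f y = 1 - ∫ y in Ioc 0 r, f y := by
    intro f hf h1
    rw [← h1, ← Ioc_union_Ioi_eq_Ioi hr.le, setIntegral_union (Ioc_disjoint_Ioi le_rfl)
      measurableSet_Ioi (hf.mono_set hsub1) (hf.mono_set hsub2)]
    ring
  -- Integrating over `y ≤ r` and then over `z > r` gives `(1 - F_a) F_b ≤ F_a (1 - F_b)` at `r`,
  -- that is `F_b ≤ F_a`.
  have h1 : ∀ z ∈ Ioi r, a z * ∫ y in Ioc 0 r, b y ≤ (∫ y in Ioc 0 r, a y) * b z := by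
    intro z hz
    rw [← integral_const_mul, ← integral_mul_const]
    exact setIntegral_mono_on ((hb.mono_set hsub1).const_mul _) ((ha.mono_set hsub1).mul_const _)
      measurableSet_Ioc fun y hy => h y hy z hz
  have h2 := setIntegral_mono_on ((ha.mono_set hsub2).mul_const _)
    ((hb.mono_set hsub2).const_mul _) measurableSet_Ioi h1
  rw [integral_mul_const, integral_const_mul, hsplit a ha hA, hsplit b hb hB] at h2
  linarith

end LikelihoodRatio

/-! ### The variable whose signed root is exactly normal. -/

section RootDensity

/-- The density of the random variable whose image under `y ↦ c κ(y / c)` is standard normal. -/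
noncomputable def rootDensity (c y : ℝ) : ℝ :=
  1 / (y / c * √(logKernel ((y / c) ^ 2))) * gaussianPDFReal 0 1 (c * signedRoot (y / c))

lemma hasDerivAt_scaled_signedRoot {c y : ℝ} (hc : 0 < c) (hy : 0 < y) :
    HasDerivAt (fun y => c * signedRoot (y / c)) (1 / (y / c * √(logKernel ((y / c) ^ 2)))) y := by
  have h1 : HasDerivAt (fun y : ℝ => y / c) (1 / c) y := (hasDerivAt_id y).div_const c
  have h2 := ((hasDerivAt_signedRoot (div_pos hy hc)).comp y h1).const_mul c
  refine h2.congr_deriv ?_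
  field_simp

lemma scaled_signedRoot_strictMonoOn {c : ℝ} (hc : 0 < c) :
    StrictMonoOn (fun y => c * signedRoot (y / c)) (Ioi 0) := by
  intro x hx y hy hxy
  exact mul_lt_mul_of_pos_left (signedRoot_strictMonoOn (div_pos hx hc) (div_pos hy hc)
    (div_lt_div_of_pos_right hxy hc)) hc

lemma scaled_signedRoot_surj {c : ℝ} (hc : 0 < c) (x : ℝ) :
    ∃ y, 0 < y ∧ c * signedRoot (y / c) = x := by
  obtain ⟨t, ht, hx⟩ := signedRoot_surjOn (x / c)
  refine ⟨c * t, by positivity, ?_⟩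
  rw [mul_div_cancel_left₀ _ hc.ne', hx, mul_div_cancel₀ _ hc.ne']

lemma image_Ioc_scaled_signedRoot {c r : ℝ} (hc : 0 < c) (hr : 0 < r) :
    (fun y => c * signedRoot (y / c)) '' Ioc 0 r = Iic (c * signedRoot (r / c)) := by
  ext x
  constructor
  · rintro ⟨y, hy, rfl⟩
    exact (scaled_signedRoot_strictMonoOn hc).monotoneOn hy.1 hr hy.2
  · intro hx
    obtain ⟨y, hy, rfl⟩ := scaled_signedRoot_surj hc x
    exact ⟨y, ⟨hy, ((scaled_signedRoot_strictMonoOn hc).le_iff_le hy hr).1 hx⟩, rfl⟩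

lemma image_Ioi_scaled_signedRoot {c : ℝ} (hc : 0 < c) :
    (fun y => c * signedRoot (y / c)) '' Ioi 0 = univ := by
  refine eq_univ_of_forall fun x => ?_
  obtain ⟨y, hy, rfl⟩ := scaled_signedRoot_surj hc x
  exact ⟨y, hy, rfl⟩

lemma scaledDeriv_nonneg {c y : ℝ} (hc : 0 < c) (hy : 0 < y) :
    0 ≤ 1 / (y / c * √(logKernel ((y / c) ^ 2))) := by positivity

lemma integral_rootDensity_Ioc {c r : ℝ} (hc : 0 < c) (hr : 0 < r) :
    ∫ y in Ioc 0 r, rootDensity c y = (gaussianReal 0 1).real (Iic (c * signedRoot (r / c))) := by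
  have h := integral_image_eq_integral_abs_deriv_smul (s := Ioc 0 r) measurableSet_Ioc
    (fun y hy => (hasDerivAt_scaled_signedRoot hc hy.1).hasDerivWithinAt)
    ((scaled_signedRoot_strictMonoOn hc).injOn.mono fun y hy => hy.1) (gaussianPDFReal 0 1)
  rw [image_Ioc_scaled_signedRoot hc hr] at h
  rw [measureReal_def, gaussianReal_apply_eq_integral _ one_ne_zero,
    ENNReal.toReal_ofReal (integral_nonneg fun _ => gaussianPDFReal_nonneg _ _ _), h]
  refine setIntegral_congr_fun measurableSet_Ioc fun y hy => ?_
  simp only [rootDensity, smul_eq_mul, abs_of_nonneg (scaledDeriv_nonneg hc hy.1)]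

lemma rootDensity_Ioi {c : ℝ} (hc : 0 < c) :
    IntegrableOn (rootDensity c) (Ioi 0) ∧ ∫ y in Ioi 0, rootDensity c y = 1 := by
  have hd : ∀ y ∈ Ioi (0 : ℝ), HasDerivWithinAt (fun y => c * signedRoot (y / c))
      (1 / (y / c * √(logKernel ((y / c) ^ 2)))) (Ioi 0) y := fun y hy =>
    (hasDerivAt_scaled_signedRoot hc hy).hasDerivWithinAt
  have h := integral_image_eq_integral_abs_deriv_smul measurableSet_Ioi hd
    (scaled_signedRoot_strictMonoOn hc).injOn (gaussianPDFReal 0 1)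
  have h' := (integrableOn_image_iff_integrableOn_abs_deriv_smul measurableSet_Ioi hd
    (scaled_signedRoot_strictMonoOn hc).injOn (gaussianPDFReal 0 1)).1
    (integrable_gaussianPDFReal 0 1).integrableOn
  rw [image_Ioi_scaled_signedRoot hc, setIntegral_univ,
    integral_gaussianPDFReal_eq_one 0 one_ne_zero] at h
  have hcongr : EqOn (fun y => |1 / (y / c * √(logKernel ((y / c) ^ 2)))| •
      gaussianPDFReal 0 1 (c * signedRoot (y / c))) (rootDensity c) (Ioi 0) := fun y hy => by
    simp only [rootDensity, smul_eq_mul, abs_of_nonneg (scaledDeriv_nonneg hc hy)]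
  exact ⟨h'.congr_fun hcongr measurableSet_Ioi,
    (setIntegral_congr_fun measurableSet_Ioi hcongr).symm.trans h.symm⟩

/-- The square of `√m κ(y/√m)` is `y² - m - 2 m log(y/√m)`, so the normal density at that point is a
multiple of `exp(-y²/2) (y/√m)^m`, and the density has chi shape up to the Jacobian. -/
lemma rootDensity_eq {m : ℕ} (hm : 1 ≤ m) {y : ℝ} (hy : 0 < y) :
    rootDensity √m y = (√(2 * Real.pi))⁻¹ * Real.exp (m / 2) * Real.exp (-y ^ 2 / 2)
      * (y / √m) ^ m * (1 / (y / √m * √(logKernel ((y / √m) ^ 2)))) := by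
  have hm0 : (0 : ℝ) < m := by exact_mod_cast hm
  have hc : 0 < √(m : ℝ) := Real.sqrt_pos.2 hm0
  have ht : 0 < y / √m := div_pos hy hc
  rw [rootDensity]
  simp only [gaussianPDFReal, NNReal.coe_one, mul_one, sub_zero]
  have h1 : -(√(m : ℝ) * signedRoot (y / √m)) ^ 2 / 2
      = m / 2 + -y ^ 2 / 2 + m * Real.log (y / √m) := by
    rw [mul_pow, signedRoot_sq ht, Real.sq_sqrt hm0.le, div_pow, Real.sq_sqrt hm0.le]
    field_simp
    ring
  rw [h1, Real.exp_add, Real.exp_add, Real.exp_nat_mul, Real.exp_log ht]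
  ring

end RootDensity

end PrecisionInference

namespace PrecisionInference

open Set

/-! ### Quantile transforms between atomless laws. -/

section QuantileTransform

lemma continuous_cdf_of_noAtoms (μ : Measure ℝ) [IsProbabilityMeasure μ] (h : ∀ x, μ {x} = 0) :
    Continuous (cdf μ) := by
  rw [continuous_iff_continuousAt]
  intro x
  refine continuousAt_iff_continuous_left'_right'.2 ⟨?_, ?_⟩
  · have h1 := (cdf μ).measure_singleton x
    rw [measure_cdf, h x] at h1
    have h2 : (cdf μ) x ≤ Function.leftLim (cdf μ) x := by
      have := ENNReal.ofReal_eq_zero.1 h1.symm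
      linarith
    have h3 : Function.leftLim (cdf μ) x = cdf μ x :=
      le_antisymm ((monotone_cdf μ).leftLim_le le_rfl) h2
    exact (monotone_cdf μ).continuousWithinAt_Iio_iff_leftLim_eq.2 h3
  · exact ((cdf μ).right_continuous x).mono Ioi_subset_Ici_self

lemma exists_cdf_eq (μ : Measure ℝ) [IsProbabilityMeasure μ] (h : ∀ x, μ {x} = 0) {y : ℝ}
    (h0 : 0 < y) (h1 : y < 1) : ∃ x, cdf μ x = y := by
  refine mem_range_of_exists_le_of_exists_ge (continuous_cdf_of_noAtoms μ h) ?_ ?_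
  · obtain ⟨x, hx⟩ := ((tendsto_cdf_atBot μ).eventually (gt_mem_nhds h0)).exists
    exact ⟨x, hx.le⟩
  · obtain ⟨x, hx⟩ := ((tendsto_cdf_atTop μ).eventually (lt_mem_nhds h1)).exists
    exact ⟨x, hx.le⟩

/-- The quantile transform of a distribution on `(0, ∞)` into another distribution. -/
lemma exists_quantileTransform (ν γ : Measure ℝ) [IsProbabilityMeasure ν] [IsProbabilityMeasure γ]
    (hν : ∀ x, ν {x} = 0) (hγ : ∀ x, γ {x} = 0) (hν0 : ν (Iic 0) = 0)
    (hνs : StrictMonoOn (cdf ν) (Ioi 0)) (hγs : StrictMono (cdf γ)) :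
    ∃ q : ℝ → ℝ, AEMeasurable q ν ∧ ν.map q = γ ∧ ∀ r, 0 < r → cdf γ (q r) = cdf ν r := by
  have hpos : ∀ r, 0 < r → 0 < cdf ν r := fun r hr =>
    (cdf_nonneg ν (r / 2)).trans_lt (hνs (half_pos hr) hr (half_lt_self hr))
  have hlt : ∀ r, 0 < r → cdf ν r < 1 := fun r hr =>
    (hνs hr (show 0 < r + 1 by linarith) (by linarith)).trans_le (cdf_le_one ν (r + 1))
  -- Nonpositive `r` carry no mass, so `q` is arbitrary there.
  have hex : ∀ r : ℝ, ∃ x, 0 < r → cdf γ x = cdf ν r := by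
    intro r
    by_cases hr : 0 < r
    · obtain ⟨x, hx⟩ := exists_cdf_eq γ hγ (hpos r hr) (hlt r hr)
      exact ⟨x, fun _ => hx⟩
    · exact ⟨0, fun h => absurd h hr⟩
  choose q hq using hex
  have hres : ν.restrict (Ioi 0) = ν := by
    rw [Measure.restrict_eq_self_of_ae_mem]
    rw [ae_iff]
    convert hν0 using 2
    ext x; simp
  have hmono : MonotoneOn q (Ioi 0) := by
    intro x hx y hy hxy
    rw [← hγs.le_iff_le, hq x hx, hq y hy]
    exact monotone_cdf ν hxy
  have hqm : AEMeasurable q ν := by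
    rw [← hres]
    exact aemeasurable_restrict_of_monotoneOn measurableSet_Ioi hmono
  refine ⟨q, hqm, ?_, hq⟩
  have := Measure.isProbabilityMeasure_map hqm
  refine Measure.ext_of_Iic _ _ fun x => ?_
  have h0 : 0 < cdf γ x := (cdf_nonneg γ (x - 1)).trans_lt (hγs (by linarith))
  have h1 : cdf γ x < 1 := (hγs (show x < x + 1 by linarith)).trans_le (cdf_le_one γ _)
  obtain ⟨r₀, hr₀⟩ := exists_cdf_eq ν hν h0 h1
  have hr₀pos : 0 < r₀ := by
    by_contra! hcon
    have h2 : cdf ν r₀ = 0 := by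
      rw [cdf_eq_real, measureReal_def, measure_mono_null (Iic_subset_Iic.2 hcon) hν0]
      rfl
    linarith
  rw [Measure.map_apply_of_aemeasurable hqm measurableSet_Iic]
  have h2 : ν (q ⁻¹' Iic x) = ν (Iic r₀) := by
    refine measure_congr ?_
    have hae : ∀ᵐ r ∂ν, r ∈ Ioi (0 : ℝ) := by
      rw [ae_iff]
      convert hν0 using 2
      ext x; simp
    filter_upwards [hae] with r hr
    have hr' : 0 < r := hr
    refine propext ?_
    change q r ≤ x ↔ r ≤ r₀
    rw [← hγs.le_iff_le, hq r hr', ← hr₀, hνs.le_iff_le hr' hr₀pos]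
  rw [h2]
  have h3 : ν.real (Iic r₀) = γ.real (Iic x) := by rw [← cdf_eq_real, ← cdf_eq_real, hr₀]
  exact (measureReal_eq_measureReal_iff (by finiteness) (by finiteness)).1 h3

end QuantileTransform

/-! ### Coupling the norm with a normal variable. -/

section ChiCoupling

variable {n : ℕ}

lemma measurable_sqrt_sqNorm : Measurable fun g : Fin n → ℝ => √(sqNorm g) := by
  simp only [sqNorm]; fun_prop

lemma pi_gaussianReal_sqNorm_pos (hn : 1 ≤ n) :
    ∀ᵐ g ∂(Measure.pi fun _ : Fin n => gaussianReal 0 1), 0 < √(sqNorm g) := by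
  obtain ⟨c, hc⟩ := exists_chiDensity hn
  have h := hc (Iic 0) measurableSet_Iic
  have he : Ioi (0 : ℝ) ∩ Iic 0 = ∅ := by ext x; simp
  rw [he, setIntegral_empty, measureReal_eq_zero_iff] at h
  rw [ae_iff]
  convert h using 2
  ext g
  change ¬ 0 < √(sqNorm g) ↔ √(sqNorm g) ≤ 0
  exact not_lt

/-- The law of the norm of a standard Gaussian vector has a density on `(0, ∞)`. -/
lemma chi_density_props (hn : 1 ≤ n) : ∃ c : ℝ, 0 < c ∧ IntegrableOn (chiDensity n c) (Ioi 0) ∧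
    ∫ y in Ioi 0, chiDensity n c y = 1 ∧ ∀ B : Set ℝ, MeasurableSet B →
    ((Measure.pi fun _ : Fin n => gaussianReal 0 1).map fun g => √(sqNorm g)).real B
      = ∫ y in Ioi 0 ∩ B, chiDensity n c y := by
  obtain ⟨c, hc⟩ := exists_chiDensity hn
  have h1 := hc univ MeasurableSet.univ
  simp only [mem_univ, ofPred_true, probReal_univ, inter_univ] at h1
  -- A non-integrable function has integral `0` by convention, whereas this integral is the total
  -- mass `1`.
  have hIntg : IntegrableOn (chiDensity n c) (Ioi 0) := by
    by_contra hcon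
    rw [integral_undef hcon] at h1
    exact one_ne_zero h1
  have hnn : 0 ≤ ∫ y in Ioi (0 : ℝ), y ^ (n - 1) * Real.exp (-y ^ 2 / 2) :=
    setIntegral_nonneg measurableSet_Ioi fun y hy => by have := mem_Ioi.1 hy; positivity
  have hcpos : 0 < c := by
    simp only [chiDensity] at h1
    rw [integral_const_mul] at h1
    by_contra! hcon
    nlinarith
  refine ⟨c, hcpos, hIntg, h1.symm, fun B hB => ?_⟩
  rw [map_measureReal_apply measurable_sqrt_sqNorm hB]
  exact hc B hB

lemma cdf_gaussian_strictMono : StrictMono (cdf (gaussianReal 0 1)) := by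
  intro x y hxy
  rw [cdf_eq_real, cdf_eq_real, ← Iic_union_Ioc_eq_Iic hxy.le,
    measureReal_union (Iic_disjoint_Ioc le_rfl) measurableSet_Ioc]
  have : 0 < (gaussianReal 0 1).real (Ioc x y) := by
    rw [measureReal_def, gaussianReal_apply_eq_integral _ one_ne_zero, ENNReal.toReal_ofReal
      (integral_nonneg fun _ => gaussianPDFReal_nonneg _ _ _)]
    rw [setIntegral_pos_iff_support_of_nonneg_ae
      (ae_of_all _ fun z => gaussianPDFReal_nonneg _ _ _)
      (integrable_gaussianPDFReal 0 1).integrableOn]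
    have : Function.support (gaussianPDFReal 0 1) = univ :=
      eq_univ_of_forall fun z => (gaussianPDFReal_pos 0 1 z one_ne_zero).ne'
    rw [this, univ_inter, Real.volume_Ioc]
    simpa using hxy
  linarith

/-- One power of `y/√m` cancels against the Jacobian; what is left is the chi density with `m`
degrees of freedom times `1/√g`, `g` being `logKernel`. -/
lemma rootDensity_sqrt {m : ℕ} (hm : 1 ≤ m) {y : ℝ} (hy : 0 < y) :
    rootDensity √m y = (√(2 * Real.pi))⁻¹ * Real.exp (m / 2) * (1 / √m) ^ (m - 1)
      * (y ^ (m - 1) * Real.exp (-y ^ 2 / 2)) * (1 / √(logKernel ((y / √m) ^ 2))) := by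
  have hm0 : (0 : ℝ) < m := by exact_mod_cast hm
  have hc : 0 < √(m : ℝ) := Real.sqrt_pos.2 hm0
  have ht : 0 < y / √m := div_pos hy hc
  rw [rootDensity_eq hm hy]
  have h1 : (y / √(m : ℝ)) ^ m = (1 / √m) ^ (m - 1) * y ^ (m - 1) * (y / √m) := by
    rw [← mul_pow, one_div_mul_eq_div, ← pow_succ, Nat.sub_add_cancel hm]
  have hg := Real.sqrt_pos.2 (logKernel_pos (u := (y / √(m : ℝ)) ^ 2) (by positivity))
  set g := √(logKernel ((y / √(m : ℝ)) ^ 2))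
  rw [h1]
  field_simp

/-- The quantile coupling of the norm of a Gaussian vector with a standard normal variable lies
between two explicit functions of the norm. -/
lemma exists_chi_coupling (hn : 2 ≤ n) : ∃ q : ℝ → ℝ,
    HasLaw (fun g : Fin n → ℝ => q √(sqNorm g)) (gaussianReal 0 1)
      (Measure.pi fun _ : Fin n => gaussianReal 0 1) ∧
    ∀ r, 0 < r → √n * signedRoot (r / √n) ≤ q r ∧
      q r ≤ √((n - 1 : ℕ) : ℝ) * signedRoot (r / √((n - 1 : ℕ) : ℝ)) := by
  obtain ⟨c, hc, hIntg, htot, hlaw⟩ := chi_density_props (show 1 ≤ n by omega)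
  set ν := (Measure.pi fun _ : Fin n => gaussianReal 0 1).map fun g => √(sqNorm g) with hν
  have : IsProbabilityMeasure ν :=
    Measure.isProbabilityMeasure_map measurable_sqrt_sqNorm.aemeasurable
  have hdpos : ∀ y : ℝ, 0 < y → 0 < chiDensity n c y := fun y hy => by
    unfold chiDensity; positivity
  have hνat : ∀ x, ν {x} = 0 := by
    intro x
    rw [← measureReal_eq_zero_iff, hlaw {x} (measurableSet_singleton x)]
    exact setIntegral_measure_zero _ (measure_mono_null inter_subset_right (by simp))
  have hν0 : ν (Iic 0) = 0 := by
    rw [← measureReal_eq_zero_iff, hlaw _ measurableSet_Iic]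
    have he : Ioi (0 : ℝ) ∩ Iic 0 = ∅ := by ext x; simp
    rw [he, setIntegral_empty]
  have hcdf : ∀ r, cdf ν r = ∫ y in Ioc 0 r, chiDensity n c y := by
    intro r
    rw [cdf_eq_real, hlaw _ measurableSet_Iic, Ioi_inter_Iic]
  have hνs : StrictMonoOn (cdf ν) (Ioi 0) := by
    intro x hx y hy hxy
    have hx' : 0 < x := hx
    rw [cdf_eq_real, cdf_eq_real, ← Iic_union_Ioc_eq_Iic hxy.le,
      measureReal_union (Iic_disjoint_Ioc le_rfl) measurableSet_Ioc, hlaw _ measurableSet_Ioc]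
    have hsub : Ioi 0 ∩ Ioc x y = Ioc x y :=
      inter_eq_right.2 fun z hz => hx'.trans hz.1
    rw [hsub]
    have : 0 < ∫ z in Ioc x y, chiDensity n c z := by
      rw [setIntegral_pos_iff_support_of_nonneg_ae]
      · refine lt_of_lt_of_le ?_ (measure_mono (show Ioc x y ⊆ _ from fun z hz =>
          ⟨(hdpos z (hx'.trans hz.1)).ne', hz⟩))
        rw [Real.volume_Ioc]
        simpa using hxy
      · exact (ae_restrict_iff' measurableSet_Ioc).2
          (ae_of_all _ fun z hz => (hdpos z (hx'.trans hz.1)).le)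
      · exact hIntg.mono_set fun z hz => hx'.trans hz.1
    linarith
  obtain ⟨q, hqm, hqmap, hq⟩ := exists_quantileTransform ν (gaussianReal 0 1) hνat
    (fun x => by
      have := nullSingletonClass_gaussianReal (μ := 0) (v := 1) one_ne_zero
      exact measure_singleton x) hν0 hνs cdf_gaussian_strictMono
  refine ⟨q, HasLaw.fun_comp (Y := q) (X := fun g : Fin n → ℝ => √(sqNorm g)) ⟨hqm, hqmap⟩
    ⟨measurable_sqrt_sqNorm.aemeasurable, hν.symm⟩, fun r hr => ⟨?_, ?_⟩⟩
  -- At scale `√n` the ratio of the root density to the chi density is a multiple of `1/√g`, which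
  -- increases with `y`.
  · rw [← cdf_gaussian_strictMono.le_iff_le, hq r hr, hcdf, cdf_eq_real]
    have hn0 : (0 : ℝ) < n := by exact_mod_cast (by omega : 0 < n)
    have hs : 0 < √(n : ℝ) := Real.sqrt_pos.2 hn0
    rw [← integral_rootDensity_Ioc hs hr]
    refine integral_le_of_likelihoodRatio hIntg (rootDensity_Ioi hs).1 htot (rootDensity_Ioi hs).2
      hr fun y hy z hz => ?_
    have hz0 : 0 < z := hr.trans hz
    have hy0 : 0 < y := hy.1
    have hyz : y ≤ z := hy.2.trans (le_of_lt hz)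
    rw [rootDensity_sqrt (by omega) hy0, rootDensity_sqrt (by omega) hz0]
    have hgy := logKernel_pos (u := (y / √n) ^ 2) (by positivity)
    have hgz := logKernel_pos (u := (z / √n) ^ 2) (by positivity)
    have hle : √(logKernel ((z / √n) ^ 2)) ≤ √(logKernel ((y / √n) ^ 2)) :=
      Real.sqrt_le_sqrt (logKernel_antitone (by positivity) (by gcongr))
    have hle' := one_div_le_one_div_of_le (Real.sqrt_pos.2 hgz) hle
    simp only [chiDensity]
    calc _ = (c * (z ^ (n - 1) * Real.exp (-z ^ 2 / 2)) * ((√(2 * Real.pi))⁻¹ * Real.exp (n / 2)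
          * (1 / √n) ^ (n - 1) * (y ^ (n - 1) * Real.exp (-y ^ 2 / 2))))
          * (1 / √(logKernel ((y / √n) ^ 2))) := by ring
      _ ≤ (c * (z ^ (n - 1) * Real.exp (-z ^ 2 / 2)) * ((√(2 * Real.pi))⁻¹ * Real.exp (n / 2)
          * (1 / √n) ^ (n - 1) * (y ^ (n - 1) * Real.exp (-y ^ 2 / 2))))
          * (1 / √(logKernel ((z / √n) ^ 2))) := mul_le_mul_of_nonneg_left hle' (by positivity)
      _ = _ := by ring
  -- At scale `√(n-1)` the power of `y` outside the Jacobian is already `n - 1`, so the ratio is a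
  -- multiple of `1/(t√g)` with `t = y/√(n-1)`. It decreases, because `u g(u)` increases, and the
  -- order is reversed.
  · rw [← cdf_gaussian_strictMono.le_iff_le, hq r hr, hcdf, cdf_eq_real]
    have hm0 : (0 : ℝ) < (n - 1 : ℕ) := by exact_mod_cast (by omega : 0 < n - 1)
    have hs : 0 < √((n - 1 : ℕ) : ℝ) := Real.sqrt_pos.2 hm0
    rw [← integral_rootDensity_Ioc hs hr]
    refine integral_le_of_likelihoodRatio (rootDensity_Ioi hs).1 hIntg (rootDensity_Ioi hs).2 htot
      hr fun y hy z hz => ?_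
    have hz0 : 0 < z := hr.trans hz
    have hy0 : 0 < y := hy.1
    have hyz : y ≤ z := hy.2.trans (le_of_lt hz)
    rw [rootDensity_eq (by omega) hy0, rootDensity_eq (by omega) hz0]
    set d := √((n - 1 : ℕ) : ℝ) with hd
    have hgy := logKernel_pos (u := (y / d) ^ 2) (by positivity)
    have hgz := logKernel_pos (u := (z / d) ^ 2) (by positivity)
    have hle : y / d * √(logKernel ((y / d) ^ 2)) ≤ z / d * √(logKernel ((z / d) ^ 2)) := by
      refine (sq_le_sq₀ (by positivity) (by positivity)).1 ?_
      rw [mul_pow, mul_pow, Real.sq_sqrt hgy.le, Real.sq_sqrt hgz.le]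
      exact mul_logKernel_monotone (by positivity) (by gcongr)
    have hle' := one_div_le_one_div_of_le (mul_pos (div_pos hy0 hs) (Real.sqrt_pos.2 hgy)) hle
    simp only [chiDensity]
    calc _ = (c * (y ^ (n - 1) * Real.exp (-y ^ 2 / 2)) * ((√(2 * Real.pi))⁻¹
          * Real.exp ((n - 1 : ℕ) / 2) * (1 / d) ^ (n - 1) * (z ^ (n - 1) * Real.exp (-z ^ 2 / 2))))
          * (1 / (z / d * √(logKernel ((z / d) ^ 2)))) := by ring
      _ ≤ (c * (y ^ (n - 1) * Real.exp (-y ^ 2 / 2)) * ((√(2 * Real.pi))⁻¹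
          * Real.exp ((n - 1 : ℕ) / 2) * (1 / d) ^ (n - 1) * (z ^ (n - 1) * Real.exp (-z ^ 2 / 2))))
          * (1 / (y / d * √(logKernel ((y / d) ^ 2)))) :=
        mul_le_mul_of_nonneg_left hle' (by positivity)
      _ = _ := by ring

/-- Comparing `u g(u)` with its value `1/2` at `u = 1` gives `t² - 1 ≤ √2 t κ(t) ≤ x t` with `x = √2
w`. This quadratic inequality implies `t² ≤ 1 + x + x²` as soon as `x ≥ -1`. -/
lemma le_of_signedRoot_le {t w : ℝ} (ht : 0 < t) (h : signedRoot t ≤ w) (hw : -1 ≤ √2 * w) :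
    t ^ 2 ≤ 1 + √2 * w + 2 * w ^ 2 := by
  have hg := logKernel_pos (u := t ^ 2) (by positivity)
  have h2 : (0 : ℝ) < √2 := by positivity
  have hkey : t ^ 2 - 1 ≤ √2 * w * t := by
    have hp : (t ^ 2 - 1) * 1 ≤ (t ^ 2 - 1) * (√2 * t * √(logKernel (t ^ 2))) := by
      have hsq : (√2 * t * √(logKernel (t ^ 2))) ^ 2 = 2 * (t ^ 2 * logKernel (t ^ 2)) := by
        rw [mul_pow, mul_pow, Real.sq_sqrt hg.le, Real.sq_sqrt zero_le_two]; ring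
      rcases le_total 1 (t ^ 2) with h1 | h1
      · refine mul_le_mul_of_nonneg_left ?_ (by linarith)
        have := mul_logKernel_monotone one_pos h1
        rw [logKernel_one] at this
        exact (sq_le_sq₀ zero_le_one (by positivity)).1 (by rw [hsq]; linarith)
      · refine mul_le_mul_of_nonpos_left ?_ (by linarith)
        have := mul_logKernel_monotone (by positivity) h1
        rw [logKernel_one] at this
        exact (sq_le_sq₀ (by positivity) zero_le_one).1 (by rw [hsq]; linarith)
    calc t ^ 2 - 1 = (t ^ 2 - 1) * 1 := by ring
      _ ≤ _ := hp
      _ = √2 * t * signedRoot t := by rw [signedRoot]; ring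
      _ ≤ √2 * t * w := mul_le_mul_of_nonneg_left h (by positivity)
      _ = _ := by ring
  have hw2 : 2 * w ^ 2 = (√2 * w) ^ 2 := by rw [mul_pow, Real.sq_sqrt zero_le_two]
  rw [hw2]
  generalize √2 * w = x at *
  rcases le_total 0 x with hx | hx
  · have : t ≤ 1 + x := by nlinarith
    nlinarith
  · rcases le_total t (1 + x) with h3 | h3 <;> nlinarith

/-- Comparing `g` with `g(1) = 1/2` on either side of `1` gives `√2 κ(t) ≤ t² - 1`. -/
lemma le_of_le_signedRoot {t w : ℝ} (ht : 0 < t) (h : w ≤ signedRoot t) :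
    1 + √2 * w ≤ t ^ 2 := by
  have hg := logKernel_pos (u := t ^ 2) (by positivity)
  have h2 : (0 : ℝ) < √2 := by positivity
  have hsq : (√2 * √(logKernel (t ^ 2))) ^ 2 = 2 * logKernel (t ^ 2) := by
    rw [mul_pow, Real.sq_sqrt hg.le, Real.sq_sqrt zero_le_two]
  have hp : (t ^ 2 - 1) * (√2 * √(logKernel (t ^ 2))) ≤ (t ^ 2 - 1) * 1 := by
    rcases le_total 1 (t ^ 2) with h1 | h1
    · refine mul_le_mul_of_nonneg_left ?_ (by linarith)
      have := logKernel_antitone one_pos h1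
      rw [logKernel_one] at this
      exact (sq_le_sq₀ (by positivity) zero_le_one).1 (by rw [hsq]; linarith)
    · refine mul_le_mul_of_nonpos_left ?_ (by linarith)
      have := logKernel_antitone (by positivity) h1
      rw [logKernel_one] at this
      exact (sq_le_sq₀ zero_le_one (by positivity)).1 (by rw [hsq]; linarith)
  have h3 := mul_le_mul_of_nonneg_left h h2.le
  rw [signedRoot] at h3
  linarith

/-- A standard normal function of a standard Gaussian vector that approximates the standardized
squared norm. -/
lemma exists_normal_approx_sqNorm (hn : 2 ≤ n) : ∃ T : (Fin n → ℝ) → ℝ, Measurable T ∧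
    HasLaw T (gaussianReal 0 1) (Measure.pi fun _ : Fin n => gaussianReal 0 1) ∧
    ∀ᵐ g ∂(Measure.pi fun _ : Fin n => gaussianReal 0 1), 4 * |T g| ≤ √n →
      |sqNorm g - n - √2 * √n * T g| ≤ 2 + 2 * T g ^ 2 ∧ n / 4 ≤ sqNorm g := by
  obtain ⟨q, hq, hb⟩ := exists_chi_coupling hn
  -- The quantile transform is only almost everywhere measurable, so a measurable version is used.
  refine ⟨hq.aemeasurable.mk _, hq.aemeasurable.measurable_mk,
    hq.congr hq.aemeasurable.ae_eq_mk.symm, ?_⟩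
  filter_upwards [hq.aemeasurable.ae_eq_mk, pi_gaussianReal_sqNorm_pos (show 1 ≤ n by omega)]
    with g hg hpos hT
  rw [← hg] at hT ⊢
  obtain ⟨h1, h2⟩ := hb _ hpos
  set r := √(sqNorm g) with hr
  set T := q r
  have hr2 : r ^ 2 = sqNorm g := Real.sq_sqrt (sqNorm_nonneg g)
  have hm : (1 : ℝ) ≤ (n - 1 : ℕ) := by exact_mod_cast (by omega : 1 ≤ n - 1)
  have hnm : (n : ℝ) = (n - 1 : ℕ) + 1 := by
    rw [Nat.cast_sub (by omega)]; simp
  set m : ℝ := ((n - 1 : ℕ) : ℝ)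
  have hn0 : (0 : ℝ) < n := by linarith
  have hsn : 0 < √(n : ℝ) := Real.sqrt_pos.2 hn0
  have hsm : 1 ≤ √m := Real.one_le_sqrt.2 hm
  have hsm0 : 0 < √m := by linarith
  have hs2 : √(2 : ℝ) ≤ 2 := by
    rw [Real.sqrt_le_left (by norm_num)]; norm_num
  have hs2' : (0 : ℝ) < √2 := by positivity
  rw [← hr2, abs_le]
  have hsqn := Real.sq_sqrt hn0.le
  have hsqm := Real.sq_sqrt (show 0 ≤ m by linarith)
  have h3 : T / √m ≤ signedRoot (r / √m) := (div_le_iff₀' hsm0).2 h2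
  have h4 := le_of_le_signedRoot (div_pos hpos hsm0) h3
  have h5 : m + √2 * √m * T ≤ r ^ 2 := by
    have h6 := mul_le_mul_of_nonneg_left h4 (show 0 ≤ m by linarith)
    rw [div_pow, hsqm, mul_div_cancel₀ _ (by linarith : m ≠ 0)] at h6
    refine le_trans (le_of_eq ?_) h6
    have h7 : m / √m = √m := Real.div_sqrt
    linear_combination (-√2 * T) * h7
  refine ⟨⟨?_, ?_⟩, ?_⟩
  -- Passing from `m = n - 1` to `n` costs `1` in the centring and at most `√2 (√n - √m) |T| ≤ |T|`
  -- in the scale.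
  · have hd0 : 0 ≤ √n - √m := sub_nonneg.2 (Real.sqrt_le_sqrt (by linarith))
    have hd : √n - √m ≤ 1 / 2 := by nlinarith
    have hd2 : √2 * (√n - √m) ≤ 1 := by nlinarith
    have h7 : √2 * (√n - √m) * T ≤ |T| := by
      have := mul_le_mul_of_nonneg_left (le_abs_self T) (mul_nonneg hs2'.le hd0)
      nlinarith [abs_nonneg T]
    have h8 := sq_abs T
    nlinarith [sq_nonneg (|T| - 1)]
  · have h3 : signedRoot (r / √n) ≤ T / √n := (le_div_iff₀' hsn).2 h1
    have h4 := le_of_signedRoot_le (div_pos hpos hsn) h3 (by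
      have : |T / √n| ≤ 1 / 2 := by
        rw [abs_div, abs_of_pos hsn, div_le_iff₀ hsn]; linarith
      nlinarith [abs_le.1 this])
    have h6 := mul_le_mul_of_nonneg_left h4 hn0.le
    rw [div_pow, hsqn, mul_div_cancel₀ _ hn0.ne'] at h6
    have h7 : (n : ℝ) * (1 + √2 * (T / √n) + 2 * (T / √n) ^ 2) = n + √2 * √n * T + 2 * T ^ 2 := by
      rw [div_pow, hsqn]
      field_simp
      linear_combination (-√2 * T) * hsqn
    linarith
  -- From `4 |T| ≤ √n ≤ √2 √m` the lower bound on `r²` is at least `m/2 ≥ n/4`.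
  · have h6 : √n ≤ √2 * √m := by
      rw [← Real.sqrt_mul zero_le_two]
      exact Real.sqrt_le_sqrt (by linarith)
    have h7 : -(√2 * √m * T) ≤ √2 * √m * (√2 * √m / 4) := by
      have := (neg_le_abs T).trans (show |T| ≤ √2 * √m / 4 by linarith)
      nlinarith [mul_pos hs2' hsm0]
    have h8 : √2 * √m * (√2 * √m / 4) = m / 2 := by
      nlinarith [Real.sq_sqrt (zero_le_two (α := ℝ))]
    linarith

end ChiCoupling

end PrecisionInference

namespace PrecisionInference

open Matrix

/-! ### Whitening the oracle. -/

section OracleNormalization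

variable {n p : ℕ}

lemma sum_subtype_pair {i j : Fin p} (hij : i ≠ j)
    (f : {m // m ∈ ({i, j} : Finset (Fin p))} → ℝ) :
    ∑ x, f x = f ⟨i, by simp⟩ + f ⟨j, by simp⟩ := by
  have h : (Finset.univ : Finset {m // m ∈ ({i, j} : Finset (Fin p))})
      = {⟨i, by simp⟩, ⟨j, by simp⟩} := by
    ext ⟨x, hx⟩
    have hx' : x = i ∨ x = j := by simpa using hx
    simp [hx', eq_comm (a := j)]
  rw [h, Finset.sum_pair (by simpa using hij)]

lemma sq_lt_mul_of_posDef {Ω : Matrix (Fin p) (Fin p) ℝ} (hΩ : Ω.PosDef) {i j : Fin p}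
    (hij : i ≠ j) : Ω i j ^ 2 < Ω i i * Ω j j := by
  have hsym : Ω j i = Ω i j := by simpa using hΩ.isHermitian.apply i j
  have hf : Function.Injective ![i, j] := by
    intro a b hab
    fin_cases a <;> fin_cases b <;> simp_all [eq_comm]
  have h := (hΩ.submatrix hf).det_pos
  rw [Matrix.det_fin_two] at h
  simp [hsym] at h
  nlinarith

/-- The square root factor of the block `Ω_{A,A}` that diagonalizes the correlation. -/
noncomputable def pairRoot (Ω : Matrix (Fin p) (Fin p) ℝ) (i j : Fin p) :
    Matrix {m // m ∈ ({i, j} : Finset (Fin p))} {m // m ∈ ({i, j} : Finset (Fin p))} ℝ :=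
  fun k l => √(Ω l.1 l.1 / 2) * (if k.1 = i then √(1 + Ω i j / √(Ω i i * Ω j j))
    else if l.1 = i then √(1 - Ω i j / √(Ω i i * Ω j j)) else -√(1 - Ω i j / √(Ω i i * Ω j j)))

lemma abs_corr_lt_one {Ω : Matrix (Fin p) (Fin p) ℝ} (hΩ : Ω.PosDef) {i j : Fin p}
    (hij : i ≠ j) : |Ω i j / √(Ω i i * Ω j j)| < 1 := by
  have h := sq_lt_mul_of_posDef hΩ hij
  have hpos : 0 < Ω i i * Ω j j := mul_pos (hΩ.diag_pos) (hΩ.diag_pos)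
  rw [abs_div, abs_of_pos (Real.sqrt_pos.2 hpos), div_lt_one (Real.sqrt_pos.2 hpos),
    ← Real.sqrt_sq_eq_abs]
  exact Real.sqrt_lt_sqrt (sq_nonneg _) h

/-- With correlation `ρ`, the row of `i` carries `√(1+ρ)` and that of `j` carries `±√(1-ρ)`. The
choice of this factor `B` matters: for symmetric `H`, the entry `(i, j)` of `Bᵀ H B` contains only
the diagonal of `H`, since the off-diagonal contributions cancel. -/
lemma pairRoot_transpose_mul {Ω : Matrix (Fin p) (Fin p) ℝ} (hΩ : Ω.PosDef) {i j : Fin p}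
    (hij : i ≠ j) : (pairRoot Ω i j)ᵀ * pairRoot Ω i j = block Ω {i, j} := by
  have hρ := abs_lt.1 (abs_corr_lt_one hΩ hij)
  have hii : 0 < Ω i i := hΩ.diag_pos
  have hjj : 0 < Ω j j := hΩ.diag_pos
  have hsym : Ω j i = Ω i j := by simpa using hΩ.isHermitian.apply i j
  have hab : √(Ω i i / 2) * √(Ω j j / 2) * 2 = √(Ω i i * Ω j j) := by
    rw [← Real.sqrt_mul (by positivity), show Ω i i / 2 * (Ω j j / 2) = (Ω i i * Ω j j) / 2 ^ 2 by
      ring, Real.sqrt_div (by positivity), Real.sqrt_sq zero_le_two]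
    ring
  have hρe : √(Ω i i * Ω j j) * (Ω i j / √(Ω i i * Ω j j)) = Ω i j := by
    field_simp
  set ρ := Ω i j / √(Ω i i * Ω j j) with hρdef
  have ha := Real.mul_self_sqrt (show 0 ≤ 1 + ρ by linarith)
  have hb := Real.mul_self_sqrt (show 0 ≤ 1 - ρ by linarith)
  have hi2 := Real.mul_self_sqrt (show 0 ≤ Ω i i / 2 by positivity)
  have hj2 := Real.mul_self_sqrt (show 0 ≤ Ω j j / 2 by positivity)
  ext ⟨k, hk⟩ ⟨l, hl⟩
  rw [Matrix.mul_apply, sum_subtype_pair hij]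
  simp only [Matrix.transpose_apply, pairRoot, block, Matrix.submatrix_apply, if_true, hij.symm,
    if_false, ← hρdef]
  have hk' : k = i ∨ k = j := by simpa using hk
  have hl' : l = i ∨ l = j := by simpa using hl
  rcases hk' with rfl | rfl <;> rcases hl' with rfl | rfl <;>
    simp only [if_true, hij.symm, if_false]
  · linear_combination (√(Ω l l / 2) * √(Ω l l / 2)) * (ha + hb) + 2 * hi2
  · linear_combination (√(Ω k k / 2) * √(Ω l l / 2)) * (ha - hb) + ρ * hab + hρe
  · rw [hsym]
    linear_combination (√(Ω k k / 2) * √(Ω l l / 2)) * (ha - hb) + ρ * hab + hρe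
  · linear_combination (√(Ω l l / 2) * √(Ω l l / 2)) * (ha + hb) + 2 * hj2

lemma pairRoot_isUnit {Ω : Matrix (Fin p) (Fin p) ℝ} (hΩ : Ω.PosDef) {i j : Fin p}
    (hij : i ≠ j) : IsUnit (pairRoot Ω i j).det := by
  have h := congrArg Matrix.det (pairRoot_transpose_mul hΩ hij)
  rw [Matrix.det_mul, Matrix.det_transpose] at h
  have h2 := (block_posDef hΩ {i, j}).det_pos
  rw [← h] at h2
  exact isUnit_iff_ne_zero.2 fun h0 => by simp [h0] at h2

/-- Directions along which the data are independent standard normal vectors. -/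
noncomputable def pairDir (Ω : Matrix (Fin p) (Fin p) ℝ) (i j : Fin p) :
    Matrix (Fin p) {m // m ∈ ({i, j} : Finset (Fin p))} ℝ :=
  residDir Ω {i, j} * (pairRoot Ω i j)ᵀ

/-- For `B = pairRoot` this is `B (BᵀB)⁻¹ Bᵀ = 1`. -/
lemma pairDir_cov {Ω : Matrix (Fin p) (Fin p) ℝ} (hΩ : Ω.PosDef) {i j : Fin p} (hij : i ≠ j) :
    (pairDir Ω i j)ᵀ * Ω⁻¹ * pairDir Ω i j = 1 := by
  have hu := pairRoot_isUnit hΩ hij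
  have h1 : (pairDir Ω i j)ᵀ * Ω⁻¹ * pairDir Ω i j
      = pairRoot Ω i j * theta Ω {i, j} * (pairRoot Ω i j)ᵀ := by
    rw [← residDir_cov hΩ, pairDir, Matrix.transpose_mul, Matrix.transpose_transpose]
    simp only [Matrix.mul_assoc]
  have hut : IsUnit (pairRoot Ω i j)ᵀ.det := by rwa [Matrix.det_transpose]
  rw [h1, theta, ← pairRoot_transpose_mul hΩ hij, Matrix.mul_inv_rev, ← Matrix.mul_assoc,
    Matrix.mul_nonsing_inv _ hu, Matrix.one_mul, Matrix.nonsing_inv_mul _ hut]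

lemma omegaOra_eq {Ω : Matrix (Fin p) (Fin p) ℝ} (hΩ : Ω.PosDef) {i j : Fin p} (hij : i ≠ j)
    (X : Matrix (Fin n) (Fin p) ℝ) :
    omegaOra Ω X {i, j} = (pairRoot Ω i j)ᵀ
      * ((1 / (n : ℝ)) • ((X * pairDir Ω i j)ᵀ * (X * pairDir Ω i j)))⁻¹ * pairRoot Ω i j := by
  have hu := pairRoot_isUnit hΩ hij
  have hut : IsUnit (pairRoot Ω i j)ᵀ.det := by rwa [Matrix.det_transpose]
  have h1 : (1 / (n : ℝ)) • ((X * pairDir Ω i j)ᵀ * (X * pairDir Ω i j))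
      = pairRoot Ω i j * thetaOra Ω X {i, j} * (pairRoot Ω i j)ᵀ := by
    rw [thetaOra, residCov, resid_beta hΩ, pairDir, ← Matrix.mul_assoc X, Matrix.transpose_mul,
      Matrix.transpose_transpose, Matrix.mul_smul, Matrix.smul_mul]
    simp only [Matrix.mul_assoc]
  rw [h1, Matrix.mul_inv_rev, Matrix.mul_inv_rev, omegaOra, Matrix.mul_assoc, Matrix.mul_assoc,
    Matrix.mul_assoc, Matrix.nonsing_inv_mul _ hu, Matrix.mul_one, ← Matrix.mul_assoc,
    Matrix.mul_nonsing_inv _ hut, Matrix.one_mul]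

lemma inv_pair_diag {i j : Fin p} (hij : i ≠ j)
    (G : Matrix {m // m ∈ ({i, j} : Finset (Fin p))} {m // m ∈ ({i, j} : Finset (Fin p))} ℝ)
    {u v w : ℝ} (hii : G ⟨i, by simp⟩ ⟨i, by simp⟩ = u) (hjj : G ⟨j, by simp⟩ ⟨j, by simp⟩ = v)
    (h12 : G ⟨i, by simp⟩ ⟨j, by simp⟩ = w) (h21 : G ⟨j, by simp⟩ ⟨i, by simp⟩ = w)
    (hd : u * v - w ^ 2 ≠ 0) :
    G⁻¹ = Matrix.of fun k l =>
      (if k = l then (if k.1 = i then v else u) else -w) / (u * v - w ^ 2) := by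
  refine Matrix.inv_eq_right_inv ?_
  ext ⟨k, hk⟩ ⟨l, hl⟩
  rw [Matrix.mul_apply, sum_subtype_pair hij]
  have hk' : k = i ∨ k = j := by simpa using hk
  have hl' : l = i ∨ l = j := by simpa using hl
  rcases hk' with rfl | rfl <;> rcases hl' with rfl | rfl <;>
    simp [hii, hjj, h12, h21, hij, hij.symm] <;> field_simp <;> ring

/-- The standardized oracle as a function of the Gram matrix of two independent standard normal
vectors. -/
lemma kappaOra_eq {Ω : Matrix (Fin p) (Fin p) ℝ} (hΩ : Ω.PosDef) {i j : Fin p} (hij : i ≠ j)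
    (X : Matrix (Fin n) (Fin p) ℝ) {u v w a b : ℝ}
    (ha : a = 1 + Ω i j / √(Ω i i * Ω j j)) (hb : b = 1 - Ω i j / √(Ω i i * Ω j j))
    (hu : u = sqNorm (fun r => (X * pairDir Ω i j) r ⟨i, by simp⟩) / n)
    (hv : v = sqNorm (fun r => (X * pairDir Ω i j) r ⟨j, by simp⟩) / n)
    (hw : w = ((fun r => (X * pairDir Ω i j) r ⟨i, by simp⟩) ⬝ᵥ
      fun r => (X * pairDir Ω i j) r ⟨j, by simp⟩) / n)
    (hd : u * v - w ^ 2 ≠ 0) :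
    kappaOra Ω X i j = √n / √2 * ((a * (v / (u * v - w ^ 2) - 1) - b * (u / (u * v - w ^ 2) - 1))
      / √(a ^ 2 + b ^ 2)) := by
  have hρ := abs_lt.1 (abs_corr_lt_one hΩ hij)
  have hii : 0 < Ω i i := hΩ.diag_pos
  have hjj : 0 < Ω j j := hΩ.diag_pos
  have hab : √(Ω i i / 2) * √(Ω j j / 2) * 2 = √(Ω i i * Ω j j) := by
    rw [← Real.sqrt_mul (by positivity), show Ω i i / 2 * (Ω j j / 2) = (Ω i i * Ω j j) / 2 ^ 2 by
      ring, Real.sqrt_div (by positivity), Real.sqrt_sq zero_le_two]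
    ring
  have hinv := inv_pair_diag hij
    ((1 / (n : ℝ)) • ((X * pairDir Ω i j)ᵀ * (X * pairDir Ω i j)))
    (u := u) (v := v) (w := w)
    (by rw [hu, sqNorm_eq_dotProduct]
        simp only [Matrix.smul_apply, Matrix.mul_apply, Matrix.transpose_apply, smul_eq_mul,
          dotProduct]
        ring)
    (by rw [hv, sqNorm_eq_dotProduct]
        simp only [Matrix.smul_apply, Matrix.mul_apply, Matrix.transpose_apply, smul_eq_mul,
          dotProduct]
        ring)
    (by rw [hw]
        simp only [Matrix.smul_apply, Matrix.mul_apply, Matrix.transpose_apply, smul_eq_mul,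
          dotProduct]
        ring)
    (by rw [hw, dotProduct_comm]
        simp only [Matrix.smul_apply, Matrix.mul_apply, Matrix.transpose_apply, smul_eq_mul,
          dotProduct]
        ring) hd
  have hs : 0 < √(Ω i i * Ω j j) := Real.sqrt_pos.2 (mul_pos hii hjj)
  have hs2 := Real.sq_sqrt (mul_pos hii hjj).le
  have hΩij : Ω i j = √(Ω i i * Ω j j) * ((a - b) / 2) := by
    rw [ha, hb]; field_simp; ring
  -- With `a = 1 + ρ` and `b = 1 - ρ`, the factor `1 + ρ²` is `(a² + b²) / 2`.
  have hden : √(Ω i i * Ω j j + Ω i j ^ 2) = √(Ω i i * Ω j j) * (√(a ^ 2 + b ^ 2) / √2) := by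
    rw [← Real.sqrt_div (by positivity), ← Real.sqrt_mul (by positivity)]
    congr 1
    have : a + b = 2 := by rw [ha, hb]; ring
    rw [hΩij, mul_pow, hs2]
    have hb' : b = 2 - a := by linarith
    rw [hb']
    ring
  have ha0 : 0 < a := by rw [ha]; linarith
  have hb0 : 0 < b := by rw [hb]; linarith
  have hent : omegaOra Ω X {i, j} ⟨i, by simp⟩ ⟨j, by simp⟩
      = √(Ω i i * Ω j j) / 2 * (a * (v / (u * v - w ^ 2)) - b * (u / (u * v - w ^ 2))) := by
    rw [omegaOra_eq hΩ hij, hinv]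
    have ha2 := Real.mul_self_sqrt ha0.le
    have hb2 := Real.mul_self_sqrt hb0.le
    rw [ha] at ha2
    rw [hb] at hb2
    rw [Matrix.mul_apply, sum_subtype_pair hij, Matrix.mul_apply, Matrix.mul_apply,
      sum_subtype_pair hij, sum_subtype_pair hij]
    simp only [Matrix.transpose_apply, pairRoot, Matrix.of_apply, if_true, hij.symm, hij, if_false,
      Subtype.mk.injEq,
      ← ha, ← hb] at ha2 hb2 ⊢
    rw [← hab]
    linear_combination (√(Ω i i / 2) * √(Ω j j / 2)) * (v / (u * v - w ^ 2) * ha2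
      - u / (u * v - w ^ 2) * hb2)
  rw [kappaOra, hent, hden]
  have h3 : Ω i j = √(Ω i i * Ω j j) / 2 * (a - b) := by rw [hΩij]; ring
  rw [h3]
  have hr : 0 < √(a ^ 2 + b ^ 2) := Real.sqrt_pos.2 (by positivity)
  have h22 := Real.sq_sqrt (zero_le_two (α := ℝ))
  generalize u / (u * v - w ^ 2) = x
  generalize v / (u * v - w ^ 2) = y
  have h2 : (0 : ℝ) < √2 := by positivity
  field_simp
  rw [h22]
  ring

end OracleNormalization

end PrecisionInference

namespace PrecisionInference

open Matrix

/-! ### Linearization of the standardized oracle. -/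

section OracleNormalApproximation

/-- A second-order expansion of `1/v` at `1`: the error is exactly `-d + (v - 1)²/v`. -/
lemma abs_inv_sub_one_add_le {v y d e : ℝ} (hv : 3 / 16 ≤ v) (hve : v = 1 + y + d) (hd : |d| ≤ e)
    (he : e ≤ 5 / 4) : |1 / v - 1 + y| ≤ 15 * e + 11 * y ^ 2 := by
  have hv0 : 0 < v := by linarith
  have h1 : 1 / v - 1 + y = -d + (y + d) ^ 2 / v := by
    have : y + d = v - 1 := by linarith
    rw [this]
    have : y = v - 1 - d := by linarith
    rw [this]
    field_simp
    ring
  rw [h1]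
  have h2 : (y + d) ^ 2 / v ≤ 16 / 3 * (y + d) ^ 2 := by
    rw [div_le_iff₀ hv0]
    nlinarith [sq_nonneg (y + d)]
  have h3 : 0 ≤ (y + d) ^ 2 / v := by positivity
  have h4 : d ^ 2 ≤ 5 / 4 * e := by
    rw [← sq_abs]
    nlinarith [abs_nonneg d]
  have h5 : (y + d) ^ 2 ≤ 2 * y ^ 2 + 2 * d ^ 2 := by nlinarith [sq_nonneg (y - d)]
  calc _ ≤ |-d| + |(y + d) ^ 2 / v| := abs_add_le _ _
    _ ≤ e + 16 / 3 * (2 * y ^ 2 + 2 * (5 / 4 * e)) := by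
        rw [abs_neg, abs_of_nonneg h3]
        linarith
    _ ≤ _ := by nlinarith [sq_nonneg y, abs_nonneg d]

lemma abs_comb_sub_le {N x y T₁ T₂ a b e₁ e₂ : ℝ} (hN : 0 < N) (ha : 0 < a) (hb : 0 < b)
    (hx : |x - 1 + √2 * T₁ / √N| ≤ e₁) (hy : |y - 1 + √2 * T₂ / √N| ≤ e₂) :
    |√N / √2 * ((a * (x - 1) - b * (y - 1)) / √(a ^ 2 + b ^ 2))
      - (-(a * T₁) + b * T₂) / √(a ^ 2 + b ^ 2)| ≤ √N * (e₁ + e₂) := by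
  have hsN : 0 < √N := Real.sqrt_pos.2 hN
  have h2 : (0 : ℝ) < √2 := by positivity
  have hR0 : 0 < √(a ^ 2 + b ^ 2) := Real.sqrt_pos.2 (by positivity)
  have haR : a ≤ √(a ^ 2 + b ^ 2) := Real.le_sqrt_of_sq_le (by nlinarith)
  have hbR : b ≤ √(a ^ 2 + b ^ 2) := Real.le_sqrt_of_sq_le (by nlinarith)
  generalize √(a ^ 2 + b ^ 2) = R at *
  have hid : √N / √2 * ((a * (x - 1) - b * (y - 1)) / R) - (-(a * T₁) + b * T₂) / R
      = √N / √2 * ((a * (x - 1 + √2 * T₁ / √N) - b * (y - 1 + √2 * T₂ / √N)) / R) := by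
    have h3 : √N / √2 * (√2 / √N) = 1 := by field_simp
    linear_combination ((-(a * T₁) + b * T₂) / R) * h3
  rw [hid, abs_mul, abs_of_pos (by positivity), abs_div, abs_of_pos hR0]
  have hA : |a * (x - 1 + √2 * T₁ / √N) - b * (y - 1 + √2 * T₂ / √N)| / R ≤ e₁ + e₂ := by
    rw [div_le_iff₀ hR0]
    have e3 : |a * (x - 1 + √2 * T₁ / √N)| ≤ R * e₁ := by
      rw [abs_mul, abs_of_pos ha]
      exact mul_le_mul haR hx (abs_nonneg _) hR0.le
    have e4 : |b * (y - 1 + √2 * T₂ / √N)| ≤ R * e₂ := by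
      rw [abs_mul, abs_of_pos hb]
      exact mul_le_mul hbR hy (abs_nonneg _) hR0.le
    refine (abs_sub _ _).trans ((add_le_add e3 e4).trans (le_of_eq ?_))
    ring
  exact mul_le_mul (div_le_self hsN.le (Real.one_le_sqrt.2 one_le_two)) hA (by positivity) hsN.le

/-- Deterministic comparison of the standardized oracle with a linear combination. -/
lemma abs_oracle_sub_le {N U V T₁ T₂ Z w a b : ℝ} (hN : 2 ≤ N) (ha : 0 < a) (hb : 0 < b)
    (hT₁ : 4 * |T₁| ≤ √N) (hT₂ : 4 * |T₂| ≤ √N) (hZ : 4 * |Z| ≤ √N)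
    (hU : |U - N - √2 * √N * T₁| ≤ 2 + 2 * T₁ ^ 2) (hU4 : N / 4 ≤ U)
    (hV : |V - N - √2 * √N * T₂| ≤ 2 + 2 * T₂ ^ 2) (hV4 : N / 4 ≤ V)
    (hw : w ^ 2 = U * Z ^ 2) :
    U / N * (V / N) - (w / N) ^ 2 ≠ 0 ∧
    |√N / √2 * ((a * (V / N / (U / N * (V / N) - (w / N) ^ 2) - 1)
        - b * (U / N / (U / N * (V / N) - (w / N) ^ 2) - 1)) / √(a ^ 2 + b ^ 2))
      - (-(a * T₁) + b * T₂) / √(a ^ 2 + b ^ 2)| ≤ 60 / √N * (1 + T₁ ^ 2 + Z ^ 2 + T₂ ^ 2) := by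
  have hN0 : 0 < N := by linarith
  have hsN : 0 < √N := Real.sqrt_pos.2 hN0
  have hsq := Real.sq_sqrt hN0.le
  have h2 : (0 : ℝ) < √2 := by positivity
  have h22 := Real.sq_sqrt (zero_le_two (α := ℝ))
  have hsmall : ∀ x : ℝ, 4 * |x| ≤ √N → x ^ 2 / N ≤ 1 / 16 := by
    intro x hx
    rw [div_le_iff₀ hN0, ← hsq, ← sq_abs x]
    nlinarith [abs_nonneg x]
  have h1N : 1 / N ≤ 1 / 2 := one_div_le_one_div_of_le (by norm_num) hN
  set q := Z ^ 2 / N with hq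
  have hq0 : 0 ≤ q := by positivity
  have hq16 : q ≤ 1 / 16 := hsmall Z hZ
  set u := U / N with hu
  set v := V / N with hv
  have hu4 : 1 / 4 ≤ u := by rw [hu, le_div_iff₀ hN0]; linarith
  have hv4 : 1 / 4 ≤ v := by rw [hv, le_div_iff₀ hN0]; linarith
  -- The inner product of the two vectors enters the determinant only through `q = Z²/N`, which is
  -- of the order of the allowed error.
  have hdet : u * v - (w / N) ^ 2 = u * (v - q) := by
    rw [div_pow, hw, hu, hq]
    field_simp
  have hvq : 3 / 16 ≤ v - q := by linarith
  have hu0 : 0 < u := by linarith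
  have hvq0 : 0 < v - q := by linarith
  have hscale : ∀ W T : ℝ, |W - N - √2 * √N * T| ≤ 2 + 2 * T ^ 2 →
      |W / N - 1 - √2 * T / √N| ≤ (2 + 2 * T ^ 2) / N := by
    intro W T h
    have : W / N - 1 - √2 * T / √N = (W - N - √2 * √N * T) / N := by
      field_simp
      linear_combination (√2 * T) * hsq
    rw [this, abs_div, abs_of_pos hN0]
    gcongr
  have hu1 := hscale U T₁ hU
  have hv1 := hscale V T₂ hV
  have hy : ∀ T : ℝ, (√2 * T / √N) ^ 2 = 2 * (T ^ 2 / N) := by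
    intro T
    rw [div_pow, mul_pow, h22, hsq]; ring
  have he : ∀ T : ℝ, (2 + 2 * T ^ 2) / N = 2 * (1 / N) + 2 * (T ^ 2 / N) := by intro T; ring
  have k1 := hsmall T₁ hT₁
  have k2 := hsmall T₂ hT₂
  have hE1 : |1 / u - 1 + √2 * T₁ / √N| ≤ 30 * (1 / N) + 52 * (T₁ ^ 2 / N) := by
    refine (abs_inv_sub_one_add_le (v := u) (d := u - 1 - √2 * T₁ / √N) (by linarith) (by ring)
      hu1 (by rw [he]; linarith)).trans ?_
    rw [hy, he]
    linarith
  have hE2 : |1 / (v - q) - 1 + √2 * T₂ / √N| ≤ 30 * (1 / N) + 52 * (T₂ ^ 2 / N) + 15 * q := by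
    refine (abs_inv_sub_one_add_le (v := v - q) (d := v - 1 - √2 * T₂ / √N - q)
      (e := (2 + 2 * T₂ ^ 2) / N + q) (by linarith) (by ring) ?_ (by rw [he]; linarith)).trans ?_
    · refine (abs_sub _ _).trans ?_
      rw [abs_of_nonneg hq0]
      linarith
    · rw [hy, he]
      linarith
  have hvd : v / (u * (v - q)) = 1 / u + q / (u * (v - q)) := by
    field_simp
    ring
  have hud : u / (u * (v - q)) = 1 / (v - q) := by
    field_simp
  have hq22 : |q / (u * (v - q))| ≤ 22 * q := by
    rw [abs_of_nonneg (by positivity), div_le_iff₀ (by positivity)]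
    have : 1 ≤ 22 * (u * (v - q)) := by nlinarith
    nlinarith
  have hE1' : |v / (u * (v - q)) - 1 + √2 * T₁ / √N|
      ≤ 30 * (1 / N) + 52 * (T₁ ^ 2 / N) + 22 * q := by
    rw [hvd, show 1 / u + q / (u * (v - q)) - 1 + √2 * T₁ / √N
      = (1 / u - 1 + √2 * T₁ / √N) + q / (u * (v - q)) by ring]
    exact (abs_add_le _ _).trans (add_le_add hE1 hq22)
  rw [← hud] at hE2
  rw [hdet]
  refine ⟨(mul_pos hu0 hvq0).ne', ?_⟩
  refine (abs_comb_sub_le hN0 ha hb hE1' hE2).trans ?_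
  have h3 : 60 / √N * (1 + T₁ ^ 2 + Z ^ 2 + T₂ ^ 2)
      = √N * (60 * (1 / N) + 60 * (T₁ ^ 2 / N) + 60 * (T₂ ^ 2 / N) + 60 * q) := by
    have : √N / N = 1 / √N := by rw [Real.sqrt_div_self', one_div]
    rw [hq]
    linear_combination (-60 * (1 + T₁ ^ 2 + Z ^ 2 + T₂ ^ 2)) * this
  rw [h3]
  refine mul_le_mul_of_nonneg_left ?_ hsN.le
  have t1 : 0 ≤ T₁ ^ 2 / N := by positivity
  have t2 : 0 ≤ T₂ ^ 2 / N := by positivity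
  linarith

variable {n p : ℕ}

lemma gaussianReal_comb {S : Type*} [MeasurableSpace S] {P : Measure S} {Y Z : S → ℝ}
    [IsProbabilityMeasure P]
    (h : HasLaw (fun ω => (Y ω, Z ω)) ((gaussianReal 0 1).prod (gaussianReal 0 1)) P) {a b : ℝ}
    (hab : a ^ 2 + b ^ 2 = 1) : HasLaw (fun ω => a * Y ω + b * Z ω) (gaussianReal 0 1) P := by
  have hY : HasLaw Y (gaussianReal 0 1) P :=
    HasLaw.fun_comp (Y := Prod.fst) ⟨measurable_fst.aemeasurable, Measure.fst_prod⟩ h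
  have hZ : HasLaw Z (gaussianReal 0 1) P :=
    HasLaw.fun_comp (Y := Prod.snd) ⟨measurable_snd.aemeasurable, Measure.snd_prod⟩ h
  have hind : IndepFun Y Z P := by
    rw [indepFun_iff_map_prod_eq_prod_map_map hY.aemeasurable hZ.aemeasurable, h.map_eq, hY.map_eq,
      hZ.map_eq]
  have hY' := gaussianReal_const_mul hY a
  have hZ' := gaussianReal_const_mul hZ b
  have hind' : IndepFun (fun ω => a * Y ω) (fun ω => b * Z ω) P :=
    hind.comp (measurable_const_mul a) (measurable_const_mul b)
  refine ⟨hY'.aemeasurable.add hZ'.aemeasurable, ?_⟩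
  refine (gaussianReal_add_gaussianReal_of_indepFun hind' hY'.map_eq hZ'.map_eq).trans ?_
  simp only [mul_zero, add_zero, mul_one]
  congr 1
  ext
  simpa using hab

lemma IsGaussianSample.exists_normal_approx_oracle {S : Type*} [MeasurableSpace S] {P : Measure S}
    [IsProbabilityMeasure P] {X : S → Matrix (Fin n) (Fin p) ℝ} {Ω : Matrix (Fin p) (Fin p) ℝ}
    (hX : IsGaussianSample P X Ω) (hΩ : Ω.PosDef) (hn : 2 ≤ n) {i j : Fin p} (hij : i ≠ j) :
    ∃ Z' Zii Zij Zjj : S → ℝ,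
        HasLaw Z' (gaussianReal 0 1) P ∧ HasLaw Zii (gaussianReal 0 1) P ∧
        HasLaw Zij (gaussianReal 0 1) P ∧ HasLaw Zjj (gaussianReal 0 1) P ∧
        (∃ a b c : ℝ, ∀ ω, Z' ω = a * Zii ω + b * Zij ω + c * Zjj ω) ∧
        ∀ᵐ ω ∂P, |Zii ω| ≤ 1 / 4 * √n → |Zij ω| ≤ 1 / 4 * √n → |Zjj ω| ≤ 1 / 4 * √n →
          |kappaOra Ω (X ω) i j - Z' ω|
            ≤ 60 / √n * (1 + Zii ω ^ 2 + Zij ω ^ 2 + Zjj ω ^ 2) := by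
  obtain ⟨T, hTm, hTlaw, hTae⟩ := exists_normal_approx_sqNorm hn
  have hρ := abs_lt.1 (abs_corr_lt_one hΩ hij)
  obtain ⟨a, ha⟩ : ∃ a, a = 1 + Ω i j / √(Ω i i * Ω j j) := ⟨_, rfl⟩
  obtain ⟨b, hb⟩ : ∃ b, b = 1 - Ω i j / √(Ω i i * Ω j j) := ⟨_, rfl⟩
  have ha0 : 0 < a := by rw [ha]; linarith
  have hb0 : 0 < b := by rw [hb]; linarith
  have hR0 : 0 < √(a ^ 2 + b ^ 2) := Real.sqrt_pos.2 (by positivity)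
  have hR2 := Real.sq_sqrt (show 0 ≤ a ^ 2 + b ^ 2 by positivity)
  have hcov := pairDir_cov hΩ hij
  have hW := hX.hasLaw_mulVec_pair hΩ (fun k => pairDir Ω i j k ⟨i, by simp⟩)
    (fun k => pairDir Ω i j k ⟨j, by simp⟩)
    (by rw [covForm_cols, hcov]; exact Matrix.one_apply_ne (by simpa using hij))
  rw [covForm_cols, covForm_cols, hcov, Matrix.one_apply_eq, Matrix.one_apply_eq,
    Real.toNNReal_one] at hW
  set W₁ : S → Fin n → ℝ := fun ω => X ω *ᵥ fun k => pairDir Ω i j k ⟨i, by simp⟩ with hW₁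
  set W₂ : S → Fin n → ℝ := fun ω => X ω *ᵥ fun k => pairDir Ω i j k ⟨j, by simp⟩ with hW₂
  have hl1 : HasLaw W₁ (Measure.pi fun _ : Fin n => gaussianReal 0 1) P :=
    HasLaw.fun_comp (Y := Prod.fst) ⟨measurable_fst.aemeasurable, Measure.fst_prod⟩ hW
  have hl2 : HasLaw W₂ (Measure.pi fun _ : Fin n => gaussianReal 0 1) P :=
    HasLaw.fun_comp (Y := Prod.snd) ⟨measurable_snd.aemeasurable, Measure.snd_prod⟩ hW
  have hneg : HasLaw (fun x : ℝ => -x) (gaussianReal 0 1) (gaussianReal 0 1) :=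
    ⟨measurable_neg.aemeasurable, by simpa using gaussianReal_map_neg (μ := 0) (v := 1)⟩
  have hpair : HasLaw (fun ω => (T (W₁ ω), T (W₂ ω)))
      ((gaussianReal 0 1).prod (gaussianReal 0 1)) P := by
    refine HasLaw.fun_comp (Y := Prod.map T T) ⟨(hTm.prodMap hTm).aemeasurable, ?_⟩ hW
    rw [← Measure.map_prod_map _ _ hTm hTm, hTlaw.map_eq]
  have hpos : ∀ᵐ v ∂(Measure.pi fun _ : Fin n => gaussianReal 0 1), 0 < sqNorm v := by
    filter_upwards [pi_gaussianReal_sqNorm_pos (show 1 ≤ n by omega)] with g hg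
    exact Real.sqrt_pos.1 hg
  have hae1 : ∀ᵐ ω ∂P, _ := ae_of_ae_map hl1.aemeasurable (by rw [hl1.map_eq]; exact hTae.and hpos)
  have hae2 : ∀ᵐ ω ∂P, _ := ae_of_ae_map hl2.aemeasurable (by rw [hl2.map_eq]; exact hTae)
  -- Inversion reverses signs, so the diagonal variables are `-T(W₁)` and `-T(W₂)`. The inner
  -- product normalized by `‖W₁‖` is standard normal but has coefficient `0` in `Z'`.
  refine ⟨fun ω => -(a / √(a ^ 2 + b ^ 2)) * T (W₁ ω) + b / √(a ^ 2 + b ^ 2) * T (W₂ ω),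
    fun ω => -T (W₁ ω), fun ω => W₁ ω ⬝ᵥ W₂ ω / √(sqNorm (W₁ ω)), fun ω => -T (W₂ ω),
    gaussianReal_comb hpair ?_, hneg.fun_comp (hTlaw.fun_comp hl1),
    hasLaw_dotProduct_div_norm hW hpos, hneg.fun_comp (hTlaw.fun_comp hl2),
    ⟨a / √(a ^ 2 + b ^ 2), 0, -(b / √(a ^ 2 + b ^ 2)), fun ω => by ring⟩, ?_⟩
  · rw [neg_sq, div_pow, div_pow, hR2, ← add_div, div_self (by positivity)]
  filter_upwards [hae1, hae2] with ω h1 h2 hz1 hz3 hz2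
  obtain ⟨h1, h1pos⟩ := h1
  simp only [abs_neg, neg_sq] at hz1 hz2 ⊢
  obtain ⟨hU, hU4⟩ := h1 (by linarith)
  obtain ⟨hV, hV4⟩ := h2 (by linarith)
  have hN : (2 : ℝ) ≤ n := by exact_mod_cast hn
  have hww : (W₁ ω ⬝ᵥ W₂ ω) ^ 2 = sqNorm (W₁ ω) * (W₁ ω ⬝ᵥ W₂ ω / √(sqNorm (W₁ ω))) ^ 2 := by
    rw [div_pow, Real.sq_sqrt h1pos.le]
    field_simp
  obtain ⟨hd, hmain⟩ := abs_oracle_sub_le hN ha0 hb0 (by linarith) (by linarith)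
    (show 4 * |W₁ ω ⬝ᵥ W₂ ω / √(sqNorm (W₁ ω))| ≤ √n by linarith) hU hU4 hV hV4 hww
  rw [kappaOra_eq hΩ hij (X ω) ha hb rfl rfl rfl hd]
  refine le_trans (le_of_eq ?_) hmain
  congr 2
  ring

end OracleNormalApproximation

end PrecisionInference

namespace PrecisionInference

open Matrix

/-! ### Deterministic tools for the square-root lasso. -/

section SqrtLasso

variable {n : ℕ} {J : Type*} [Fintype J]

/-- The normalized norm `‖v‖ / √n`. -/
noncomputable def rms (v : Fin n → ℝ) : ℝ := √(sqNorm v / n)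

/-- The weighted `ℓ₁` norm. -/
def wl1 (w : J → ℝ) (v : J → ℝ) : ℝ := ∑ k, w k * |v k|

lemma rms_nonneg (v : Fin n → ℝ) : 0 ≤ rms v := Real.sqrt_nonneg _

lemma rms_sq (v : Fin n → ℝ) : rms v ^ 2 = sqNorm v / n :=
  Real.sq_sqrt (div_nonneg (sqNorm_nonneg v) n.cast_nonneg)

lemma sqNorm_sub (u v : Fin n → ℝ) : sqNorm (u - v) = sqNorm u - 2 * (u ⬝ᵥ v) + sqNorm v := by
  simp only [sqNorm, dotProduct, Pi.sub_apply, Finset.mul_sum, ← Finset.sum_sub_distrib,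
    ← Finset.sum_add_distrib]
  exact Finset.sum_congr rfl fun _ _ => by ring

lemma rms_sub_sq (u v : Fin n → ℝ) :
    rms (u - v) ^ 2 = rms u ^ 2 - 2 * (u ⬝ᵥ v / n) + sqNorm v / n := by
  rw [rms_sq, rms_sq, sqNorm_sub]; ring

lemma dotProduct_le_rms (u v : Fin n → ℝ) : u ⬝ᵥ v / n ≤ rms u * rms v := by
  have h : (u ⬝ᵥ v) ^ 2 ≤ sqNorm u * sqNorm v := by
    simpa [dotProduct, sqNorm] using Finset.sum_mul_sq_le_sq_mul_sq Finset.univ u v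
  have h2 : (u ⬝ᵥ v / n) ^ 2 ≤ (rms u * rms v) ^ 2 := by
    rw [mul_pow, rms_sq, rms_sq, div_pow, div_mul_div_comm, ← sq]
    gcongr
  exact (le_abs_self _).trans (abs_le_of_sq_le_sq h2 (mul_nonneg (rms_nonneg u) (rms_nonneg v)))

lemma wl1_nonneg {w : J → ℝ} (hw : ∀ k, 0 ≤ w k) (v : J → ℝ) : 0 ≤ wl1 w v :=
  Finset.sum_nonneg fun k _ => mul_nonneg (hw k) (abs_nonneg _)

lemma wl1_sub_le {w : J → ℝ} (hw : ∀ k, 0 ≤ w k) (u v : J → ℝ) :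
    wl1 w u - wl1 w v ≤ wl1 w (v - u) := by
  rw [wl1, wl1, wl1, ← Finset.sum_sub_distrib]
  refine Finset.sum_le_sum fun k _ => ?_
  rw [← mul_sub, Pi.sub_apply, abs_sub_comm]
  exact mul_le_mul_of_nonneg_left (abs_sub_abs_le_abs_sub _ _) (hw k)

lemma wl1_add_le {w : J → ℝ} (hw : ∀ k, 0 ≤ w k) (u v : J → ℝ) :
    wl1 w (u + v) ≤ wl1 w u + wl1 w v := by
  rw [wl1, wl1, wl1, ← Finset.sum_add_distrib]
  refine Finset.sum_le_sum fun k _ => ?_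
  rw [← mul_add]
  exact mul_le_mul_of_nonneg_left (abs_add_le _ _) (hw k)

/-- The properties of the design and of the noise used in the analysis of the lasso. -/
structure LassoEvent (Y : Matrix (Fin n) J ℝ) (e : Fin n → ℝ) (w : J → ℝ)
    (lam ρ a b K wlo whi : ℝ) : Prop where
  lower : ∀ v, a * sqNorm v - K * wl1 w v ^ 2 ≤ sqNorm (Y *ᵥ v) / n
  upper : ∀ v, sqNorm (Y *ᵥ v) / n ≤ b * sqNorm v + K * wl1 w v ^ 2
  weight_lower : ∀ k, wlo ≤ w k
  weight_upper : ∀ k, w k ≤ whi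
  weight_eq : ∀ k, w k ^ 2 = sqNorm (fun r => Y r k) / n
  noise : ∀ k, |(fun r => Y r k) ⬝ᵥ e| / n ≤ ρ * lam * w k * rms e

variable {Y : Matrix (Fin n) J ℝ} {e : Fin n → ℝ} {w : J → ℝ} {lam ρ a b K wlo whi : ℝ}

lemma LassoEvent.weight_nonneg (hE : LassoEvent Y e w lam ρ a b K wlo whi) (hwlo : 0 < wlo)
    (k : J) : 0 ≤ w k := hwlo.le.trans (hE.weight_lower k)

lemma LassoEvent.abs_dotProduct_le (hE : LassoEvent Y e w lam ρ a b K wlo whi) (h : J → ℝ) :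
    |e ⬝ᵥ Y *ᵥ h / n| ≤ ρ * lam * rms e * wl1 w h := by
  have h1 : e ⬝ᵥ Y *ᵥ h / n = ∑ k, (fun r => Y r k) ⬝ᵥ e / n * h k := by
    rw [Matrix.dotProduct_mulVec, dotProduct, Finset.sum_div]
    refine Finset.sum_congr rfl fun k _ => ?_
    rw [dotProduct_comm]
    simp only [Matrix.vecMul]
    ring
  rw [h1, wl1, Finset.mul_sum]
  refine (Finset.abs_sum_le_sum_abs _ _).trans (Finset.sum_le_sum fun k _ => ?_)
  rw [abs_mul, abs_div, Nat.abs_cast]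
  calc _ ≤ ρ * lam * w k * rms e * |h k| :=
        mul_le_mul_of_nonneg_right (hE.noise k) (abs_nonneg _)
    _ = _ := by ring

/-- The subgradient inequality of the norm at `e`, that is Cauchy–Schwarz for `e` and `e - Y h`,
combined with the noise bound. -/
lemma LassoEvent.rms_sub_ge (hE : LassoEvent Y e w lam ρ a b K wlo whi) (he : 0 < rms e)
    (h : J → ℝ) : rms e - ρ * lam * wl1 w h ≤ rms (e - Y *ᵥ h) := by
  have h1 := dotProduct_le_rms e (e - Y *ᵥ h)
  have h2 : e ⬝ᵥ (e - Y *ᵥ h) / n = rms e ^ 2 - e ⬝ᵥ Y *ᵥ h / n := by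
    rw [dotProduct_sub, rms_sq, sqNorm_eq_dotProduct]; ring
  have h3 := (abs_le.1 (hE.abs_dotProduct_le h)).2
  rw [h2] at h1
  have h4 : rms e * (rms e - ρ * lam * wl1 w h) ≤ rms e * rms (e - Y *ᵥ h) := by nlinarith
  exact le_of_mul_le_mul_left h4 he

lemma abs_rms_sq_sub_le (hE : LassoEvent Y e w lam ρ a b K wlo whi) (h : J → ℝ) :
    |rms (e - Y *ᵥ h) ^ 2 - rms e ^ 2|
      ≤ 2 * (ρ * lam * rms e * wl1 w h) + sqNorm (Y *ᵥ h) / n := by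
  have h1 := abs_le.1 (hE.abs_dotProduct_le h)
  have h2 : 0 ≤ sqNorm (Y *ᵥ h) / n := div_nonneg (sqNorm_nonneg _) n.cast_nonneg
  rw [rms_sub_sq, abs_le]
  constructor <;> linarith

/-- The quadratic inequality that closes the analysis. -/
lemma le_of_quadratic {a c r B z q lam σ K H P : ℝ} (ha : 0 < a) (hc : 0 ≤ c) (hr : 0 ≤ r)
    (hB : 0 ≤ B) (hz : 0 ≤ z) (hlam : 0 ≤ lam) (hσ : 0 ≤ σ) (hq : q = lam * σ) (hK : 0 ≤ K)
    (hH0 : 0 ≤ H) (hH : H ≤ c * σ * (z + q)) (hlow : a * z ^ 2 - K * H ^ 2 ≤ P)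
    (hP : P ≤ 4 * lam * r * H + lam ^ 2 * H ^ 2 + B * q ^ 2)
    (hsmall : (lam ^ 2 + K) * σ ^ 2 * c ^ 2 ≤ a / 8) : z ≤ (1 + (16 * r * c + 2 * B) / a) * q := by
  have hq0 : 0 ≤ q := by rw [hq]; positivity
  have hD : 0 ≤ (16 * r * c + 2 * B) / a := by positivity
  -- If `z ≤ q` nothing is left to prove. Otherwise `z + q ≤ 2 z`, the `H²` terms cost at most half
  -- of `a z²`, and the other terms are at most a multiple of `q z`.
  rcases le_total z q with hzq | hzq
  · nlinarith [mul_nonneg hD hq0]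
  have h1 : lam * H ≤ c * q * (2 * z) := by
    have := mul_le_mul_of_nonneg_left hH hlam
    have h3 : lam * (c * σ * (z + q)) = c * q * (z + q) := by rw [hq]; ring
    have h4 : c * q * (z + q) ≤ c * q * (2 * z) :=
      mul_le_mul_of_nonneg_left (by linarith) (by positivity)
    linarith
  have h2 : (lam ^ 2 + K) * H ^ 2 ≤ a / 2 * z ^ 2 := by
    have h3 : H ^ 2 ≤ (c * σ * (2 * z)) ^ 2 := by
      refine pow_le_pow_left₀ hH0 (hH.trans ?_) 2
      exact mul_le_mul_of_nonneg_left (by linarith) (by positivity)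
    calc (lam ^ 2 + K) * H ^ 2 ≤ (lam ^ 2 + K) * (c * σ * (2 * z)) ^ 2 :=
          mul_le_mul_of_nonneg_left h3 (by positivity)
      _ = (lam ^ 2 + K) * σ ^ 2 * c ^ 2 * (4 * z ^ 2) := by ring
      _ ≤ a / 8 * (4 * z ^ 2) := mul_le_mul_of_nonneg_right hsmall (by positivity)
      _ = _ := by ring
  have h3 : B * q ^ 2 ≤ B * (q * z) := by
    rw [sq]
    exact mul_le_mul_of_nonneg_left (mul_le_mul_of_nonneg_left hzq hq0) hB
  have h4 : 4 * lam * r * H ≤ 8 * r * c * q * z := by nlinarith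
  have h5 : a / 2 * z * z ≤ (8 * r * c + B) * q * z := by nlinarith
  rcases hz.eq_or_lt with rfl | hz0
  · positivity
  have h6 := le_of_mul_le_mul_right h5 hz0
  have h7 : z ≤ (16 * r * c + 2 * B) / a * q := by
    rw [div_mul_eq_mul_div, le_div_iff₀ ha]
    linarith
  linarith

lemma sum_abs_le_sqrt_card (T : Finset J) {s : ℝ} (hT : (T.card : ℝ) ≤ s) (h : J → ℝ) :
    ∑ k ∈ T, |h k| ≤ √s * √(sqNorm h) := by
  have h1 : (∑ k ∈ T, |h k|) ^ 2 ≤ T.card * ∑ k ∈ T, |h k| ^ 2 := sq_sum_le_card_mul_sum_sq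
  have h2 : ∑ k ∈ T, |h k| ^ 2 ≤ sqNorm h := by
    simp only [sq_abs, sqNorm]
    exact Finset.sum_le_sum_of_subset_of_nonneg (Finset.subset_univ T) fun _ _ _ => sq_nonneg _
  rw [← Real.sqrt_mul (T.card.cast_nonneg.trans hT)]
  refine Real.le_sqrt_of_sq_le (h1.trans ?_)
  exact mul_le_mul hT h2 (Finset.sum_nonneg fun _ _ => sq_nonneg _) (T.card.cast_nonneg.trans hT)

/-- The cone inequality for a vector with small capped `ℓ₁` norm. -/
lemma wl1_le_of_cone {β h : J → ℝ} {s : ℝ} (hlam : 0 < lam) (hρ : ρ < 1) (hw0 : ∀ k, 0 ≤ w k)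
    (hwhi1 : 0 ≤ whi) (hwhi : ∀ k, w k ≤ whi) (hcap : ∑ k, min 1 (|β k| / lam) ≤ s)
    (hcone : wl1 w (β + h) - wl1 w β ≤ ρ * wl1 w h) :
    wl1 w h ≤ 2 * whi / (1 - ρ) * √s * (√(sqNorm h) + lam * √s) := by
  classical
  -- The capped sum bounds both the number of coordinates above `λ` by `s` and the ℓ₁ norm of the
  -- others by `λ s`.
  set T : Finset J := Finset.univ.filter fun k => lam < |β k| with hT
  have hmin0 : ∀ k, 0 ≤ min 1 (|β k| / lam) := fun k => le_min zero_le_one (by positivity)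
  have hs0 : 0 ≤ s := (Finset.sum_nonneg fun k _ => hmin0 k).trans hcap
  have hTs : (T.card : ℝ) ≤ s := by
    refine le_trans ?_ hcap
    calc (T.card : ℝ) = ∑ k ∈ T, (1 : ℝ) := by simp
      _ ≤ ∑ k ∈ T, min 1 (|β k| / lam) := Finset.sum_le_sum fun k hk => by
          have : lam < |β k| := (Finset.mem_filter.1 hk).2
          exact le_min le_rfl ((one_le_div hlam).2 this.le)
      _ ≤ _ := Finset.sum_le_sum_of_subset_of_nonneg (Finset.subset_univ T) fun k _ _ => hmin0 k
  have hTc : ∑ k ∈ Tᶜ, |β k| ≤ lam * s := by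
    calc ∑ k ∈ Tᶜ, |β k| = ∑ k ∈ Tᶜ, lam * min 1 (|β k| / lam) := by
          refine Finset.sum_congr rfl fun k hk => ?_
          have : ¬ lam < |β k| := by simpa [hT] using hk
          rw [min_eq_right ((div_le_one hlam).2 (not_lt.1 this)), mul_div_cancel₀ _ hlam.ne']
      _ = lam * ∑ k ∈ Tᶜ, min 1 (|β k| / lam) := by rw [Finset.mul_sum]
      _ ≤ lam * s := mul_le_mul_of_nonneg_left ((Finset.sum_le_sum_of_subset_of_nonneg
          (Finset.subset_univ _) fun k _ _ => hmin0 k).trans hcap) hlam.le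
  -- On `T` the triangle defect is charged to `h`, off `T` to `β`.
  have hkey : wl1 w h + wl1 w β - wl1 w (β + h)
      ≤ 2 * (whi * ∑ k ∈ T, |h k|) + 2 * (whi * ∑ k ∈ Tᶜ, |β k|) := by
    have h1 : wl1 w h + wl1 w β - wl1 w (β + h)
        = ∑ k, w k * (|h k| + |β k| - |β k + h k|) := by
      simp only [wl1, ← Finset.sum_add_distrib, ← Finset.sum_sub_distrib, Pi.add_apply]
      exact Finset.sum_congr rfl fun k _ => by ring
    rw [h1, ← Finset.sum_add_sum_compl T, Finset.mul_sum, Finset.mul_sum, Finset.mul_sum,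
      Finset.mul_sum]
    refine add_le_add (Finset.sum_le_sum fun k _ => ?_) (Finset.sum_le_sum fun k _ => ?_)
    · have : |h k| + |β k| - |β k + h k| ≤ 2 * |h k| := by
        have := abs_sub_abs_le_abs_sub (β k) (β k + h k)
        rw [sub_add_cancel_left, abs_neg] at this
        linarith
      calc _ ≤ w k * (2 * |h k|) := mul_le_mul_of_nonneg_left this (hw0 k)
        _ ≤ whi * (2 * |h k|) := mul_le_mul_of_nonneg_right (hwhi k) (by positivity)
        _ = _ := by ring
    · have : |h k| + |β k| - |β k + h k| ≤ 2 * |β k| := by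
        have := abs_sub_abs_le_abs_sub (h k) (β k + h k)
        rw [sub_add_cancel_right, abs_neg] at this
        linarith
      calc _ ≤ w k * (2 * |β k|) := mul_le_mul_of_nonneg_left this (hw0 k)
        _ ≤ whi * (2 * |β k|) := mul_le_mul_of_nonneg_right (hwhi k) (by positivity)
        _ = _ := by ring
  have h2 := sum_abs_le_sqrt_card T hTs h
  have h3 := mul_le_mul_of_nonneg_left h2 hwhi1
  have h4 := mul_le_mul_of_nonneg_left hTc hwhi1
  have hρ' : 0 < 1 - ρ := by linarith
  have hss := Real.mul_self_sqrt hs0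
  rw [div_mul_eq_mul_div, div_mul_eq_mul_div, le_div_iff₀ hρ']
  calc _ ≤ 2 * (whi * (√s * √(sqNorm h))) + 2 * (whi * (lam * s)) := by linarith
    _ = _ := by linear_combination (-2 * whi * lam) * hss

end SqrtLasso

end PrecisionInference

namespace PrecisionInference

open Matrix

/-! ### Rates of the square-root lasso and stationarity. -/

section EstimationBounds

variable {n : ℕ} {J : Type*} [Fintype J] {Y : Matrix (Fin n) J ℝ} {e y : Fin n → ℝ} {w : J → ℝ}
  {lam ρ a b K wlo whi s : ℝ}

/-- Estimation and prediction error bounds of the rate of the lasso. -/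
structure EstimationBound (Y : Matrix (Fin n) J ℝ) (w h : J → ℝ) (C lam s : ℝ) : Prop where
  l2 : √(sqNorm h) ≤ C * lam * √s
  l1 : wl1 w h ≤ C * lam * s
  pred : sqNorm (Y *ᵥ h) / n ≤ C * lam ^ 2 * s

/-- The constant in the error bounds. -/
noncomputable def estConst (a c r B : ℝ) : ℝ :=
  (c + 1) * (2 + (16 * r * c + 2 * B) / a)
    + (4 * r * (c * (2 + (16 * r * c + 2 * B) / a)) + (c * (2 + (16 * r * c + 2 * B) / a)) ^ 2 + B)

lemma estConst_pos {a c r B : ℝ} (ha : 0 < a) (hc : 0 ≤ c) (hr : 0 ≤ r) (hB : 0 ≤ B) :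
    0 < estConst a c r B := by
  unfold estConst
  positivity

/-- The common endgame of both estimators: `c` is their cone constant, and `B` an excess in the
prediction bound, zero for the lasso. -/
lemma EstimationBound.of_quadratic {c r B : ℝ} {h : J → ℝ}
    (hE : LassoEvent Y e w lam ρ a b K wlo whi) (hwlo : 0 < wlo) (ha : 0 < a)
    (hc : 0 ≤ c) (hr : 0 ≤ r) (hB : 0 ≤ B) (hlam : 0 ≤ lam) (hs : 0 ≤ s) (hK : 0 ≤ K)
    (hH : wl1 w h ≤ c * √s * (√(sqNorm h) + lam * √s))
    (hP : sqNorm (Y *ᵥ h) / n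
      ≤ 4 * lam * r * wl1 w h + lam ^ 2 * wl1 w h ^ 2 + B * (lam ^ 2 * s))
    (hsmall : (lam ^ 2 + K) * s * c ^ 2 ≤ a / 8) (hls : lam ^ 2 * s ≤ 1) :
    EstimationBound Y w h (estConst a c r B) lam s := by
  have hss := Real.sq_sqrt hs
  have hH0 := wl1_nonneg (hE.weight_nonneg hwlo) h
  have hlow := hE.lower h
  rw [← Real.sq_sqrt (sqNorm_nonneg h)] at hlow
  have hz := le_of_quadratic (B := B) ha hc hr hB (Real.sqrt_nonneg (sqNorm h)) hlam
    (Real.sqrt_nonneg s) rfl hK hH0 hH hlow (by rw [mul_pow, hss]; exact hP)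
    (by rw [hss]; exact hsmall)
  set D := (16 * r * c + 2 * B) / a with hD
  have hD0 : 0 ≤ D := by positivity
  have hq0 : 0 ≤ lam * √s := by positivity
  have hH2 : wl1 w h ≤ c * (2 + D) * (lam * s) := by
    calc wl1 w h ≤ c * √s * (√(sqNorm h) + lam * √s) := hH
      _ ≤ c * √s * ((1 + D) * (lam * √s) + lam * √s) := by gcongr
      _ = c * (2 + D) * (lam * √s ^ 2) := by ring
      _ = _ := by rw [hss]
  have hc2 : 0 ≤ c * (2 + D) := by positivity
  have hP2 : sqNorm (Y *ᵥ h) / n ≤ (4 * r * (c * (2 + D)) + (c * (2 + D)) ^ 2 + B)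
      * (lam ^ 2 * s) := by
    have h1 : 4 * lam * r * wl1 w h ≤ 4 * lam * r * (c * (2 + D) * (lam * s)) := by gcongr
    have h2 : lam ^ 2 * wl1 w h ^ 2 ≤ lam ^ 2 * (c * (2 + D) * (lam * s)) ^ 2 := by gcongr
    have h3 : lam ^ 2 * (c * (2 + D) * (lam * s)) ^ 2
        = (c * (2 + D)) ^ 2 * (lam ^ 2 * s) * (lam ^ 2 * s) := by ring
    have h4 : (c * (2 + D)) ^ 2 * (lam ^ 2 * s) * (lam ^ 2 * s) ≤ (c * (2 + D)) ^ 2 * (lam ^ 2 * s) :=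
      mul_le_of_le_one_right (by positivity) hls
    nlinarith
  have hest : estConst a c r B = (c + 1) * (2 + D)
    + (4 * r * (c * (2 + D)) + (c * (2 + D)) ^ 2 + B) := rfl
  have hX0 : 0 ≤ 4 * r * (c * (2 + D)) + (c * (2 + D)) ^ 2 + B := by positivity
  have hl2 : 0 ≤ lam * s := by positivity
  have hl3 : 0 ≤ lam ^ 2 * s := by positivity
  refine ⟨?_, ?_, ?_⟩
  · refine hz.trans ?_
    rw [hest, mul_assoc]
    refine mul_le_mul_of_nonneg_right ?_ hq0
    nlinarith
  · refine hH2.trans ?_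
    rw [hest, mul_assoc _ lam s]
    refine mul_le_mul_of_nonneg_right ?_ hl2
    nlinarith
  · refine hP2.trans ?_
    rw [hest, mul_assoc _ (lam ^ 2) s]
    refine mul_le_mul_of_nonneg_right ?_ hl3
    nlinarith

/-- Minimality is used twice: with `rms_sub_ge` it yields the cone condition, and squared it bounds
the prediction error. -/
lemma EstimationBound.of_sqrtLasso {β h : J → ℝ} {r : ℝ}
    (hE : LassoEvent Y e w lam ρ a b K wlo whi) (hwlo : 0 < wlo) (hwhi : 0 ≤ whi) (ha : 0 < a)
    (hρ : ρ < 1) (hlam : 0 < lam) (hK : 0 ≤ K) (he : 0 < rms e) (her : rms e ≤ r)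
    (hcap : ∑ k, min 1 (|β k| / lam) ≤ s) (hs : 0 ≤ s)
    (hmin : rms (e - Y *ᵥ h) + lam * wl1 w (β + h) ≤ rms e + lam * wl1 w β)
    (hsmall : (lam ^ 2 + K) * s * (2 * whi / (1 - ρ)) ^ 2 ≤ a / 8) (hls : lam ^ 2 * s ≤ 1) :
    EstimationBound Y w h (estConst a (2 * whi / (1 - ρ)) r 0) lam s := by
  have hρ' : 0 < 1 - ρ := by linarith
  have hw0 := hE.weight_nonneg hwlo
  have hH0 := wl1_nonneg hw0 h
  have hr : 0 ≤ r := he.le.trans her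
  refine EstimationBound.of_quadratic hE hwlo ha (by positivity) hr le_rfl hlam.le hs hK ?_ ?_
    hsmall hls
  · refine wl1_le_of_cone hlam hρ hw0 hwhi hE.weight_upper hcap ?_
    have := hE.rms_sub_ge he h
    have h1 : lam * (wl1 w (β + h) - wl1 w β) ≤ lam * (ρ * wl1 w h) := by linarith
    exact le_of_mul_le_mul_left h1 hlam
  · have h1 := abs_le.1 (hE.abs_dotProduct_le h)
    have h2 := rms_sub_sq e (Y *ᵥ h)
    have h3 : rms (e - Y *ᵥ h) ≤ rms e + lam * wl1 w h := by
      have := wl1_sub_le hw0 β (β + h)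
      rw [add_sub_cancel_left] at this
      nlinarith
    have h4 := pow_le_pow_left₀ (rms_nonneg _) h3 2
    have h5 : rms e * (lam * wl1 w h) ≤ r * (lam * wl1 w h) :=
      mul_le_mul_of_nonneg_right her (by positivity)
    have h6 : ρ * lam * rms e * wl1 w h ≤ rms e * (lam * wl1 w h) := by
      have : 0 ≤ rms e * (lam * wl1 w h) := by positivity
      nlinarith
    nlinarith

/-- The one-sided stationarity condition on the support of a minimizer. -/
lemma sqrtLasso_stationary [DecidableEq J] {β : J → ℝ} (hw0 : ∀ k, 0 ≤ w k) (hlam : 0 ≤ lam)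
    (hw : ∀ k, w k ^ 2 = sqNorm (fun r => Y r k) / n)
    (hmin : ∀ b', rms (y - Y *ᵥ β) + lam * wl1 w β ≤ rms (y - Y *ᵥ b') + lam * wl1 w b')
    {k : J} (hk : β k ≠ 0) :
    lam * w k * rms (y - Y *ᵥ β)
      ≤ (SignType.sign (β k) : ℝ) * ((fun r => Y r k) ⬝ᵥ (y - Y *ᵥ β) / n) := by
  set σ : ℝ := (SignType.sign (β k) : ℝ) with hσ
  have hσβ : σ * β k = |β k| := by rw [hσ, sign_mul_self]
  have hσ2 : σ * σ = 1 := by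
    rcases lt_or_gt_of_ne hk with h | h <;> simp [hσ, h]
  have hσabs : |σ| = 1 := by
    rcases lt_or_gt_of_ne hk with h | h <;> simp [hσ, h]
  set f := y - Y *ᵥ β with hf
  -- Moving coordinate `k` by `t` towards zero lowers the penalty by exactly `λ w_k t`, as `t ≤ |β
  -- k|`, so the residual norm must rise by at least as much. After squaring and dividing by `t`,
  -- the last term is removed by letting `t` be small.
  have hstep : ∀ t, 0 < t → t ≤ |β k| →
      2 * (lam * w k * rms f) ≤ 2 * (σ * ((fun r => Y r k) ⬝ᵥ f / n)) + t * w k ^ 2 := by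
    intro t ht htk
    have h1 := hmin (β - (t * σ) • Pi.single k 1)
    have h2 : y - Y *ᵥ (β - (t * σ) • Pi.single k 1) = f - (-(t * σ)) • fun r => Y r k := by
      rw [Matrix.mulVec_sub, Matrix.mulVec_smul, Matrix.mulVec_single_one, hf]
      ext r
      simp [Matrix.col]
      ring
    have h3 : wl1 w (β - (t * σ) • Pi.single k 1) = wl1 w β - w k * t := by
      have h4 : wl1 w β - wl1 w (β - (t * σ) • Pi.single k 1) = w k * t := by
        rw [wl1, wl1, ← Finset.sum_sub_distrib, Finset.sum_eq_single k]
        · have : β k - t * σ = σ * (|β k| - t) := by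
            linear_combination (-β k) * hσ2 + σ * hσβ
          simp only [Pi.sub_apply, Pi.smul_apply, Pi.single_eq_same, smul_eq_mul, mul_one]
          rw [this, abs_mul, hσabs, abs_of_nonneg (show 0 ≤ |β k| - t by linarith)]
          ring
        · intro l _ hl
          simp [Pi.single_eq_of_ne hl]
        · simp
      linarith
    rw [h2, h3] at h1
    have h5 : rms f + lam * w k * t ≤ rms (f - (-(t * σ)) • fun r => Y r k) := by linarith
    have h6 := pow_le_pow_left₀ (add_nonneg (rms_nonneg f)
      (mul_nonneg (mul_nonneg hlam (hw0 k)) ht.le)) h5 2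
    rw [rms_sub_sq, sqNorm_smul, dotProduct_smul, smul_eq_mul, neg_sq, mul_pow,
      dotProduct_comm f] at h6
    have h7 : σ ^ 2 = 1 := by rw [sq]; exact hσ2
    rw [h7, mul_one, mul_div_assoc (t ^ 2), ← hw k] at h6
    have h8 : 0 ≤ (lam * w k * t) ^ 2 := sq_nonneg _
    have h9 : t * (2 * (lam * w k * rms f))
        ≤ t * (2 * (σ * ((fun r => Y r k) ⬝ᵥ f / n)) + t * w k ^ 2) := by
      have : -(t * σ) * ((fun r => Y r k) ⬝ᵥ f) / n
        = -(t * (σ * ((fun r => Y r k) ⬝ᵥ f / n))) := by ring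
      rw [this] at h6
      nlinarith
    exact le_of_mul_le_mul_left h9 ht
  by_contra! hcon
  set D := lam * w k * rms f - σ * ((fun r => Y r k) ⬝ᵥ f / n) with hD
  have hD0 : 0 < D := by linarith
  have ht0 : 0 < min |β k| (D / (w k ^ 2 + 1)) := lt_min (abs_pos.2 hk) (by positivity)
  have h1 := hstep _ ht0 (min_le_left _ _)
  have h2 : min |β k| (D / (w k ^ 2 + 1)) * w k ^ 2 ≤ D := by
    calc _ ≤ D / (w k ^ 2 + 1) * w k ^ 2 :=
          mul_le_mul_of_nonneg_right (min_le_right _ _) (sq_nonneg _)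
      _ ≤ D := by
          rw [div_mul_eq_mul_div, div_le_iff₀ (by positivity)]
          nlinarith
  linarith

/-- Correlated columns: a bound on the number of coordinates in the support. -/
lemma sq_card_le_of_stationary [DecidableEq J] {β h : J → ℝ} {g : ℝ}
    (hE : LassoEvent Y e w lam ρ a b K wlo whi) (hwlo : 0 < wlo) (hlam : 0 ≤ lam) (hK : 0 ≤ K)
    (hb0 : 0 ≤ b) (hg : g ≤ rms (e - Y *ᵥ h) - ρ * rms e) (hg0 : 0 ≤ g) (B : Finset J)
    (hB : ∀ k ∈ B, lam * w k * rms (e - Y *ᵥ h)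
      ≤ (SignType.sign (β k) : ℝ) * ((fun r => Y r k) ⬝ᵥ (e - Y *ᵥ h) / n)) :
    ((B.card : ℝ) * (lam * wlo * g)) ^ 2
      ≤ (b * B.card + K * (whi * B.card) ^ 2) * (sqNorm (Y *ᵥ h) / n) := by
  -- The negated sign vector on `B` is the test direction: stationarity and the noise bound make `Yu
  -- · Yh` grow linearly in `|B|`, while `‖Yu‖²/n` is controlled by the upper eigenvalue bound.
  set u : J → ℝ := fun k => if k ∈ B then -(SignType.sign (β k) : ℝ) else 0 with hu
  have hσ : ∀ k, |(SignType.sign (β k) : ℝ)| ≤ 1 := by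
    intro k
    rcases lt_trichotomy (β k) 0 with h | h | h <;> simp [h]
  have hu1 : ∀ k, |u k| ≤ if k ∈ B then 1 else 0 := by
    intro k
    simp only [hu]
    split_ifs
    · rw [abs_neg]; exact hσ k
    · simp
  have hsum1 : (∑ k : J, if k ∈ B then (1 : ℝ) else 0) = B.card := by simp
  have husq : sqNorm u ≤ B.card := by
    rw [← hsum1, sqNorm]
    refine Finset.sum_le_sum fun k _ => ?_
    have := hu1 k
    rw [← sq_abs]
    split_ifs at this ⊢ <;> nlinarith [abs_nonneg (u k)]
  have huw : wl1 w u ≤ whi * B.card := by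
    rw [← hsum1, wl1, Finset.mul_sum]
    exact Finset.sum_le_sum fun k _ => mul_le_mul (hE.weight_upper k) (hu1 k) (abs_nonneg _)
      ((hE.weight_nonneg hwlo k).trans (hE.weight_upper k))
  have hw0 := hE.weight_nonneg hwlo
  have hdot : (Y *ᵥ u) ⬝ᵥ (Y *ᵥ h) / n
      = ∑ k ∈ B, -(SignType.sign (β k) : ℝ) * ((fun r => Y r k) ⬝ᵥ (Y *ᵥ h) / n) := by
    rw [dotProduct_comm, Matrix.dotProduct_mulVec, dotProduct, Finset.sum_div,
      ← Finset.sum_subset (Finset.subset_univ B)]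
    · refine Finset.sum_congr rfl fun k hk => ?_
      simp only [hu, if_pos hk]
      rw [dotProduct_comm (fun r => Y r k)]
      simp only [Matrix.vecMul]
      ring
    · intro k _ hk
      simp [hu, hk]
  have hterm : ∀ k ∈ B, lam * wlo * g
      ≤ -(SignType.sign (β k) : ℝ) * ((fun r => Y r k) ⬝ᵥ (Y *ᵥ h) / n) := by
    intro k hk
    have h1 := hB k hk
    have h2 : (fun r => Y r k) ⬝ᵥ (Y *ᵥ h) / n
        = (fun r => Y r k) ⬝ᵥ e / n - (fun r => Y r k) ⬝ᵥ (e - Y *ᵥ h) / n := by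
      rw [dotProduct_sub]; ring
    have h3 : (SignType.sign (β k) : ℝ) * ((fun r => Y r k) ⬝ᵥ e / n)
        ≤ ρ * lam * w k * rms e := by
      refine (le_abs_self _).trans ?_
      rw [abs_mul, abs_div, Nat.abs_cast]
      refine le_trans ?_ (hE.noise k)
      exact mul_le_of_le_one_left (by positivity) (hσ k)
    rw [h2]
    have h4 : lam * wlo * g ≤ lam * w k * (rms (e - Y *ᵥ h) - ρ * rms e) :=
      mul_le_mul (mul_le_mul_of_nonneg_left (hE.weight_lower k) hlam) hg hg0
        (mul_nonneg hlam (hw0 k))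
    linarith
  have hsum : (B.card : ℝ) * (lam * wlo * g) ≤ (Y *ᵥ u) ⬝ᵥ (Y *ᵥ h) / n := by
    rw [hdot, ← nsmul_eq_mul, ← Finset.sum_const]
    exact Finset.sum_le_sum hterm
  have hP0 : 0 ≤ sqNorm (Y *ᵥ h) / n := div_nonneg (sqNorm_nonneg _) n.cast_nonneg
  have hb : sqNorm (Y *ᵥ u) / n ≤ b * B.card + K * (whi * B.card) ^ 2 := by
    refine (hE.upper u).trans (add_le_add (mul_le_mul_of_nonneg_left husq hb0) ?_)
    exact mul_le_mul_of_nonneg_left (pow_le_pow_left₀ (wl1_nonneg hw0 u) huw 2) hK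
  calc ((B.card : ℝ) * (lam * wlo * g)) ^ 2 ≤ (rms (Y *ᵥ u) * rms (Y *ᵥ h)) ^ 2 :=
        pow_le_pow_left₀ (by positivity) (hsum.trans (dotProduct_le_rms _ _)) 2
    _ = sqNorm (Y *ᵥ u) / n * (sqNorm (Y *ᵥ h) / n) := by rw [mul_pow, rms_sq, rms_sq]
    _ ≤ _ := mul_le_mul_of_nonneg_right hb hP0

end EstimationBounds

end PrecisionInference

namespace PrecisionInference

open Matrix

/-! ### Size of the selected model and least squares on it. -/

section Selection

variable {n : ℕ} {J : Type*} [Fintype J] {Y : Matrix (Fin n) J ℝ} {e y : Fin n → ℝ} {w : J → ℝ}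
  {lam ρ a b K wlo whi s : ℝ}

/-- The quadratic bound of `sq_card_le_of_stationary` is useful only while the slack `K (whi N)²` is
below `b N`. It is therefore applied to a subset of `⌊L s⌋ + 1` elements, which it forces to have at
most `(L - 1) s`. -/
lemma card_le_of_stationary [DecidableEq J] {β h : J → ℝ} {g C L : ℝ}
    (hE : LassoEvent Y e w lam ρ a b K wlo whi) (hwlo : 0 < wlo) (hlam : 0 < lam) (hK : 0 ≤ K)
    (hb0 : 0 < b) (hC : 0 ≤ C) (hg : g ≤ rms (e - Y *ᵥ h) - ρ * rms e) (hg0 : 0 < g) (hs : 1 ≤ s)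
    (hEst : EstimationBound Y w h C lam s) (hL : L = 2 * b * C / (wlo * g) ^ 2 + 1)
    (hKs : K * s * (whi ^ 2 * (L + 1)) ≤ b) (S : Finset J)
    (hS : ∀ k ∈ S, lam * w k * rms (e - Y *ᵥ h)
      ≤ (SignType.sign (β k) : ℝ) * ((fun r => Y r k) ⬝ᵥ (e - Y *ᵥ h) / n)) :
    (S.card : ℝ) ≤ L * s := by
  by_contra! hcon
  have hL1 : 1 ≤ L := by
    rw [hL]
    have : 0 ≤ 2 * b * C / (wlo * g) ^ 2 := by positivity
    linarith
  have hLs : 1 ≤ L * s := by nlinarith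
  obtain ⟨B, hBS, hBc⟩ := Finset.exists_subset_card_eq
    (show ⌊L * s⌋₊ + 1 ≤ S.card by
      have := (Nat.floor_lt (by linarith : 0 ≤ L * s)).2 hcon
      omega)
  have hB1 : L * s < B.card := by
    rw [hBc]; push_cast
    exact Nat.lt_floor_add_one _
  have hB2 : (B.card : ℝ) ≤ (L + 1) * s := by
    rw [hBc]; push_cast
    have := Nat.floor_le (by linarith : 0 ≤ L * s)
    linarith
  have hmain := sq_card_le_of_stationary hE hwlo hlam.le hK hb0.le hg hg0.le B
    fun k hk => hS k (hBS hk)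
  set N : ℝ := (B.card : ℝ) with hN
  have hN0 : 0 < N := by linarith
  have h1 : K * (whi * N) ^ 2 ≤ b * N := by
    have h2 : K * whi ^ 2 * N ≤ K * whi ^ 2 * ((L + 1) * s) :=
      mul_le_mul_of_nonneg_left hB2 (by positivity)
    calc K * (whi * N) ^ 2 = K * whi ^ 2 * N * N := by ring
      _ ≤ b * N := mul_le_mul_of_nonneg_right (by linarith) hN0.le
  have h3 : (N * (lam * wlo * g)) ^ 2 ≤ (2 * b * N) * (C * lam ^ 2 * s) :=
    hmain.trans (mul_le_mul (by linarith) hEst.pred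
      (div_nonneg (sqNorm_nonneg _) n.cast_nonneg) (by positivity))
  have h4 : N * lam ^ 2 * (N * (wlo * g) ^ 2) ≤ N * lam ^ 2 * (2 * b * C * s) := by
    calc _ = (N * (lam * wlo * g)) ^ 2 := by ring
      _ ≤ _ := h3
      _ = _ := by ring
  have h5 := le_of_mul_le_mul_left h4 (by positivity)
  have h6 : N ≤ (L - 1) * s := by
    rw [hL, add_sub_cancel_right, div_mul_eq_mul_div, le_div_iff₀ (by positivity)]
    exact h5
  nlinarith

lemma continuous_rms : Continuous fun v : Fin n → ℝ => rms v := by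
  unfold rms sqNorm
  fun_prop

lemma exists_sqrtLasso_min (hlam : 0 < lam) (hwlo : 0 < wlo) (hw : ∀ k, wlo ≤ w k) :
    ∃ b : J → ℝ, ∀ b', rms (y - Y *ᵥ b) + lam * wl1 w b ≤ rms (y - Y *ᵥ b') + lam * wl1 w b' := by
  have hcont : Continuous fun b : J → ℝ => rms (y - Y *ᵥ b) + lam * wl1 w b := by
    refine (continuous_rms.comp ?_).add ?_
    · exact continuous_const.sub (continuous_const.matrix_mulVec continuous_id)
    · unfold wl1; fun_prop
  refine hcont.exists_forall_le ?_
  refine tendsto_atTop_mono (f := fun b : J → ℝ => lam * wlo * ‖b‖) (fun b => ?_)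
    ((tendsto_norm_cocompact_atTop).const_mul_atTop (by positivity))
  have h1 : ‖b‖ ≤ ∑ k, |b k| := by
    refine (pi_norm_le_iff_of_nonneg (Finset.sum_nonneg fun _ _ => abs_nonneg _)).2 fun k => ?_
    exact Finset.single_le_sum (f := fun k => |b k|) (fun _ _ => abs_nonneg _) (Finset.mem_univ k)
  have h2 : wlo * ‖b‖ ≤ wl1 w b := by
    refine (mul_le_mul_of_nonneg_left h1 hwlo.le).trans ?_
    rw [Finset.mul_sum, wl1]
    exact Finset.sum_le_sum fun k _ => mul_le_mul_of_nonneg_right (hw k) (abs_nonneg _)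
  have h3 := mul_le_mul_of_nonneg_left h2 hlam.le
  have h4 := rms_nonneg (y - Y *ᵥ b)
  linarith

/-- Least squares restricted to a set of coordinates on which the design is injective. -/
lemma exists_restricted_leastSquares (S : Set J) {c : ℝ} (hc : 0 < c)
    (hS : ∀ v : J → ℝ, (∀ k, v k ≠ 0 → k ∈ S) → c * sqNorm v ≤ sqNorm (Y *ᵥ v) / n) :
    ∃ b : J → ℝ, (∀ k, b k ≠ 0 → k ∈ S) ∧
      ∀ b' : J → ℝ, (∀ k, b' k ≠ 0 → k ∈ S) → rms (y - Y *ᵥ b) ≤ rms (y - Y *ᵥ b') := by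
  have hcont : Continuous fun b : J → ℝ => rms (y - Y *ᵥ b) :=
    continuous_rms.comp (continuous_const.sub (continuous_const.matrix_mulVec continuous_id))
  set F : Set (J → ℝ) := {v | ∀ k, v k ≠ 0 → k ∈ S} with hF
  have hclosed : IsClosed F := by
    have : F = ⋂ k ∈ Sᶜ, {v : J → ℝ | v k = 0} := by
      ext v
      simp only [Set.mem_iInter, Set.mem_compl_iff]
      exact ⟨fun h k hk => by
        by_contra h0
        exact hk (h k h0), fun h k hk => by
        by_contra h0
        exact hk (h k h0)⟩
    rw [this]
    exact isClosed_biInter fun k _ => isClosed_eq (continuous_apply k) continuous_const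
  have h0 : (0 : J → ℝ) ∈ F := fun k hk => absurd rfl hk
  have hlow : ∀ v ∈ F, c / 2 * ‖v‖ ^ 2 ≤ rms (y - Y *ᵥ v) ^ 2 + rms y ^ 2 := by
    intro v hv
    have h1 := hS v hv
    have h2 : ‖v‖ ^ 2 ≤ sqNorm v := by
      rw [← Real.sqrt_le_sqrt_iff (sqNorm_nonneg v), Real.sqrt_sq (norm_nonneg v)]
      refine (pi_norm_le_iff_of_nonneg (Real.sqrt_nonneg _)).2 fun k => ?_
      refine Real.le_sqrt_of_sq_le ?_
      rw [Real.norm_eq_abs, sq_abs]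
      exact Finset.single_le_sum (f := fun k => v k ^ 2) (fun _ _ => sq_nonneg _)
        (Finset.mem_univ k)
    have h3 : sqNorm (Y *ᵥ v) / n ≤ 2 * (rms (y - Y *ᵥ v) ^ 2 + rms y ^ 2) := by
      rw [rms_sq, rms_sq, ← add_div, ← mul_div_assoc]
      refine div_le_div_of_nonneg_right ?_ n.cast_nonneg
      simp only [sqNorm, ← Finset.sum_add_distrib, Finset.mul_sum, Pi.sub_apply]
      exact Finset.sum_le_sum fun r _ => by nlinarith [sq_nonneg (2 * y r - (Y *ᵥ v) r)]
    nlinarith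
  obtain ⟨b, hb, hmin⟩ := hcont.continuousOn.exists_isMinOn' hclosed h0 (by
    have ht : Tendsto (fun v : J → ℝ => c / 2 * ‖v‖ ^ 2) (cocompact _) atTop :=
      ((tendsto_pow_atTop two_ne_zero).comp tendsto_norm_cocompact_atTop).const_mul_atTop
        (by positivity)
    have h1 := (ht.eventually_ge_atTop (rms (y - Y *ᵥ 0) ^ 2 + rms y ^ 2)).filter_mono
      (inf_le_left : cocompact (J → ℝ) ⊓ 𝓟 F ≤ cocompact _)
    filter_upwards [h1, mem_inf_of_right (mem_principal_self F)] with v hv hvF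
    have := hlow v hvF
    exact (sq_le_sq₀ (rms_nonneg _) (rms_nonneg _)).1 (by linarith))
  exact ⟨b, hb, fun b' hb' => hmin hb'⟩

lemma wl1_le_card (hwhi : ∀ k, w k ≤ whi) (hwhi0 : 0 ≤ whi) (S : Finset J)
    {t : ℝ} (hS : (S.card : ℝ) ≤ t) {v : J → ℝ} (hv : ∀ k, v k ≠ 0 → k ∈ S) :
    wl1 w v ≤ whi * (√t * √(sqNorm v)) := by
  refine le_trans ?_ (mul_le_mul_of_nonneg_left (sum_abs_le_sqrt_card S hS v) hwhi0)
  rw [Finset.mul_sum, wl1, ← Finset.sum_subset (Finset.subset_univ S)]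
  · exact Finset.sum_le_sum fun k _ => mul_le_mul_of_nonneg_right (hwhi k) (abs_nonneg _)
  · intro k _ hk
    have : v k = 0 := by
      by_contra h
      exact hk (hv k h)
    simp [this]

/-- On `t`-sparse vectors the ℓ₁ slack is at most `K whi² t ‖v‖²`, half of the lower eigenvalue
bound. -/
lemma LassoEvent.lower_sparse (hE : LassoEvent Y e w lam ρ a b K wlo whi) (hwlo : 0 < wlo)
    (hwhi : 0 ≤ whi) (hK : 0 ≤ K) (S : Finset J) {t : ℝ} (hS : (S.card : ℝ) ≤ t)
    (hKt : K * (whi ^ 2 * t) ≤ a / 2) {v : J → ℝ} (hv : ∀ k, v k ≠ 0 → k ∈ S) :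
    a / 2 * sqNorm v ≤ sqNorm (Y *ᵥ v) / n := by
  have hw0 := hE.weight_nonneg hwlo
  have ht0 : 0 ≤ t := S.card.cast_nonneg.trans hS
  have h1 := wl1_le_card hE.weight_upper hwhi S hS hv
  have h2 := pow_le_pow_left₀ (wl1_nonneg hw0 v) h1 2
  rw [mul_pow, mul_pow, Real.sq_sqrt ht0, Real.sq_sqrt (sqNorm_nonneg v)] at h2
  have h3 := hE.lower v
  have h4 := mul_le_mul_of_nonneg_left h2 hK
  have h5 := mul_le_mul_of_nonneg_right hKt (sqNorm_nonneg v)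
  nlinarith

lemma sqrt_sqNorm_sub_le (u v : J → ℝ) : √(sqNorm (u - v)) ≤ √(sqNorm u) + √(sqNorm v) := by
  have h : ∀ x : J → ℝ, √(sqNorm x) = ‖(WithLp.toLp 2 x : EuclideanSpace ℝ J)‖ := by
    intro x
    rw [EuclideanSpace.norm_eq]
    simp [sqNorm]
  rw [h, h, h, WithLp.toLp_sub]
  exact norm_sub_le _ _

/-- Least squares after selection inherits the error bounds of the lasso. -/
lemma EstimationBound.of_leastSquares {h h' : J → ℝ} {C L r : ℝ}
    (hE : LassoEvent Y e w lam ρ a b K wlo whi) (hwlo : 0 < wlo) (hwhi : 0 ≤ whi) (ha : 0 < a)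
    (hρ : ρ ≤ 1) (hlam : 0 < lam) (hK : 0 ≤ K) (her : rms e ≤ r) (hC : 0 ≤ C)
    (hL : 0 ≤ L) (hs : 0 ≤ s) (hEst : EstimationBound Y w h C lam s) (S : Finset J)
    (hS : (S.card : ℝ) ≤ L * s) (hsupp : ∀ k, (h' - h) k ≠ 0 → k ∈ S)
    (hmin : rms (e - Y *ᵥ h') ≤ rms (e - Y *ᵥ h))
    (hsmall : (lam ^ 2 + K) * s * (whi * √L * (1 + C) + C) ^ 2 ≤ a / 8) (hls : lam ^ 2 * s ≤ 1) :
    EstimationBound Y w h' (estConst a (whi * √L * (1 + C) + C) r ((2 * r + 1) * C)) lam s := by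
  have hw0 := hE.weight_nonneg hwlo
  have hr : 0 ≤ r := (rms_nonneg e).trans her
  have hH0 := wl1_nonneg hw0 h'
  have hH1 := wl1_nonneg hw0 h
  have hss := Real.mul_self_sqrt hs
  refine EstimationBound.of_quadratic hE hwlo ha (by positivity) hr (by positivity) hlam.le hs hK
    ?_ ?_ hsmall hls
  -- A substitute for the cone condition: the two estimates differ only on the selected set, whose
  -- size is at most `L s`.
  · have h1 := wl1_le_card hE.weight_upper hwhi S hS hsupp
    have h2 := wl1_add_le hw0 (h' - h) h
    rw [sub_add_cancel] at h2
    have h3 : √(sqNorm (h' - h)) ≤ √(sqNorm h') + C * lam * √s :=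
      (sqrt_sqNorm_sub_le h' h).trans (by linarith [hEst.l2])
    rw [Real.sqrt_mul hL] at h1
    have h4 := mul_le_mul_of_nonneg_left h3 (show 0 ≤ whi * √L * √s by positivity)
    have hz := Real.sqrt_nonneg (sqNorm h')
    have h5 : 0 ≤ whi * √L * √s * √(sqNorm h') := by positivity
    have h6 : 0 ≤ √s * √(sqNorm h') := by positivity
    have h7 : 0 ≤ whi * √L * √s * (lam * √s) := by positivity
    have h8 : C * lam * s = C * √s * (lam * √s) := by
      linear_combination (-C * lam) * hss
    have h9 := hEst.l1
    have h10 := mul_nonneg hC h5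
    have h11 := mul_nonneg hC h6
    linarith
  -- The residual of least squares is no larger than that of the lasso, so the lasso error enters as
  -- the excess `(2 r + 1) C λ² s`.
  · have h1 := abs_le.1 (hE.abs_dotProduct_le h')
    have h2 := rms_sub_sq e (Y *ᵥ h')
    have h3 := (abs_le.1 (abs_rms_sq_sub_le hE h)).2
    have h4 := pow_le_pow_left₀ (rms_nonneg _) hmin 2
    have h5 : ∀ H, 0 ≤ H → ρ * lam * rms e * H ≤ lam * r * H := by
      intro H hH
      have e1 : ρ * rms e ≤ r := by nlinarith [rms_nonneg e]
      have := mul_le_mul_of_nonneg_right e1 (show 0 ≤ lam * H by positivity)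
      linarith
    have h6 := h5 _ hH0
    have h7 := h5 _ hH1
    have h8 : lam * r * wl1 w h ≤ r * C * (lam ^ 2 * s) := by
      have := mul_le_mul_of_nonneg_left hEst.l1 (show 0 ≤ lam * r by positivity)
      linarith
    have h9 := hEst.pred
    have h10 : 0 ≤ lam ^ 2 * wl1 w h' ^ 2 := by positivity
    have h11 : 0 ≤ lam * r * wl1 w h' := by positivity
    linarith

lemma EstimationBound.mono {h : J → ℝ} {C C' : ℝ} (hE : EstimationBound Y w h C lam s)
    (hC : C ≤ C') (hlam : 0 ≤ lam) (hs : 0 ≤ s) : EstimationBound Y w h C' lam s :=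
  ⟨hE.l2.trans (by gcongr), hE.l1.trans (by gcongr), hE.pred.trans (by gcongr)⟩

end Selection

/-! ### The deterministic theorem for both estimators. -/

section Deterministic

/-- `b` minimizes the square-root lasso criterion. -/
def IsSqrtLassoMin {n : ℕ} {J : Type} [Fintype J] (Y : Matrix (Fin n) J ℝ) (y : Fin n → ℝ)
    (w : J → ℝ) (lam : ℝ) (b : J → ℝ) : Prop :=
  ∀ b', rms (y - Y *ᵥ b) + lam * wl1 w b ≤ rms (y - Y *ᵥ b') + lam * wl1 w b'

/-- `b` is a least squares estimator among the vectors supported in `S`. -/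
def IsLeastSquaresOn {n : ℕ} {J : Type} [Fintype J] (Y : Matrix (Fin n) J ℝ) (y : Fin n → ℝ)
    (S : Set J) (b : J → ℝ) : Prop :=
  (∀ k, b k ≠ 0 → k ∈ S) ∧
    ∀ b', (∀ k, b' k ≠ 0 → k ∈ S) → rms (y - Y *ᵥ b) ≤ rms (y - Y *ᵥ b')

lemma exists_pos_forall_le (l : List ℝ) (h : ∀ x ∈ l, 0 < x) : ∃ κ > 0, ∀ x ∈ l, κ ≤ x := by
  induction l with
  | nil => exact ⟨1, one_pos, by simp⟩
  | cons x l ih =>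
    obtain ⟨κ, hκ, hl⟩ := ih fun y hy => h y (List.mem_cons_of_mem _ hy)
    refine ⟨min x κ, lt_min (h x List.mem_cons_self) hκ, fun y hy => ?_⟩
    rcases List.mem_cons.1 hy with rfl | hy
    · exact min_le_left _ _
    · exact (min_le_right _ _).trans (hl y hy)

/-- Existence and error bounds of the square-root lasso and of least squares after selection. -/
theorem sqrtLasso_and_leastSquares {a b wlo whi rlo rhi ρ : ℝ} (ha : 0 < a) (hb : 0 < b)
    (hwlo : 0 < wlo) (hwhi : 0 < whi) (hrlo : 0 < rlo) (hρ0 : 0 ≤ ρ) (hρ : ρ < 1)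
    (hrhi : 0 ≤ rhi) :
    ∃ C κ : ℝ, 0 < C ∧ 0 < κ ∧ ∀ {n : ℕ} {J : Type} [Fintype J] {Y : Matrix (Fin n) J ℝ}
      {y : Fin n → ℝ} {w β : J → ℝ} {lam K s : ℝ},
      LassoEvent Y (y - Y *ᵥ β) w lam ρ a b K wlo whi → 0 < lam → 0 ≤ K →
      rlo ≤ rms (y - Y *ᵥ β) → rms (y - Y *ᵥ β) ≤ rhi → ∑ k, min 1 (|β k| / lam) ≤ s → 1 ≤ s →
      lam ^ 2 * s ≤ κ → K * s ≤ κ →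
      (∃ b', IsSqrtLassoMin Y y w lam b') ∧ ∀ b', IsSqrtLassoMin Y y w lam b' →
        (EstimationBound Y w (b' - β) C lam s ∧ 0 < rms (y - Y *ᵥ b')) ∧
        (∃ c', IsLeastSquaresOn Y y {k | b' k ≠ 0} c') ∧
        ∀ c', IsLeastSquaresOn Y y {k | b' k ≠ 0} c' →
          EstimationBound Y w (c' - β) C lam s ∧ 0 < rms (y - Y *ᵥ c') := by
  classical
  have hρ' : 0 < 1 - ρ := by linarith
  obtain ⟨c₁, hc₁⟩ : ∃ c, c = 2 * whi / (1 - ρ) := ⟨_, rfl⟩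
  have hc₁0 : 0 ≤ c₁ := by rw [hc₁]; positivity
  obtain ⟨C₁, hC₁⟩ : ∃ c, c = estConst a c₁ rhi 0 := ⟨_, rfl⟩
  have hC₁0 : 0 < C₁ := by rw [hC₁]; exact estConst_pos ha hc₁0 hrhi le_rfl
  obtain ⟨g, hg⟩ : ∃ c, c = (1 - ρ) / 2 * rlo := ⟨_, rfl⟩
  have hg0 : 0 < g := by rw [hg]; positivity
  obtain ⟨L, hL⟩ : ∃ c, c = 2 * b * C₁ / (wlo * g) ^ 2 + 1 := ⟨_, rfl⟩
  have hL0 : 0 < L := by rw [hL]; positivity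
  obtain ⟨c₂, hc₂⟩ : ∃ c, c = whi * √L * (1 + C₁) + C₁ := ⟨_, rfl⟩
  have hc₂0 : 0 ≤ c₂ := by rw [hc₂]; positivity
  obtain ⟨C₂, hC₂⟩ : ∃ c, c = estConst a c₂ rhi ((2 * rhi + 1) * C₁) := ⟨_, rfl⟩
  have hC₂0 : 0 < C₂ := by rw [hC₂]; exact estConst_pos ha hc₂0 hrhi (by positivity)
  -- In order, the entries give: `λ² s ≤ 1`; absorption of the quadratic terms for the lasso; a
  -- lasso residual above the noise by `g`; the support count; eigenvalues on the support;
  -- absorption for least squares; a positive least squares residual.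
  obtain ⟨κ, hκ0, hκ⟩ := exists_pos_forall_le [1, a / (16 * (c₁ ^ 2 + 1)), g / C₁,
    b / (whi ^ 2 * (L + 1)), a / (2 * (whi ^ 2 * L)), a / (16 * (c₂ ^ 2 + 1)), rlo / (2 * C₂)] (by
      intro x hx
      simp only [List.mem_cons, List.not_mem_nil, or_false] at hx
      rcases hx with rfl | rfl | rfl | rfl | rfl | rfl | rfl <;> positivity)
  have k1 := hκ 1 (by simp)
  have k2 := hκ (a / (16 * (c₁ ^ 2 + 1))) (by simp)
  have k3 := hκ (g / C₁) (by simp)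
  have k4 := hκ (b / (whi ^ 2 * (L + 1))) (by simp)
  have k5 := hκ (a / (2 * (whi ^ 2 * L))) (by simp)
  have k6 := hκ (a / (16 * (c₂ ^ 2 + 1))) (by simp)
  have k7 := hκ (rlo / (2 * C₂)) (by simp)
  rw [le_div_iff₀ (by positivity)] at k2 k3 k4 k5 k6 k7
  refine ⟨max C₁ C₂, κ, lt_max_of_lt_left hC₁0, hκ0, ?_⟩
  intro n J _ Y y w β lam K s hE hlam hK hr1 hr2 hcap hs hls hKs
  have hs0 : 0 ≤ s := by linarith
  have he0 : 0 < rms (y - Y *ᵥ β) := hrlo.trans_le hr1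
  have hls0 : 0 ≤ lam ^ 2 * s := by positivity
  have hKs0 : 0 ≤ K * s := by positivity
  have hsub : ∀ v : J → ℝ, y - Y *ᵥ v = (y - Y *ᵥ β) - Y *ᵥ (v - β) := by
    intro v
    rw [Matrix.mulVec_sub]; abel
  have hsm : ∀ c : ℝ, κ * (16 * (c ^ 2 + 1)) ≤ a → (lam ^ 2 + K) * s * c ^ 2 ≤ a / 8 := by
    intro c hc
    have h1 : (lam ^ 2 + K) * s ≤ 2 * κ := by linarith
    have := mul_le_mul_of_nonneg_right h1 (sq_nonneg c)
    linarith
  refine ⟨exists_sqrtLasso_min hlam hwlo hE.weight_lower, fun b' hb' => ?_⟩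
  have hEst : EstimationBound Y w (b' - β) C₁ lam s := by
    rw [hC₁, hc₁]
    refine EstimationBound.of_sqrtLasso (β := β) hE hwlo hwhi.le ha hρ hlam hK he0 hr2 hcap hs0 ?_
      (by rw [← hc₁]; exact hsm c₁ k2) (hls.trans k1)
    have := hb' β
    rwa [← hsub b', show β + (b' - β) = b' by abel]
  have hgb : g ≤ rms (y - Y *ᵥ b') - ρ * rms (y - Y *ᵥ β) := by
    have h1 := hE.rms_sub_ge he0 (b' - β)
    rw [← hsub b'] at h1
    have h2 : ρ * lam * wl1 w (b' - β) ≤ g := by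
      have h3 := mul_le_mul_of_nonneg_left hEst.l1 hlam.le
      have h4 : 0 ≤ lam * wl1 w (b' - β) :=
        mul_nonneg hlam.le (wl1_nonneg (hE.weight_nonneg hwlo) _)
      have h5 := mul_le_mul_of_nonneg_right hls hC₁0.le
      have h6 := mul_le_of_le_one_left h4 hρ.le
      linarith
    have h3 : (1 - ρ) * rlo ≤ (1 - ρ) * rms (y - Y *ᵥ β) := mul_le_mul_of_nonneg_left hr1 hρ'.le
    rw [hg] at h2 ⊢
    linarith
  have hstat : ∀ k ∈ Finset.univ.filter (fun k => b' k ≠ 0), lam * w k * rms (y - Y *ᵥ b')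
      ≤ (SignType.sign (b' k) : ℝ) * ((fun r => Y r k) ⬝ᵥ (y - Y *ᵥ b') / n) := fun k hk =>
    sqrtLasso_stationary (hE.weight_nonneg hwlo) hlam.le hE.weight_eq hb' (Finset.mem_filter.1 hk).2
  have hcard : ((Finset.univ.filter fun k => b' k ≠ 0).card : ℝ) ≤ L * s := by
    refine card_le_of_stationary (β := b') (h := b' - β) hE hwlo hlam hK hb hC₁0.le
      (by rw [← hsub]; exact hgb) hg0 hs hEst hL ?_ _ (by rw [← hsub]; exact hstat)
    exact (mul_le_mul_of_nonneg_right hKs (by positivity)).trans k4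
  refine ⟨⟨hEst.mono (le_max_left _ _) hlam.le hs0, ?_⟩, ?_, fun c' hc' => ?_⟩
  · have := mul_nonneg hρ0 (rms_nonneg (y - Y *ᵥ β))
    linarith
  · refine exists_restricted_leastSquares _ (half_pos ha) fun v hv => ?_
    refine hE.lower_sparse hwlo hwhi.le hK _ hcard ?_ fun k hk => by simpa using hv k hk
    have := mul_le_mul_of_nonneg_right hKs (show 0 ≤ whi ^ 2 * L by positivity)
    linarith
  have hEst' : EstimationBound Y w (c' - β) C₂ lam s := by
    rw [hC₂, hc₂]
    refine EstimationBound.of_leastSquares hE hwlo hwhi.le ha hρ.le hlam hK hr2 hC₁0.le hL0.le hs0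
      hEst _ hcard ?_ ?_ (by rw [← hc₂]; exact hsm c₂ k6) (hls.trans k1)
    · intro k hk
      rw [Finset.mem_filter]
      refine ⟨Finset.mem_univ k, fun h0 => hk ?_⟩
      have : c' k = 0 := by
        by_contra h1
        exact hc'.1 k h1 h0
      simp [h0, this]
    · rw [← hsub, ← hsub]
      exact hc'.2 b' fun k hk => hk
  refine ⟨hEst'.mono (le_max_right _ _) hlam.le hs0, ?_⟩
  have h1 := hE.rms_sub_ge he0 (c' - β)
  rw [← hsub c'] at h1
  have h2 : ρ * lam * wl1 w (c' - β) ≤ rlo / 2 := by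
    have h3 := mul_le_mul_of_nonneg_left hEst'.l1 hlam.le
    have h4 : 0 ≤ lam * wl1 w (c' - β) :=
      mul_nonneg hlam.le (wl1_nonneg (hE.weight_nonneg hwlo) _)
    have h5 := mul_le_mul_of_nonneg_right hls hC₂0.le
    have h6 := mul_le_of_le_one_left h4 hρ.le
    linarith
  linarith

end Deterministic

end PrecisionInference

namespace PrecisionInference

open Matrix

/-! ### Spectral bounds as bounds on quadratic forms. -/

section QuadraticForms

variable {ι : Type*} [Fintype ι] [DecidableEq ι]

/-- `c ‖x‖² ≤ xᵀ B x ≤ d ‖x‖²` for all `x`. -/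
def QuadFormBounds {ι : Type*} [Fintype ι] (B : Matrix ι ι ℝ) (c d : ℝ) : Prop :=
  ∀ x : ι → ℝ, c * sqNorm x ≤ x ⬝ᵥ B *ᵥ x ∧ x ⬝ᵥ B *ᵥ x ≤ d * sqNorm x

lemma quadFormBounds_of_eigenvalues {B : Matrix ι ι ℝ} (hB : B.IsHermitian) {c d : ℝ}
    (h : ∀ k, c ≤ hB.eigenvalues k ∧ hB.eigenvalues k ≤ d) : QuadFormBounds B c d := by
  intro x
  set U : Matrix ι ι ℝ := (hB.eigenvectorUnitary : Matrix ι ι ℝ) with hU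
  have hUU : U * Uᵀ = 1 := by
    have := (Matrix.mem_unitaryGroup_iff (A := U)).1 hB.eigenvectorUnitary.2
    simpa [Matrix.star_eq_conjTranspose] using this
  have hBU : B = U * diagonal hB.eigenvalues * Uᵀ := by
    have := hB.spectral_theorem
    rw [Unitary.conjStarAlgAut_apply] at this
    simpa [Matrix.star_eq_conjTranspose] using this
  have h1 : x ⬝ᵥ B *ᵥ x = ∑ k, hB.eigenvalues k * (Uᵀ *ᵥ x) k ^ 2 := by
    conv_lhs => rw [hBU]
    rw [← mulVec_mulVec, ← mulVec_mulVec, dotProduct_mulVec, ← mulVec_transpose, dotProduct]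
    refine Finset.sum_congr rfl fun k _ => ?_
    rw [mulVec_diagonal]
    ring
  have h2 : sqNorm x = ∑ k, (Uᵀ *ᵥ x) k ^ 2 := by
    change _ = sqNorm (Uᵀ *ᵥ x)
    rw [sqNorm_eq_dotProduct, sqNorm_eq_dotProduct, dotProduct_mulVec, ← mulVec_transpose,
      transpose_transpose, mulVec_mulVec, hUU, one_mulVec]
  rw [h1, h2, Finset.mul_sum, Finset.mul_sum]
  exact ⟨Finset.sum_le_sum fun k _ => mul_le_mul_of_nonneg_right (h k).1 (sq_nonneg _),
    Finset.sum_le_sum fun k _ => mul_le_mul_of_nonneg_right (h k).2 (sq_nonneg _)⟩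

/-- For the upper bound put `z = B⁻¹ v`. Then `‖z‖² ≤ M (v · z)`, and Cauchy–Schwarz gives `(v · z)²
≤ M ‖v‖² (v · z)`. -/
lemma QuadFormBounds.inv {B : Matrix ι ι ℝ} (hB : B.PosDef) {M : ℝ} (hM : 0 < M)
    (h : QuadFormBounds B (1 / M) M) : QuadFormBounds B⁻¹ (1 / M) M := by
  intro v
  refine ⟨inv_quadForm_ge hB hM (fun x => (h x).2) v, ?_⟩
  have hu := (Matrix.isUnit_iff_isUnit_det _).1 hB.isUnit
  set z := B⁻¹ *ᵥ v with hz
  have hBz : B *ᵥ z = v := by rw [hz, mulVec_mulVec, Matrix.mul_nonsing_inv _ hu, one_mulVec]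
  have h1 := (h z).1
  rw [hBz, dotProduct_comm] at h1
  have h2 : (v ⬝ᵥ z) ^ 2 ≤ sqNorm v * sqNorm z := by
    simpa [dotProduct, sqNorm] using Finset.sum_mul_sq_le_sq_mul_sq Finset.univ v z
  have h3 : sqNorm z ≤ M * (v ⬝ᵥ z) := by
    rw [one_div, inv_mul_le_iff₀ hM] at h1
    exact h1
  have hz0 := sqNorm_nonneg z
  have hv0 := sqNorm_nonneg v
  have h4 : 0 ≤ v ⬝ᵥ z := by
    by_contra! hcon
    nlinarith
  rcases h4.eq_or_lt with h5 | h5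
  · rw [← h5]; positivity
  have h6 : (v ⬝ᵥ z) * (v ⬝ᵥ z) ≤ M * sqNorm v * (v ⬝ᵥ z) := by
    have := mul_le_mul_of_nonneg_left h3 hv0
    nlinarith
  exact le_of_mul_le_mul_right h6 h5

lemma QuadFormBounds.compress {ι κ : Type*} [Fintype ι] [Fintype κ] [DecidableEq κ]
    {B : Matrix ι ι ℝ} {c d : ℝ} (h : QuadFormBounds B c d)
    {U : Matrix ι κ ℝ} (hU : Uᵀ * U = 1) : QuadFormBounds (Uᵀ * B * U) c d := by
  intro x
  have h1 : x ⬝ᵥ (Uᵀ * B * U) *ᵥ x = (U *ᵥ x) ⬝ᵥ B *ᵥ (U *ᵥ x) := by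
    rw [← mulVec_mulVec, ← mulVec_mulVec, dotProduct_mulVec, vecMul_transpose]
  have h2 : sqNorm x = sqNorm (U *ᵥ x) := by
    rw [sqNorm_eq_dotProduct, sqNorm_eq_dotProduct, dotProduct_mulVec, ← mulVec_transpose,
      mulVec_mulVec, hU, one_mulVec]
  rw [h1, h2]
  exact h _

lemma QuadFormBounds.diag {B : Matrix ι ι ℝ} {c d : ℝ} (h : QuadFormBounds B c d) (k : ι) :
    c ≤ B k k ∧ B k k ≤ d := by
  have := h (Pi.single k 1)
  have h1 : sqNorm (Pi.single k (1 : ℝ) : ι → ℝ) = 1 := by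
    rw [sqNorm_eq_dotProduct]; simp
  simpa [h1] using this

end QuadraticForms

/-! ### Consequences of membership in the capped ℓ₁ class. -/

section CappedClass

variable {p : ℕ} {M s lam : ℝ} {Ω : Matrix (Fin p) (Fin p) ℝ}

lemma inclIn_orthonormal (A : Finset (Fin p)) : (inclIn A)ᵀ * inclIn A = 1 := by
  rw [inclIn_transpose_mul]
  exact Matrix.submatrix_one _ Subtype.val_injective

lemma inclOut_orthonormal (A : Finset (Fin p)) : (inclOut A)ᵀ * inclOut A = 1 := by
  rw [inclOut_transpose_mul]
  exact Matrix.submatrix_one _ Subtype.val_injective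

lemma cappedBall_quadFormBounds (hΩ : Ω ∈ cappedBall p M s lam) :
    QuadFormBounds Ω (1 / M) M := by
  obtain ⟨-, h, hk⟩ := hΩ
  exact quadFormBounds_of_eigenvalues h hk

lemma cappedBall_posDef (hM : 0 < M) (hΩ : Ω ∈ cappedBall p M s lam) : Ω.PosDef := by
  obtain ⟨-, h, hk⟩ := hΩ
  exact h.posDef_iff_eigenvalues_pos.2 fun k => (by positivity : 0 < 1 / M).trans_le (hk k).1

lemma block_quadFormBounds (hΩ : Ω ∈ cappedBall p M s lam) (A : Finset (Fin p)) :
    QuadFormBounds (block Ω A) (1 / M) M := by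
  rw [block_eq]
  exact (cappedBall_quadFormBounds hΩ).compress (inclIn_orthonormal A)

lemma theta_quadFormBounds (hM : 0 < M) (hΩ : Ω ∈ cappedBall p M s lam) (A : Finset (Fin p)) :
    QuadFormBounds (theta Ω A) (1 / M) M :=
  (block_quadFormBounds hΩ A).inv (block_posDef (cappedBall_posDef hM hΩ) A) hM

lemma covOut_quadFormBounds (hM : 0 < M) (hΩ : Ω ∈ cappedBall p M s lam) (A : Finset (Fin p)) :
    QuadFormBounds ((inclOut A)ᵀ * Ω⁻¹ * inclOut A) (1 / M) M :=
  ((cappedBall_quadFormBounds hΩ).inv (cappedBall_posDef hM hΩ) hM).compress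
    (inclOut_orthonormal A)

lemma cappedBall_sum_le (hΩ : Ω ∈ cappedBall p M s lam) (j : Fin p) :
    ∑ i, min 1 (|Ω i j| / lam) ≤ s :=
  (le_ciSup (f := fun j => ∑ i, min 1 (|Ω i j| / lam)) (Set.finite_range _).bddAbove j).trans hΩ.1

lemma min_one_add_le {x y : ℝ} (hx : 0 ≤ x) (hy : 0 ≤ y) : min 1 (x + y) ≤ min 1 x + min 1 y := by
  rcases le_total 1 x with h | h
  · rw [min_eq_left h]
    exact (min_le_left _ _).trans (le_add_of_nonneg_right (le_min zero_le_one hy))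
  rcases le_total 1 y with h' | h'
  · rw [min_eq_left h']
    exact (min_le_left _ _).trans (le_add_of_nonneg_left (le_min zero_le_one hx))
  rw [min_eq_right h, min_eq_right h']
  exact min_le_right _ _

lemma min_one_sum_le {ι : Type*} (T : Finset ι) (f : ι → ℝ) (hf : ∀ i, 0 ≤ f i) :
    min 1 (∑ i ∈ T, f i) ≤ ∑ i ∈ T, min 1 (f i) := by
  classical
  induction T using Finset.induction_on with
  | empty => simp
  | insert i T hi ih =>
    rw [Finset.sum_insert hi, Finset.sum_insert hi]
    exact (min_one_add_le (hf i) (Finset.sum_nonneg fun i _ => hf i)).trans (by gcongr)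

lemma min_one_mul_le {c x : ℝ} (hc : 1 ≤ c) : min 1 (c * x) ≤ c * min 1 x := by
  rcases le_total 1 x with h | h
  · rw [min_eq_left h, mul_one]
    exact (min_le_left _ _).trans hc
  · rw [min_eq_right h]
    exact min_le_right _ _

/-- The regression coefficients inherit the capped `ℓ₁` sparsity of the precision matrix. -/
lemma beta_capped_le (hM : 1 ≤ M) (hlam : 0 < lam) (hΩ : Ω ∈ cappedBall p M s lam)
    {A : Finset (Fin p)} (hA : A.card = 2) (m : {m // m ∈ A}) :
    ∑ k : {k // k ∉ A}, min 1 (|beta Ω A k m| / lam) ≤ 2 * M * s := by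
  have hM0 : 0 < M := by linarith
  have hθ : ∀ l m : {m // m ∈ A}, |theta Ω A l m| ≤ M := by
    intro l m
    have := abs_inv_apply_le (by positivity : 0 < 1 / M)
      (fun x => (block_quadFormBounds hΩ A x).1) l m
    rwa [one_div_one_div] at this
  have h1 : ∀ k : {k // k ∉ A}, min 1 (|beta Ω A k m| / lam)
      ≤ ∑ l : {m // m ∈ A}, M * min 1 (|Ω k.1 l.1| / lam) := by
    intro k
    have h2 : |beta Ω A k m| / lam ≤ ∑ l : {m // m ∈ A}, M * (|Ω k.1 l.1| / lam) := by
      rw [div_le_iff₀ hlam, Finset.sum_mul, beta, Matrix.neg_apply, abs_neg, Matrix.mul_apply]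
      refine (Finset.abs_sum_le_sum_abs _ _).trans (Finset.sum_le_sum fun l _ => ?_)
      rw [abs_mul, mul_assoc, div_mul_cancel₀ _ hlam.ne', mul_comm]
      exact mul_le_mul_of_nonneg_right (hθ l m) (abs_nonneg _)
    calc _ ≤ min 1 (∑ l : {m // m ∈ A}, M * (|Ω k.1 l.1| / lam)) := min_le_min le_rfl h2
      _ ≤ ∑ l : {m // m ∈ A}, min 1 (M * (|Ω k.1 l.1| / lam)) :=
          min_one_sum_le _ _ fun l => by positivity
      _ ≤ _ := Finset.sum_le_sum fun l _ => min_one_mul_le hM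
  calc _ ≤ ∑ k : {k // k ∉ A}, ∑ l : {m // m ∈ A}, M * min 1 (|Ω k.1 l.1| / lam) :=
        Finset.sum_le_sum fun k _ => h1 k
    _ = ∑ l : {m // m ∈ A}, M * ∑ k : {k // k ∉ A}, min 1 (|Ω k.1 l.1| / lam) := by
        rw [Finset.sum_comm]
        exact Finset.sum_congr rfl fun l _ => by rw [Finset.mul_sum]
    _ ≤ ∑ l : {m // m ∈ A}, M * s := by
        refine Finset.sum_le_sum fun l _ => mul_le_mul_of_nonneg_left ?_ hM0.le
        refine le_trans ?_ (cappedBall_sum_le hΩ l.1)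
        rw [← Fintype.sum_subtype_add_sum_subtype (fun k => k ∉ A)
          (fun k => min 1 (|Ω k l.1| / lam))]
        exact le_add_of_nonneg_right (Finset.sum_nonneg fun _ _ => le_min zero_le_one (by positivity))
    _ = 2 * M * s := by
        rw [Finset.sum_const, Finset.card_univ, Fintype.card_coe, hA, nsmul_eq_mul]
        push_cast
        ring

/-- A diagonal entry is at least `1/M` and contributes `min 1 (1/(M λ))` to the capped sum. If this
were less than one, then `λ > 1/M` and `λ² s ≥ λ/M > 1/M²`. This is why `s ≥ 1` need not be assumed
for the lasso. -/
lemma one_le_of_mem_cappedBall {c : ℝ} (hM : 0 < M) (hlam : 0 < lam) (hp : 0 < p)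
    (hΩ : Ω ∈ cappedBall p M s lam) (hs : lam ^ 2 * s ≤ c) (hc : c * M ^ 2 < 1) : 1 ≤ s := by
  have hj := (cappedBall_quadFormBounds hΩ).diag ⟨0, hp⟩
  have h1 : min 1 (1 / M / lam) ≤ s := by
    refine le_trans ?_ (cappedBall_sum_le hΩ ⟨0, hp⟩)
    refine le_trans ?_ (Finset.single_le_sum (f := fun i => min 1 (|Ω i ⟨0, hp⟩| / lam))
      (fun _ _ => le_min zero_le_one (by positivity)) (Finset.mem_univ ⟨0, hp⟩))
    refine min_le_min le_rfl (div_le_div_of_nonneg_right (hj.1.trans (le_abs_self _)) hlam.le)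
  rcases le_or_gt 1 (1 / M / lam) with h | h
  · rwa [min_eq_left h] at h1
  · exfalso
    rw [min_eq_right h.le] at h1
    have h2 : lam ^ 2 * (1 / M / lam) ≤ c := (mul_le_mul_of_nonneg_left h1 (sq_nonneg _)).trans hs
    have h3 : lam ^ 2 * (1 / M / lam) = lam / M := by field_simp
    rw [h3, div_le_iff₀ hM] at h2
    rw [div_div, div_lt_one (by positivity)] at h
    nlinarith

end CappedClass

end PrecisionInference

namespace PrecisionInference

open Matrix

/-! ### From the scaled lasso to the square-root lasso. -/

section ScaledLasso

variable {n p : ℕ} {X : Matrix (Fin n) (Fin p) ℝ} {A : Finset (Fin p)} {lam : ℝ}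

/-- The penalty weights `‖X_k‖ / √n`. -/
noncomputable def lassoWeight (X : Matrix (Fin n) (Fin p) ℝ) (A : Finset (Fin p)) :
    {k // k ∉ A} → ℝ :=
  fun k => √(sqNorm (fun r => X r k.1)) / √n

lemma scaledLoss_eq (m : Fin p) (b : {k // k ∉ A} → ℝ) (σ : ℝ) :
    scaledLoss X A m b σ
      = rms ((fun r => X r m) - colsOut X A *ᵥ b) ^ 2 / (2 * σ) + σ / 2 := by
  rw [rms_sq, scaledLoss, div_div]
  congr 2
  ring

lemma rms_le_scaledLoss (m : Fin p) (b : {k // k ∉ A} → ℝ) {σ : ℝ} (hσ : 0 < σ) :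
    rms ((fun r => X r m) - colsOut X A *ᵥ b) ≤ scaledLoss X A m b σ := by
  rw [scaledLoss_eq]
  generalize rms ((fun r => X r m) - colsOut X A *ᵥ b) = R
  have : R ^ 2 / (2 * σ) + σ / 2 - R = (R - σ) ^ 2 / (2 * σ) := by
    field_simp
    ring
  have h2 : 0 ≤ (R - σ) ^ 2 / (2 * σ) := by positivity
  linarith

/-- The minimum over `σ` of the loss is the residual norm, attained at `σ` equal to that norm. The
shift `η` keeps `σ > 0` when the residual vanishes. -/
lemma scaledLoss_add_le (m : Fin p) (b : {k // k ∉ A} → ℝ) {η : ℝ} (hη : 0 < η) :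
    scaledLoss X A m b (rms ((fun r => X r m) - colsOut X A *ᵥ b) + η)
      ≤ rms ((fun r => X r m) - colsOut X A *ᵥ b) + η := by
  rw [scaledLoss_eq]
  have hR := rms_nonneg ((fun r => X r m) - colsOut X A *ᵥ b)
  generalize rms ((fun r => X r m) - colsOut X A *ᵥ b) = R at *
  have : R ^ 2 / (2 * (R + η)) ≤ R / 2 := by
    rw [div_le_div_iff₀ (by positivity) (by positivity)]
    nlinarith
  linarith

lemma scaledLoss_rms (m : Fin p) (b : {k // k ∉ A} → ℝ)
    (hb : 0 < rms ((fun r => X r m) - colsOut X A *ᵥ b)) :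
    scaledLoss X A m b (rms ((fun r => X r m) - colsOut X A *ᵥ b))
      = rms ((fun r => X r m) - colsOut X A *ᵥ b) := by
  rw [scaledLoss_eq]
  field_simp
  ring

lemma IsScaledLassoSol.isSqrtLassoMin {m : Fin p} {b : {k // k ∉ A} → ℝ} {σ : ℝ}
    (h : IsScaledLassoSol lam X A m b σ) :
    IsSqrtLassoMin (colsOut X A) (fun r => X r m) (lassoWeight X A) lam b := by
  intro b'
  refine le_of_forall_pos_le_add fun η hη => ?_
  have h1 := h.2 b' (rms ((fun r => X r m) - colsOut X A *ᵥ b') + η)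
    (add_pos_of_nonneg_of_pos (rms_nonneg _) hη)
  have h2 := rms_le_scaledLoss (X := X) m b h.1
  have h3 := scaledLoss_add_le (X := X) m b' hη
  change rms _ + lam * weightedL1 X A b ≤ rms _ + lam * weightedL1 X A b' + η
  linarith

lemma IsSqrtLassoMin.isScaledLassoSol {m : Fin p} {b : {k // k ∉ A} → ℝ}
    (h : IsSqrtLassoMin (colsOut X A) (fun r => X r m) (lassoWeight X A) lam b)
    (hb : 0 < rms ((fun r => X r m) - colsOut X A *ᵥ b)) :
    IsScaledLassoSol lam X A m b (rms ((fun r => X r m) - colsOut X A *ᵥ b)) := by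
  refine ⟨hb, fun b' σ' hσ' => ?_⟩
  rw [scaledLoss_rms m b hb]
  have h1 := h b'
  have h2 := rms_le_scaledLoss (X := X) m b' hσ'
  change rms _ + lam * weightedL1 X A b ≤ rms _ + lam * weightedL1 X A b' at h1
  linarith

lemma mem_colSupport_iff {B : Matrix {k // k ∉ A} {m // m ∈ A} ℝ} {m : {m // m ∈ A}}
    (k : {k // k ∉ A}) : k.1 ∈ colSupport B m ↔ B k m ≠ 0 :=
  ⟨fun ⟨_, h⟩ => h, fun h => ⟨k.2, h⟩⟩

lemma IsLSESol.isLeastSquaresOn {T : Set (Fin p)} {m : Fin p} {b : {k // k ∉ A} → ℝ} {σ : ℝ}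
    (h : IsLSESol T X A m b σ) :
    IsLeastSquaresOn (colsOut X A) (fun r => X r m) {k | k.1 ∈ T} b := by
  refine ⟨h.2.1, fun b' hb' => le_of_forall_pos_le_add fun η hη => ?_⟩
  have h1 := h.2.2 b' (rms ((fun r => X r m) - colsOut X A *ᵥ b') + η)
    (add_pos_of_nonneg_of_pos (rms_nonneg _) hη) hb'
  have h2 := rms_le_scaledLoss (X := X) m b h.1
  have h3 := scaledLoss_add_le (X := X) m b' hη
  linarith

lemma IsLeastSquaresOn.isLSESol {T : Set (Fin p)} {m : Fin p} {b : {k // k ∉ A} → ℝ}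
    (h : IsLeastSquaresOn (colsOut X A) (fun r => X r m) {k | k.1 ∈ T} b)
    (hb : 0 < rms ((fun r => X r m) - colsOut X A *ᵥ b)) :
    IsLSESol T X A m b (rms ((fun r => X r m) - colsOut X A *ᵥ b)) := by
  refine ⟨hb, h.1, fun b' σ' hσ' hb' => ?_⟩
  rw [scaledLoss_rms m b hb]
  exact (h.2 b' hb').trans (rms_le_scaledLoss (X := X) m b' hσ')

lemma resid_col (b : Matrix {k // k ∉ A} {m // m ∈ A} ℝ) (m : {m // m ∈ A}) :
    (fun r => resid X A b r m) = (fun r => X r m.1) - colsOut X A *ᵥ (fun k => b k m) := rfl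

lemma residCov_diag (b : Matrix {k // k ∉ A} {m // m ∈ A} ℝ) (m : {m // m ∈ A}) :
    residCov X A b m m = rms ((fun r => X r m.1) - colsOut X A *ᵥ (fun k => b k m)) ^ 2 := by
  rw [residCov_apply, rms_sq, ← resid_col]
  simp only [sqNorm, sq]

lemma matSqNorm_colsOut_mul (Δ : Matrix {k // k ∉ A} {m // m ∈ A} ℝ) :
    matSqNorm (colsOut X A * Δ) = ∑ m, sqNorm (colsOut X A *ᵥ fun k => Δ k m) := by
  rw [matSqNorm, Finset.sum_comm]
  rfl

lemma matL1_rootDiag_mul (Δ : Matrix {k // k ∉ A} {m // m ∈ A} ℝ) :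
    matL1 (rootDiag X A * Δ) = ∑ m, wl1 (lassoWeight X A) fun k => Δ k m := by
  rw [matL1, Finset.sum_comm]
  refine Finset.sum_congr rfl fun m _ => Finset.sum_congr rfl fun k _ => ?_
  rw [rootDiag, Matrix.diagonal_mul, abs_mul, abs_of_nonneg (Real.sqrt_nonneg _), lassoWeight,
    Real.sqrt_div (sqNorm_nonneg _)]

/-- The error bounds for the two estimators, on the event of a well-behaved design and noise. -/
theorem estimationBound_of_lassoEvent {a b wlo whi rlo rhi ρ : ℝ} (ha : 0 < a) (hb : 0 < b)
    (hwlo : 0 < wlo) (hwhi : 0 < whi) (hrlo : 0 < rlo) (hρ0 : 0 ≤ ρ) (hρ : ρ < 1)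
    (hrhi : 0 ≤ rhi) :
    ∃ C κ : ℝ, 0 < C ∧ 0 < κ ∧ ∀ {n p : ℕ} {X : Matrix (Fin n) (Fin p) ℝ} {A : Finset (Fin p)},
      A.card = 2 → ∀ {β : Matrix {k // k ∉ A} {m // m ∈ A} ℝ} {lam K s : ℝ} {m : {m // m ∈ A}},
      LassoEvent (colsOut X A) (fun r => resid X A β r m) (lassoWeight X A) lam ρ a b K wlo whi →
      0 < lam → 0 ≤ K → rlo ≤ rms (fun r => resid X A β r m) →
      rms (fun r => resid X A β r m) ≤ rhi → ∑ k, min 1 (|β k m| / lam) ≤ s → 1 ≤ s →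
      lam ^ 2 * s ≤ κ → K * s ≤ κ → ∀ {βhat : CoefEstimator n p},
      IsScaledLasso lam βhat ∨ IsLSEAfterScaledLasso lam βhat →
      EstimationBound (colsOut X A) (lassoWeight X A) (fun k => (βhat X A - β) k m) C lam s := by
  obtain ⟨C, κ, hC, hκ, hmain⟩ :=
    sqrtLasso_and_leastSquares ha hb hwlo hwhi hrlo hρ0 hρ hrhi
  refine ⟨C, κ, hC, hκ, ?_⟩
  intro n p X A hA β lam K s m hE hlam hK hr1 hr2 hcap hs hls hKs βhat hβ
  rw [resid_col] at hE hr1 hr2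
  obtain ⟨⟨b₀, hb₀⟩, hall⟩ := hmain hE hlam hK hr1 hr2 hcap hs hls hKs
  have hsel : ∀ βsel : CoefEstimator n p, IsScaledLasso lam βsel →
      IsSqrtLassoMin (colsOut X A) (fun r => X r m.1) (lassoWeight X A) lam
        (fun k => βsel X A k m) := by
    intro βsel h
    -- `IsScaledLasso` only speaks where a minimum is attained; the positive residual of a
    -- square-root lasso minimizer provides that.
    obtain ⟨σ, hσ⟩ := h X A hA m ⟨b₀, _, hb₀.isScaledLassoSol (hall b₀ hb₀).1.2⟩
    exact hσ.isSqrtLassoMin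
  rcases hβ with h | ⟨βsel, hs', h⟩
  · exact (hall _ (hsel βhat h)).1.1
  · obtain ⟨-, ⟨c₀, hc₀⟩, hc⟩ := hall _ (hsel βsel hs')
    have hset : {k : {k // k ∉ A} | k.1 ∈ colSupport (βsel X A) m} = {k | βsel X A k m ≠ 0} := by
      ext k
      exact mem_colSupport_iff k
    have hc₀' := hc₀
    rw [← hset] at hc₀'
    obtain ⟨σ, hσ⟩ := h X A hA m ⟨c₀, _, hc₀'.isLSESol (hc c₀ hc₀).2⟩
    have h2 := hσ.isLeastSquaresOn
    rw [hset] at h2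
    exact (hc _ h2).1

end ScaledLasso

end PrecisionInference

namespace PrecisionInference

open Matrix

/-! ### The random event behind the lasso analysis. -/

section DesignEvent

variable {n p : ℕ} {Ω : Matrix (Fin p) (Fin p) ℝ} {M s lam : ℝ}

/-- Restricted eigenvalue bounds, bounded correlations with the noise, and noise level of the
right order. -/
structure DesignEvent (Ω : Matrix (Fin p) (Fin p) ℝ) (X : Matrix (Fin n) (Fin p) ℝ)
    (A : Finset (Fin p)) (t K z : ℝ) : Prop where
  restricted : RestrictedBounds n (X * inclOut A) ((inclOut A)ᵀ * Ω⁻¹ * inclOut A) K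
  noise : NoiseBound Ω X A t
  scale : ∀ m, theta Ω A m m ≤ √z * rms (fun r => resid X A (beta Ω A) r m) ^ 2 ∧
    rms (fun r => resid X A (beta Ω A) r m) ^ 2 ≤ 2 * theta Ω A m m

lemma lassoWeight_sq (X : Matrix (Fin n) (Fin p) ℝ) (A : Finset (Fin p)) (k : {k // k ∉ A}) :
    lassoWeight X A k ^ 2 = sqNorm (fun r => X r k.1) / n := by
  rw [lassoWeight, div_pow, Real.sq_sqrt (sqNorm_nonneg _), Real.sq_sqrt n.cast_nonneg]

lemma DesignEvent.restricted_weighted {X : Matrix (Fin n) (Fin p) ℝ} {A : Finset (Fin p)}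
    {t K z : ℝ} (h : DesignEvent Ω X A t K z) (hM : 0 < M) (hΩ : Ω ∈ cappedBall p M s lam)
    (v : {k // k ∉ A} → ℝ) :
    1 / (2 * M) * sqNorm v - K * (∑ k, |v k|) ^ 2 ≤ sqNorm (colsOut X A *ᵥ v) / n ∧
      sqNorm (colsOut X A *ᵥ v) / n ≤ 2 * M * sqNorm v + K * (∑ k, |v k|) ^ 2 := by
  have h1 := h.restricted v
  have h2 := covOut_quadFormBounds hM hΩ A v
  rw [show X * inclOut A = colsOut X A from mul_inclOut X A] at h1
  have h3 : 1 / (2 * M) * sqNorm v = 1 / 2 * (1 / M * sqNorm v) := by field_simp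
  constructor <;> linarith [h1.1, h1.2, h2.1, h2.2]

/-- The restricted eigenvalue bounds at coordinate vectors. -/
lemma DesignEvent.weight_bounds {X : Matrix (Fin n) (Fin p) ℝ} {A : Finset (Fin p)}
    {t K z : ℝ} (h : DesignEvent Ω X A t K z) (hM : 1 ≤ M) (hΩ : Ω ∈ cappedBall p M s lam)
    (hK : K ≤ 1 / (4 * M)) (k : {k // k ∉ A}) :
    √(1 / (4 * M)) ≤ lassoWeight X A k ∧ lassoWeight X A k ≤ √(3 * M) := by
  have hM0 : 0 < M := by linarith
  have h1 := h.restricted_weighted hM0 hΩ (Pi.single k 1)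
  have h2 : sqNorm (Pi.single k (1 : ℝ) : {k // k ∉ A} → ℝ) = 1 := by
    rw [sqNorm_eq_dotProduct]; simp
  have h3 : ∑ l, |(Pi.single k (1 : ℝ) : {k // k ∉ A} → ℝ) l| = 1 := by
    rw [Finset.sum_eq_single k]
    · simp
    · intro l _ hl
      simp [Pi.single_eq_of_ne hl]
    · simp
  have h4 : colsOut X A *ᵥ Pi.single k (1 : ℝ) = fun r => X r k.1 := by
    rw [mulVec_single_one]
    rfl
  rw [h2, h3, h4, ← lassoWeight_sq] at h1
  have h0 : 0 ≤ lassoWeight X A k := by unfold lassoWeight; positivity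
  have h5 : 1 / (2 * M) = 2 * (1 / (4 * M)) := by field_simp; norm_num
  have h6 : 1 / (4 * M) ≤ 1 := by
    rw [div_le_one (by positivity)]; linarith
  constructor
  · rw [Real.sqrt_le_left h0]
    linarith
  · exact Real.le_sqrt_of_sq_le (by linarith)

/-- How the factor `z = 1 + ε` of the penalty is spent: `√z` on the noise level, `z^{1/4}` on
replacing the true error scale by the realized one. What remains is `ρ = z^{-1/4} < 1`. The weights
are at least `(4M)^{-1/2}`, which turns the slack `K` into `4 M K`. -/
lemma DesignEvent.lassoEvent {X : Matrix (Fin n) (Fin p) ℝ} {A : Finset (Fin p)} {ε δ K : ℝ}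
    (hn : 1 ≤ n) (hε : 0 < ε) (hδ : 0 ≤ δ * Real.log p)
    (h : DesignEvent Ω X A √(2 * ((1 + ε) * (δ * Real.log p))) K (1 + ε)) (hM : 1 ≤ M)
    (hΩ : Ω ∈ cappedBall p M s lam) (hK0 : 0 ≤ K) (hK : K ≤ 1 / (4 * M)) (m : {m // m ∈ A}) :
    LassoEvent (colsOut X A) (fun r => resid X A (beta Ω A) r m) (lassoWeight X A)
      (penalty ε δ n p) (√√(1 + ε) / √(1 + ε)) (1 / (2 * M)) (2 * M) (4 * M * K)
      √(1 / (4 * M)) √(3 * M) := by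
  have hM0 : 0 < M := by linarith
  have hn0 : (0 : ℝ) < n := by exact_mod_cast hn
  have hl1 : ∀ v : {k // k ∉ A} → ℝ,
      K * (∑ k, |v k|) ^ 2 ≤ 4 * M * K * wl1 (lassoWeight X A) v ^ 2 := by
    intro v
    have h1 : √(1 / (4 * M)) * ∑ k, |v k| ≤ wl1 (lassoWeight X A) v := by
      rw [Finset.mul_sum, wl1]
      exact Finset.sum_le_sum fun k _ =>
        mul_le_mul_of_nonneg_right (h.weight_bounds hM hΩ hK k).1 (abs_nonneg _)
    have h2 := pow_le_pow_left₀ (mul_nonneg (Real.sqrt_nonneg _)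
      (Finset.sum_nonneg fun k _ => abs_nonneg (v k))) h1 2
    rw [mul_pow, Real.sq_sqrt (by positivity), one_div, inv_mul_le_iff₀ (by positivity)] at h2
    calc K * (∑ k, |v k|) ^ 2 ≤ K * (4 * M * wl1 (lassoWeight X A) v ^ 2) :=
          mul_le_mul_of_nonneg_left h2 hK0
      _ = _ := by ring
  refine ⟨fun v => ?_, fun v => ?_, fun k => (h.weight_bounds hM hΩ hK k).1,
    fun k => (h.weight_bounds hM hΩ hK k).2, fun k => lassoWeight_sq X A k, fun k => ?_⟩
  · linarith [(h.restricted_weighted hM0 hΩ v).1, hl1 v]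
  · linarith [(h.restricted_weighted hM0 hΩ v).2, hl1 v]
  · have h1 := h.noise k m
    set e := fun r => resid X A (beta Ω A) r m with he
    have h2 : √(theta Ω A m m) ≤ √√(1 + ε) * rms e := by
      rw [Real.sqrt_le_left (mul_nonneg (Real.sqrt_nonneg _) (rms_nonneg e)), mul_pow,
        Real.sq_sqrt (Real.sqrt_nonneg _)]
      exact (h.scale m).1
    have hz : 0 < √(1 + ε) := Real.sqrt_pos.2 (by linarith)
    have hzz := Real.mul_self_sqrt (show 0 ≤ 1 + ε by linarith)
    have hnn := Real.mul_self_sqrt hn0.le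
    have hsn : 0 < √(n : ℝ) := Real.sqrt_pos.2 hn0
    have ht : √(2 * ((1 + ε) * (δ * Real.log p))) = √(1 + ε) * √(2 * (δ * Real.log p)) := by
      rw [← Real.sqrt_mul (by linarith)]; congr 1; ring
    have hpen : penalty ε δ n p = (1 + ε) * (√(2 * (δ * Real.log p)) / √n) := by
      rw [penalty, ← Real.sqrt_div (by positivity), mul_assoc 2]
    have hdot : (fun r => colsOut X A r k) ⬝ᵥ e = ∑ r, X r k.1 * resid X A (beta Ω A) r m := rfl
    rw [hdot, div_le_iff₀ hn0]
    refine h1.trans ?_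
    rw [ht, hpen, lassoWeight]
    calc _ ≤ √(1 + ε) * √(2 * (δ * Real.log p)) * (√√(1 + ε) * rms e)
          * √(sqNorm fun r => X r k.1) := by gcongr
      _ = √√(1 + ε) * ((√(1 + ε) * √(1 + ε)) / √(1 + ε)) * √(2 * (δ * Real.log p)) * rms e
          * √(sqNorm fun r => X r k.1) * ((√n * √n) / (√n * √n)) := by
          field_simp
      _ = _ := by
          rw [hzz]
          nth_rewrite 1 [hnn]
          ring

lemma IsGaussianSample.real_not_designEvent_le {S : Type*} [MeasurableSpace S] {P : Measure S}
    [IsProbabilityMeasure P] {X : S → Matrix (Fin n) (Fin p) ℝ} (hX : IsGaussianSample P X Ω)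
    (hΩ : Ω.PosDef) (hn : 1 ≤ n) {A : Finset (Fin p)} (hA : A.card = 2) {t z D : ℝ} (ht : 0 ≤ t)
    (hz : 1 < z) (hD : ∀ j, ((inclOut A)ᵀ * Ω⁻¹ * inclOut A) j j ≤ D) {k : ℕ} (hk : 2 ≤ k) :
    P.real {ω | ¬ DesignEvent Ω (X ω) A t (2 * D / (k - 1)) z}
      ≤ 4 * p * Real.exp (-t ^ 2 / 2) + (2 * (2 * p) ^ k + p) * Real.exp (-(n / 32 : ℝ))
        + 4 * Real.exp (-(n * (1 - 1 / √z) ^ 2 / 8)) := by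
  have hn0 : (0 : ℝ) < n := by exact_mod_cast hn
  have hz1 : 1 < √z := by rw [Real.lt_sqrt zero_le_one]; linarith
  have hiz : 1 / √z < 1 := by rw [div_lt_one (by linarith)]; exact hz1
  have hiz0 : 0 < 1 / √z := by positivity
  set u : {m // m ∈ A} → Fin p → ℝ := fun m j => residDir Ω A j m with hu
  have hcov : ∀ m, u m ⬝ᵥ Ω⁻¹ *ᵥ u m = theta Ω A m m := fun m => by
    rw [hu, covForm_cols, residDir_cov hΩ]
  have hres : ∀ ω m, X ω *ᵥ u m = fun r => resid (X ω) A (beta Ω A) r m := fun ω m => by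
    rw [hu, mulVec_col, resid_beta hΩ]
  set B1 := {ω | ¬ NoiseBound Ω (X ω) A t}
  set B2 := {ω | ¬ RestrictedBounds n (X ω * inclOut A) ((inclOut A)ᵀ * Ω⁻¹ * inclOut A)
    (2 * D / (k - 1))}
  set B3 : {m // m ∈ A} → Set S := fun m =>
    {ω | (1 + (1 - 1 / √z)) * (n * (u m ⬝ᵥ Ω⁻¹ *ᵥ u m)) < sqNorm (X ω *ᵥ u m)}
  set B4 : {m // m ∈ A} → Set S := fun m =>
    {ω | sqNorm (X ω *ᵥ u m) < (1 - (1 - 1 / √z)) * (n * (u m ⬝ᵥ Ω⁻¹ *ᵥ u m))}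
  have hsub : {ω | ¬ DesignEvent Ω (X ω) A t (2 * D / (k - 1)) z}
      ⊆ (B1 ∪ B2) ∪ ⋃ m, (B3 m ∪ B4 m) := by
    intro ω hω
    by_contra hcon
    simp only [Set.mem_union, Set.mem_iUnion, not_or, not_exists] at hcon
    obtain ⟨⟨h1, h2⟩, h3⟩ := hcon
    refine hω ⟨not_not.1 h2, not_not.1 h1, fun m => ?_⟩
    have h4 : ¬ (1 + (1 - 1 / √z)) * (n * (u m ⬝ᵥ Ω⁻¹ *ᵥ u m)) < sqNorm (X ω *ᵥ u m) := (h3 m).1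
    have h5 : ¬ sqNorm (X ω *ᵥ u m) < (1 - (1 - 1 / √z)) * (n * (u m ⬝ᵥ Ω⁻¹ *ᵥ u m)) := (h3 m).2
    rw [hcov, not_lt] at h4 h5
    rw [← hres, rms_sq]
    have hθ : 0 ≤ theta Ω A m m := (theta_posDef hΩ A).posSemidef.diag_nonneg
    constructor
    · rw [← mul_div_assoc, le_div_iff₀ hn0]
      have h6 := mul_le_mul_of_nonneg_left h5 (show 0 ≤ √z by positivity)
      have h7 : √z * ((1 - (1 - 1 / √z)) * (n * theta Ω A m m)) = theta Ω A m m * n := by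
        field_simp
        ring
      linarith
    · rw [div_le_iff₀ hn0]
      have : 0 ≤ n * theta Ω A m m := by positivity
      nlinarith
  have hcard : (Fintype.card {k // k ∉ A} : ℝ) ≤ p := by
    have := Fintype.card_subtype_le fun k : Fin p => k ∉ A
    rw [Fintype.card_fin] at this
    exact_mod_cast this
  have hb2 : P.real B2 ≤ (2 * (2 * p) ^ k + p) * Real.exp (-(n / 32 : ℝ)) := by
    refine (hX.real_not_restrictedBounds_le hΩ hn (inclOut A) hD hk).trans ?_
    gcongr
  have hb34 : ∀ m, P.real (B3 m ∪ B4 m) ≤ 2 * Real.exp (-(n * (1 - 1 / √z) ^ 2 / 8)) := by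
    intro m
    obtain ⟨h1, h2⟩ := hX.real_sqNorm_tails hΩ (u m) (t := 1 - 1 / √z) (by linarith) (by linarith)
    have := measureReal_union_le (μ := P) (B3 m) (B4 m)
    change P.real (B3 m) ≤ _ at h1
    change P.real (B4 m) ≤ _ at h2
    linarith
  have hb5 : P.real (⋃ m, (B3 m ∪ B4 m)) ≤ 4 * Real.exp (-(n * (1 - 1 / √z) ^ 2 / 8)) := by
    refine (measureReal_iUnion_fintype_le _).trans ((Finset.sum_le_sum fun m _ => hb34 m).trans ?_)
    rw [Finset.sum_const, Finset.card_univ, Fintype.card_coe, hA, nsmul_eq_mul]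
    push_cast
    linarith
  have hb1 := hX.real_not_noiseBound_le hΩ A hA ht
  calc _ ≤ P.real ((B1 ∪ B2) ∪ ⋃ m, (B3 m ∪ B4 m)) := measureReal_mono hsub
    _ ≤ P.real B1 + P.real B2 + P.real (⋃ m, (B3 m ∪ B4 m)) :=
        (measureReal_union_le _ _).trans (by gcongr; exact measureReal_union_le _ _)
    _ ≤ _ := add_le_add (add_le_add hb1 hb2) hb5

end DesignEvent

/-! ### Failure probabilities. -/

section TailArithmetic

/-- The remainder of the failure probability. -/
noncomputable def lassoRemainder (ε : ℝ) (p : ℕ) : ℝ := 4 * (p : ℝ) ^ (-ε) + 7 * (p : ℝ) ^ (-1 : ℝ)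

lemma tendsto_lassoRemainder {ε : ℝ} (hε : 0 < ε) :
    Tendsto (lassoRemainder ε) atTop (𝓝 0) := by
  have h1 := ((tendsto_rpow_neg_atTop hε).comp tendsto_natCast_atTop_atTop).const_mul (4 : ℝ)
  have h2 := ((tendsto_rpow_neg_atTop one_pos).comp tendsto_natCast_atTop_atTop).const_mul (7 : ℝ)
  have h3 := h1.add h2
  rw [mul_zero, mul_zero, add_zero] at h3
  exact h3

/-- The noise term is `4 p · p^{-(1+ε)δ} ≤ 4 p^{1-δ} p^{-ε}`, as `δ ≥ 1`. The other terms are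
exponentially small in `n`: `k` is so small that `(2p)^k ≤ p^{2k} ≤ exp(n/64)`, and together they
cost at most `(2 + 1 + 4) p^{-δ}`. -/
lemma failure_le {n p k : ℕ} {ε δ z : ℝ} (hp : 2 ≤ p) (hε : 0 < ε) (hδ : 1 ≤ δ)
    (hn : 64 * (δ * Real.log p) ≤ n) (hk : k ≤ n / (128 * Real.log p))
    (hz : δ * Real.log p ≤ n * z / 8) :
    4 * p * Real.exp (-√(2 * ((1 + ε) * (δ * Real.log p))) ^ 2 / 2)
      + (2 * (2 * p) ^ k + p) * Real.exp (-(n / 32 : ℝ)) + 4 * Real.exp (-(n * z / 8))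
      ≤ (p : ℝ) ^ (-δ + 1) * lassoRemainder ε p := by
  have hL := log_natCast_pos hp
  have hp0 : (0 : ℝ) < p := by exact_mod_cast (by omega : 0 < p)
  have hp2 : (2 : ℝ) ≤ p := by exact_mod_cast hp
  have hpe : (p : ℝ) = Real.exp (Real.log p) := (Real.exp_log hp0).symm
  set L := Real.log p with hLdef
  have hδL : L ≤ δ * L := by nlinarith
  have h1 : (p : ℝ) * Real.exp (-√(2 * ((1 + ε) * (δ * L))) ^ 2 / 2)
      ≤ Real.exp ((-δ + 1) * L + -ε * L) := by
    rw [Real.sq_sqrt (by positivity)]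
    conv_lhs => rw [hpe]
    rw [← Real.exp_add]
    refine Real.exp_le_exp.2 ?_
    have := mul_le_mul_of_nonneg_left hδL hε.le
    linarith
  have h2 : (2 * (p : ℝ)) ^ k * Real.exp (-(n / 32 : ℝ)) ≤ Real.exp ((-δ + 1) * L + -1 * L) := by
    have h3 : (2 * (p : ℝ)) ^ k ≤ Real.exp (n / 64) := by
      calc (2 * (p : ℝ)) ^ k ≤ (p * p) ^ k := by gcongr
        _ = Real.exp (k * (2 * L)) := by
            conv_lhs => rw [hpe]
            rw [← Real.exp_add, ← Real.exp_nat_mul]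
            congr 1; ring
        _ ≤ Real.exp (n / 64) := by
            refine Real.exp_le_exp.2 ?_
            rw [le_div_iff₀ (by positivity)] at hk
            linarith
    calc _ ≤ Real.exp (n / 64) * Real.exp (-(n / 32 : ℝ)) := by gcongr
      _ = Real.exp (-(n / 64 : ℝ)) := by rw [← Real.exp_add]; congr 1; ring
      _ ≤ _ := Real.exp_le_exp.2 (by linarith)
  have h4 : (p : ℝ) * Real.exp (-(n / 32 : ℝ)) ≤ Real.exp ((-δ + 1) * L + -1 * L) := by
    conv_lhs => rw [hpe]
    rw [← Real.exp_add]
    exact Real.exp_le_exp.2 (by linarith)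
  have h5 : Real.exp (-(n * z / 8)) ≤ Real.exp ((-δ + 1) * L + -1 * L) :=
    Real.exp_le_exp.2 (by linarith)
  rw [lassoRemainder, rpow_eq_exp_log hp, rpow_eq_exp_log hp, rpow_eq_exp_log hp, ← hLdef]
  rw [Real.exp_add] at h1 h2 h4 h5
  linarith

end TailArithmetic

end PrecisionInference

namespace PrecisionInference

open Matrix

/-! ### The error conditions for the two estimators. -/

section ErrorConditionsOfLasso

variable {n p : ℕ}

lemma penalty_sq {ε δ : ℝ} (h : 0 ≤ δ * Real.log p) :
    penalty ε δ n p ^ 2 = 2 * (1 + ε) ^ 2 * (δ * Real.log p / n) := by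
  have : 0 ≤ 2 * δ * Real.log p / n := by
    rw [mul_assoc]; positivity
  rw [penalty, mul_pow, Real.sq_sqrt this]
  ring

lemma penalty_eq {ε δ : ℝ} :
    penalty ε δ n p = √2 * (1 + ε) * √(δ * Real.log p / n) := by
  rw [penalty, mul_assoc 2, mul_div_assoc, Real.sqrt_mul zero_le_two]
  ring

/-- The three error quantities on the event of well-behaved design and noise. -/
lemma errors_lt_of_estimationBound {Ω : Matrix (Fin p) (Fin p) ℝ} {X : Matrix (Fin n) (Fin p) ℝ}
    {A : Finset (Fin p)} (hA : A.card = 2) {βhat : CoefEstimator n p}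
    {ε δ s C C₀ s₁ M ρ a b K wlo whi rlo rhi : ℝ}
    (hn : 1 ≤ n) (hx : 0 < δ * Real.log p) (hε : 0 < ε) (hs : 1 ≤ s) (hC : 0 < C) (hM : 1 ≤ M)
    (hs₁ : s₁ = 2 * M * s) (hρ : ρ < 1) (hrlo : 0 < rlo) (hrhi : 0 ≤ rhi)
    (hwlo : 0 < wlo)
    (hC₀ : C₀ = 16 * M * (1 + ε) ^ 2 * C * (1 + (2 * rhi + 1) / rlo ^ 2))
    (hE : ∀ m, LassoEvent (colsOut X A) (fun r => resid X A (beta Ω A) r m) (lassoWeight X A)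
      (penalty ε δ n p) ρ a b K wlo whi)
    (hr1 : ∀ m, rlo ≤ rms (fun r => resid X A (beta Ω A) r m))
    (hr2 : ∀ m, rms (fun r => resid X A (beta Ω A) r m) ≤ rhi)
    (hB : ∀ m, EstimationBound (colsOut X A) (lassoWeight X A)
      (fun k => (βhat X A - beta Ω A) k m) C (penalty ε δ n p) s₁) :
    matSqNorm (colsOut X A * (βhat X A - beta Ω A)) < C₀ * s * δ * Real.log p ∧
    matL1 (rootDiag X A * (βhat X A - beta Ω A)) < C₀ * s * √(δ * Real.log p / n) ∧
    ∀ m, |thetaHat βhat X A m m / thetaOra Ω X A m m - 1| < C₀ * s * δ * Real.log p / n := by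
  have hn0 : (0 : ℝ) < n := by exact_mod_cast hn
  have hq : 0 < δ * Real.log p / n := by positivity
  have hlam2 := penalty_sq (n := n) (ε := ε) hx.le
  have hlam := penalty_eq (n := n) (p := p) (ε := ε) (δ := δ)
  set q := δ * Real.log p / n with hqdef
  have hxq : δ * Real.log p = q * n := by rw [hqdef]; field_simp
  have hlam0 : 0 < penalty ε δ n p := by rw [hlam]; positivity
  have hG : 1 ≤ 1 + (2 * rhi + 1) / rlo ^ 2 := by
    have : 0 ≤ (2 * rhi + 1) / rlo ^ 2 := by positivity
    linarith
  -- Summing over the two columns needs only `8`; doubling it makes the inequalities strict, as the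
  -- events in the error conditions include equality. The last factor of `C₀` serves the relative
  -- error of the noise level.
  have hbase : 16 * M * (1 + ε) ^ 2 * C ≤ C₀ := by
    rw [hC₀]; exact le_mul_of_one_le_right (by positivity) hG
  have hbase0 : 0 < M * (1 + ε) ^ 2 * C := by positivity
  refine ⟨?_, ?_, fun m => ?_⟩
  · rw [matSqNorm_colsOut_mul]
    have h1 : ∀ m, sqNorm (colsOut X A *ᵥ fun k => (βhat X A - beta Ω A) k m)
        ≤ 4 * M * (1 + ε) ^ 2 * C * (s * (q * n)) := by
      intro m
      have h2 := (hB m).pred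
      rw [div_le_iff₀ hn0, hlam2, hs₁] at h2
      refine h2.trans (le_of_eq ?_)
      ring
    calc _ ≤ ∑ m : {m // m ∈ A}, 4 * M * (1 + ε) ^ 2 * C * (s * (q * n)) :=
          Finset.sum_le_sum fun m _ => h1 m
      _ = 8 * M * (1 + ε) ^ 2 * C * (s * (q * n)) := by
          rw [Finset.sum_const, Finset.card_univ, Fintype.card_coe, hA, nsmul_eq_mul]
          push_cast
          ring
      _ < 16 * M * (1 + ε) ^ 2 * C * (s * (q * n)) := by
          refine mul_lt_mul_of_pos_right ?_ (by positivity)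
          linarith
      _ ≤ C₀ * (s * (q * n)) := mul_le_mul_of_nonneg_right hbase (by positivity)
      _ = _ := by rw [← hxq]; ring
  · rw [matL1_rootDiag_mul]
    have h1 : ∀ m, wl1 (lassoWeight X A) (fun k => (βhat X A - beta Ω A) k m)
        ≤ 4 * M * (1 + ε) ^ 2 * C * (s * √q) := by
      intro m
      have h2 := (hB m).l1
      rw [hlam, hs₁] at h2
      refine h2.trans ?_
      have h3 : √2 ≤ (2 : ℝ) := by rw [Real.sqrt_le_left zero_le_two]; norm_num
      have h4 : 1 + ε ≤ (1 + ε) ^ 2 := by nlinarith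
      have h5 : √2 * (1 + ε) ≤ 2 * (1 + ε) ^ 2 :=
        mul_le_mul h3 h4 (by linarith) zero_le_two
      calc C * (√2 * (1 + ε) * √q) * (2 * M * s) = √2 * (1 + ε) * (2 * M * C * (s * √q)) := by ring
        _ ≤ 2 * (1 + ε) ^ 2 * (2 * M * C * (s * √q)) :=
            mul_le_mul_of_nonneg_right h5 (by positivity)
        _ = _ := by ring
    have hsq : 0 < √q := Real.sqrt_pos.2 hq
    calc _ ≤ ∑ m : {m // m ∈ A}, 4 * M * (1 + ε) ^ 2 * C * (s * √q) :=
          Finset.sum_le_sum fun m _ => h1 m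
      _ = 8 * M * (1 + ε) ^ 2 * C * (s * √q) := by
          rw [Finset.sum_const, Finset.card_univ, Fintype.card_coe, hA, nsmul_eq_mul]
          push_cast
          ring
      _ < 16 * M * (1 + ε) ^ 2 * C * (s * √q) := by
          refine mul_lt_mul_of_pos_right ?_ (by positivity)
          linarith
      _ ≤ C₀ * (s * √q) := mul_le_mul_of_nonneg_right hbase (by positivity)
      _ = _ := by ring
  · rw [thetaHat, thetaOra, residCov_diag, residCov_diag, ← resid_col (beta Ω A)]
    have h1 := abs_rms_sq_sub_le (hE m) (fun k => (βhat X A - beta Ω A) k m)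
    have h2 : (fun r => resid X A (beta Ω A) r m)
        - colsOut X A *ᵥ (fun k => (βhat X A - beta Ω A) k m)
        = (fun r => X r m.1) - colsOut X A *ᵥ (fun k => βhat X A k m) := by
      rw [resid_col, show (fun k => (βhat X A - beta Ω A) k m)
        = (fun k => βhat X A k m) - fun k => beta Ω A k m from rfl, mulVec_sub]
      abel
    rw [h2] at h1
    have hr1m := hr1 m
    have hr2m := hr2 m
    set r₀ := rms (fun r => resid X A (beta Ω A) r m) with hr₀
    have hr0 : 0 < r₀ := hrlo.trans_le hr1m
    set R := rms ((fun r => X r m.1) - colsOut X A *ᵥ (fun k => βhat X A k m))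
    have h3 : R ^ 2 / r₀ ^ 2 - 1 = (R ^ 2 - r₀ ^ 2) / r₀ ^ 2 := by field_simp
    rw [h3, abs_div, abs_of_pos (by positivity : 0 < r₀ ^ 2), div_lt_iff₀ (by positivity)]
    have h4 := (hB m).l1
    have h5 := (hB m).pred
    set H := wl1 (lassoWeight X A) (fun k => (βhat X A - beta Ω A) k m)
    have hH0 : 0 ≤ H := wl1_nonneg ((hE m).weight_nonneg hwlo) _
    have h6 : ρ * penalty ε δ n p * r₀ * H ≤ rhi * (C * penalty ε δ n p ^ 2 * s₁) := by
      calc ρ * penalty ε δ n p * r₀ * H ≤ 1 * penalty ε δ n p * rhi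
            * (C * penalty ε δ n p * s₁) := by gcongr
        _ = _ := by ring
    have h7 : |R ^ 2 - r₀ ^ 2| ≤ (2 * rhi + 1) * (4 * M * (1 + ε) ^ 2 * C) * (s * q) := by
      refine h1.trans ?_
      calc _ ≤ (2 * rhi + 1) * (C * penalty ε δ n p ^ 2 * s₁) := by linarith
        _ = _ := by rw [hlam2, hs₁]; ring
    have h8 : rlo ^ 2 ≤ r₀ ^ 2 := pow_le_pow_left₀ hrlo.le hr1m 2
    calc |R ^ 2 - r₀ ^ 2| ≤ (2 * rhi + 1) * (4 * M * (1 + ε) ^ 2 * C) * (s * q) := h7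
      _ < (16 * M * (1 + ε) ^ 2 * C * (1 + (2 * rhi + 1) / rlo ^ 2)) * (s * q) * rlo ^ 2 := by
          have h9 : (16 * M * (1 + ε) ^ 2 * C * (1 + (2 * rhi + 1) / rlo ^ 2)) * (s * q) * rlo ^ 2
              = 16 * (M * (1 + ε) ^ 2 * C) * (s * q) * (rlo ^ 2 + (2 * rhi + 1)) := by
            field_simp
          rw [h9]
          have h10 : 0 < M * (1 + ε) ^ 2 * C * (s * q) := by positivity
          have h11 : 0 < rlo ^ 2 := by positivity
          nlinarith [mul_pos h10 h11, mul_nonneg h10.le hrhi]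
      _ ≤ C₀ * (s * q) * r₀ ^ 2 := by
          rw [← hC₀]
          have : 0 ≤ C₀ := le_trans (by positivity) hbase
          gcongr
      _ = _ := by rw [hqdef]; ring

/-- With `k = ⌊n/(128 log p)⌋` the union bound over `(2p)^k` signed sums is still affordable, and
the slack `2M/(k-1)` has the order `log p / n` that `K s ≤ κ` requires. -/
lemma exists_block_count {N L M : ℝ} (hM : 0 < M) (hL : 0 < L) (hN : 0 < N) (h : 512 * L ≤ N) :
    ∃ k : ℕ, 2 ≤ k ∧ (k : ℝ) ≤ N / (128 * L) ∧ 0 ≤ 2 * M / ((k : ℝ) - 1) ∧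
      2 * M / ((k : ℝ) - 1) ≤ 512 * M * (L / N) := by
  obtain ⟨k, hk⟩ : ∃ k, k = ⌊N / (128 * L)⌋₊ := ⟨_, rfl⟩
  have hklt : N / (128 * L) < k + 1 := by rw [hk]; exact Nat.lt_floor_add_one _
  have h4k : 4 ≤ N / (128 * L) := by rw [le_div_iff₀ (by positivity)]; linarith
  have hk2 : 2 ≤ k := by
    have : (2 : ℝ) < k := by linarith
    exact_mod_cast this.le
  have hk1 : N / (256 * L) ≤ k - 1 := by
    have : N / (256 * L) = N / (128 * L) / 2 := by field_simp; norm_num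
    rw [this]; linarith
  have hk1pos : 0 < (k : ℝ) - 1 := lt_of_lt_of_le (by positivity) hk1
  refine ⟨k, hk2, by rw [hk]; exact Nat.floor_le (by positivity), by positivity, ?_⟩
  rw [div_le_iff₀ hk1pos]
  calc 2 * M = 512 * M * (L / N) * (N / (256 * L)) := by field_simp; norm_num
    _ ≤ _ := mul_le_mul_of_nonneg_left hk1 (by positivity)

/-- The error conditions for the scaled lasso and for least squares after selection. -/
theorem exists_errorConditions {M ε : ℝ} (hM : 1 < M) (hε : 0 < ε) :
    ∃ c₀ C₀ : ℝ, 0 < c₀ ∧ 0 < C₀ ∧ ∀ {δ : ℝ}, 1 ≤ δ → ∀ {n p : ℕ}, 1 ≤ n → 2 ≤ p → ∀ {s : ℝ},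
      s ≤ c₀ / δ * n / Real.log p → ∀ {Ω : Matrix (Fin p) (Fin p) ℝ},
      Ω ∈ cappedBall p M s (penalty ε δ n p) →
      ∀ {S : Type*} [MeasurableSpace S] {P : Measure S} [IsProbabilityMeasure P]
        {X : S → Matrix (Fin n) (Fin p) ℝ}, IsGaussianSample P X Ω →
      ∀ {βhat : CoefEstimator n p},
        IsScaledLasso (penalty ε δ n p) βhat ∨ IsLSEAfterScaledLasso (penalty ε δ n p) βhat →
        1 ≤ s ∧ ErrorConditions P X Ω βhat C₀ s δ (lassoRemainder ε p) := by
  have hM0 : 0 < M := by linarith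
  set z := 1 + ε with hz
  have hz1 : 1 < z := by linarith
  have hz0 : 0 < z := by linarith
  have hsz : 1 < √z := by rw [Real.lt_sqrt zero_le_one]; linarith
  have hssz : 1 < √√z := by rw [Real.lt_sqrt zero_le_one]; linarith
  obtain ⟨ρ, hρdef⟩ : ∃ ρ, ρ = √√z / √z := ⟨_, rfl⟩
  have hρ0 : 0 ≤ ρ := by rw [hρdef]; positivity
  have hρ1 : ρ < 1 := by
    rw [hρdef, div_lt_one (by positivity)]
    have := Real.mul_self_sqrt (Real.sqrt_nonneg z)
    nlinarith
  obtain ⟨rlo, hrlo⟩ : ∃ r, r = √(1 / (M * √z)) := ⟨_, rfl⟩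
  obtain ⟨rhi, hrhi⟩ : ∃ r, r = √(2 * M) := ⟨_, rfl⟩
  have hrlo0 : 0 < rlo := by rw [hrlo]; exact Real.sqrt_pos.2 (by positivity)
  have hrhi0 : 0 ≤ rhi := by rw [hrhi]; positivity
  have hwlo0 : 0 < √(1 / (4 * M)) := Real.sqrt_pos.2 (by positivity)
  obtain ⟨C, κ, hC, hκ, hest⟩ := estimationBound_of_lassoEvent (a := 1 / (2 * M)) (b := 2 * M)
    (wlo := √(1 / (4 * M))) (whi := √(3 * M)) (by positivity) (by positivity) hwlo0
    (Real.sqrt_pos.2 (by positivity)) hrlo0 hρ0 hρ1 hrhi0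
  have ht0 : 0 < 1 - 1 / √z := by
    rw [sub_pos, div_lt_one (by positivity)]; exact hsz
  -- In order, the entries give: `512 log p ≤ n`; concentration of the noise level; a slack below
  -- `1/(4M)`; slack times sparsity below `κ`; `λ²` times sparsity below `κ`; and `s ≥ 1`. The
  -- sparsity of `β` is `2 M s`.
  obtain ⟨c₀, hc₀, hcl⟩ := exists_pos_forall_le [1 / 512, (1 - 1 / √z) ^ 2 / 8,
    1 / (2048 * M ^ 2), κ / (4096 * M ^ 3), κ / (4 * M * z ^ 2), 1 / (4 * z ^ 2 * M ^ 2)] (by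
      intro x hx
      simp only [List.mem_cons, List.not_mem_nil, or_false] at hx
      rcases hx with rfl | rfl | rfl | rfl | rfl | rfl <;> positivity)
  have k1 := hcl (1 / 512) (by simp)
  have k2 := hcl ((1 - 1 / √z) ^ 2 / 8) (by simp)
  have k3 := hcl (1 / (2048 * M ^ 2)) (by simp)
  have k4 := hcl (κ / (4096 * M ^ 3)) (by simp)
  have k5 := hcl (κ / (4 * M * z ^ 2)) (by simp)
  have k6 := hcl (1 / (4 * z ^ 2 * M ^ 2)) (by simp)
  rw [le_div_iff₀ (by positivity)] at k1 k2 k3 k4 k5 k6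
  obtain ⟨C₀, hC₀⟩ : ∃ c, c = 16 * M * (1 + ε) ^ 2 * C * (1 + (2 * rhi + 1) / rlo ^ 2) := ⟨_, rfl⟩
  refine ⟨c₀, C₀, hc₀, by rw [hC₀]; positivity, ?_⟩
  intro δ hδ n p hn hp s hs Ω hΩ S _ P _ X hX βhat hβ
  have hL := log_natCast_pos hp
  have hn0 : (0 : ℝ) < n := by exact_mod_cast hn
  have hpd := cappedBall_posDef hM0 hΩ
  set L := Real.log p with hLdef
  have hL0 : 0 < L := by linarith
  have hx : 0 < δ * L := mul_pos (by linarith) hL0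
  have hlam2 := penalty_sq (n := n) (p := p) (ε := ε) hx.le
  have hlam0 : 0 < penalty ε δ n p := by rw [penalty_eq]; positivity
  have hsx : δ * L / n * s ≤ c₀ := by
    have h1 : s ≤ c₀ * n / (δ * L) := hs.trans (le_of_eq (by field_simp))
    rw [le_div_iff₀ hx] at h1
    rw [div_mul_eq_mul_div, div_le_iff₀ hn0]
    linarith
  have hs1 : 1 ≤ s := by
    refine one_le_of_mem_cappedBall (c := 2 * z ^ 2 * c₀) hM0 hlam0 (by omega) hΩ ?_ ?_
    · rw [hlam2]
      have := mul_le_mul_of_nonneg_left hsx (show 0 ≤ 2 * z ^ 2 by positivity)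
      linarith
    · linarith
  refine ⟨hs1, ?_⟩
  have hnx : δ * L ≤ c₀ * n := by
    have h1 : δ * L / n ≤ c₀ := by
      have : δ * L / n * 1 ≤ δ * L / n * s := mul_le_mul_of_nonneg_left hs1 (by positivity)
      linarith
    rwa [div_le_iff₀ hn0] at h1
  have hδL : L ≤ δ * L := le_mul_of_one_le_left hL0.le hδ
  have hcn := mul_le_mul_of_nonneg_right k1 hn0.le
  have hLn : 512 * L ≤ n := by linarith
  have hs2 : 1 ≤ 2 * M * s := by
    have := mul_le_mul hM.le hs1 zero_le_one hM0.le
    linarith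
  obtain ⟨k, hk2, hkle, hK0, hK1⟩ := exists_block_count hM0 hL0 hn0 hLn
  have hLc : L / n ≤ c₀ := by rw [div_le_iff₀ hn0]; linarith
  have hK2 : 2 * M / ((k : ℝ) - 1) ≤ 1 / (4 * M) := by
    refine hK1.trans ?_
    rw [le_div_iff₀ (by positivity)]
    have := mul_le_mul_of_nonneg_left hLc (show 0 ≤ 2048 * M ^ 2 by positivity)
    linarith
  have hLs : L / n * s ≤ c₀ := by
    refine le_trans ?_ hsx
    gcongr
  have hK3 : 4 * M * (2 * M / ((k : ℝ) - 1)) * (2 * M * s) ≤ κ := by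
    have h1 := mul_le_mul_of_nonneg_right hK1 (show 0 ≤ 8 * M ^ 2 * s by positivity)
    have h2 := mul_le_mul_of_nonneg_left hLs (show 0 ≤ 4096 * M ^ 3 by positivity)
    linarith
  have hls : penalty ε δ n p ^ 2 * (2 * M * s) ≤ κ := by
    rw [hlam2]
    have := mul_le_mul_of_nonneg_left hsx (show 0 ≤ 4 * M * z ^ 2 by positivity)
    linarith
  have hbad : ∀ A : Finset (Fin p), A.card = 2 →
      P.real {ω | ¬ DesignEvent Ω (X ω) A √(2 * ((1 + ε) * (δ * Real.log p)))
        (2 * M / ((k : ℝ) - 1)) (1 + ε)} ≤ (p : ℝ) ^ (-δ + 1) * lassoRemainder ε p := by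
    intro A hA
    refine (hX.real_not_designEvent_le hpd hn hA (Real.sqrt_nonneg _) hz1
      (fun j => ((covOut_quadFormBounds hM0 hΩ A).diag j).2) hk2).trans ?_
    refine failure_le hp hε hδ (by linarith) hkle ?_
    have := mul_le_mul_of_nonneg_right k2 hn0.le
    linarith
  have hgood : ∀ A : Finset (Fin p), A.card = 2 → ∀ ω,
      DesignEvent Ω (X ω) A √(2 * ((1 + ε) * (δ * Real.log p))) (2 * M / ((k : ℝ) - 1)) (1 + ε) →
      matSqNorm (colsOut (X ω) A * (βhat (X ω) A - beta Ω A)) < C₀ * s * δ * Real.log p ∧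
      matL1 (rootDiag (X ω) A * (βhat (X ω) A - beta Ω A)) < C₀ * s * √(δ * Real.log p / n) ∧
      ∀ m, |thetaHat βhat (X ω) A m m / thetaOra Ω (X ω) A m m - 1|
        < C₀ * s * δ * Real.log p / n := by
    intro A hA ω hD
    have hE := fun m => hD.lassoEvent hn hε hx.le hM.le hΩ hK0 hK2 m
    rw [← hz, ← hρdef] at hE
    have hθ := theta_quadFormBounds hM0 hΩ A
    have hr1 : ∀ m, rlo ≤ rms (fun r => resid (X ω) A (beta Ω A) r m) := by
      intro m
      rw [hrlo, Real.sqrt_le_left (rms_nonneg _), div_le_iff₀ (by positivity)]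
      have h1 := (hθ.diag m).1
      have h2 := (hD.scale m).1
      rw [div_le_iff₀ hM0] at h1
      have := mul_le_mul_of_nonneg_right h2 hM0.le
      linarith
    have hr2 : ∀ m, rms (fun r => resid (X ω) A (beta Ω A) r m) ≤ rhi := by
      intro m
      rw [hrhi]
      refine Real.le_sqrt_of_sq_le ((hD.scale m).2.trans ?_)
      linarith [(hθ.diag m).2]
    exact errors_lt_of_estimationBound hA hn hx hε hs1 hC hM.le rfl hρ1 hrlo0 hrhi0 hwlo0 hC₀
      hE hr1 hr2 fun m => hest hA (hE m) hlam0 (by positivity) (hr1 m) (hr2 m)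
        (beta_capped_le hM.le hlam0 hΩ hA m) hs2 hls hK3 hβ
  refine ⟨fun A hA => ?_, fun A hA => ?_, fun A hA m => ?_⟩
  · refine (measureReal_mono ?_).trans (hbad A hA)
    intro ω hω hD
    exact absurd hω (not_le.2 (hgood A hA ω hD).1)
  · refine (measureReal_mono ?_).trans (hbad A hA)
    intro ω hω hD
    exact absurd hω (not_le.2 (hgood A hA ω hD).2.1)
  · refine (measureReal_mono ?_).trans (hbad A hA)
    intro ω hω hD
    exact absurd hω (not_le.2 ((hgood A hA ω hD).2.2 m))

end ErrorConditionsOfLasso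

end PrecisionInference

/-! ### Assembly of the three parts. -/

theorem theorem2 :
    -- (i) comparison with the oracle, for any coefficient estimator
    (∀ C₀ : ℝ, 0 < C₀ → ∀ Lθ : ℝ, 0 < Lθ → ∃ C₁ : ℝ, 0 < C₁ ∧
      ∀ Lω : ℝ, 0 < Lω → ∃ c₀ : ℝ, 0 < c₀ ∧ ∃ C₁' : ℝ, 0 < C₁' ∧
      ∀ (δ : ℝ), 1 ≤ δ → ∀ (n p : ℕ), 1 ≤ n → 2 ≤ p → ∀ (s ε : ℝ)
        (Ω : Matrix (Fin p) (Fin p) ℝ), Ω.PosDef →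
      ∀ (S : Type*) [MeasurableSpace S] (P : Measure S) [IsProbabilityMeasure P]
        (X : S → Matrix (Fin n) (Fin p) ℝ), IsGaussianSample P X Ω →
      ∀ βhat : CoefEstimator n p, ErrorConditions P X Ω βhat C₀ s δ ε →
      ∀ A : Finset (Fin p), A.card = 2 → (∀ m, theta Ω A m m ≤ Lθ) →
        P.real {ω | C₁ * s * (δ * Real.log p / n) <
            matSup (thetaHat βhat (X ω) A - thetaOra Ω (X ω) A)} ≤ tailBound ε δ p ∧
        ((∀ m, block Ω A m m ≤ Lω) → 1 ≤ s → s ≤ c₀ / δ * n / Real.log p →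
          P.real {ω | C₁' * s * (δ * Real.log p / n) <
            matSup (omegaHat βhat (X ω) A - omegaOra Ω (X ω) A)} ≤ tailBound ε δ p)) ∧
    -- (ii) the conditions for the scaled lasso and for the LSE after scaled lasso selection
    (∀ M : ℝ, 1 < M → ∀ ε : ℝ, 0 < ε → ∃ c₀ : ℝ, 0 < c₀ ∧
      ∃ C₀ C₁ C₁' : ℝ, 0 < C₀ ∧ 0 < C₁ ∧ 0 < C₁' ∧
      ∀ (δ : ℝ), 1 ≤ δ → ∃ e : ℕ → ℝ, Tendsto e atTop (𝓝 0) ∧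
      ∀ (n p : ℕ), 1 ≤ n → 2 ≤ p → ∀ s : ℝ, s ≤ c₀ / δ * n / Real.log p →
      ∀ Ω ∈ cappedBall p M s (penalty ε δ n p),
      ∀ (S : Type*) [MeasurableSpace S] (P : Measure S) [IsProbabilityMeasure P]
        (X : S → Matrix (Fin n) (Fin p) ℝ), IsGaussianSample P X Ω →
      ∀ βhat : CoefEstimator n p,
        IsScaledLasso (penalty ε δ n p) βhat ∨ IsLSEAfterScaledLasso (penalty ε δ n p) βhat →
        ErrorConditions P X Ω βhat C₀ s δ (e p) ∧
        ∀ A : Finset (Fin p), A.card = 2 →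
          P.real {ω | C₁ * s * (δ * Real.log p / n) <
            matSup (thetaHat βhat (X ω) A - thetaOra Ω (X ω) A)} ≤ tailBound (e p) δ p ∧
          P.real {ω | C₁' * s * (δ * Real.log p / n) <
            matSup (omegaHat βhat (X ω) A - omegaOra Ω (X ω) A)} ≤ tailBound (e p) δ p) ∧
    -- (iii) normal approximation of the standardized oracle
    (∃ D₁ ϑ : ℝ, 0 < D₁ ∧ 0 < ϑ ∧
      ∀ (n p : ℕ), 2 ≤ n → ∀ Ω : Matrix (Fin p) (Fin p) ℝ, Ω.PosDef →
      ∀ (S : Type*) [MeasurableSpace S] (P : Measure S) [IsProbabilityMeasure P]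
        (X : S → Matrix (Fin n) (Fin p) ℝ), IsGaussianSample P X Ω →
      ∀ i j : Fin p, i ≠ j → ∃ Z' Zii Zij Zjj : S → ℝ,
        HasLaw Z' (gaussianReal 0 1) P ∧ HasLaw Zii (gaussianReal 0 1) P ∧
        HasLaw Zij (gaussianReal 0 1) P ∧ HasLaw Zjj (gaussianReal 0 1) P ∧
        (∃ a b c : ℝ, ∀ ω, Z' ω = a * Zii ω + b * Zij ω + c * Zjj ω) ∧
        ∀ᵐ ω ∂P, |Zii ω| ≤ ϑ * √n → |Zij ω| ≤ ϑ * √n → |Zjj ω| ≤ ϑ * √n →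
          |kappaOra Ω (X ω) i j - Z' ω|
            ≤ D₁ / √n * (1 + Zii ω ^ 2 + Zij ω ^ 2 + Zjj ω ^ 2)) := by
  refine ⟨?_, ?_, 60, 1 / 4, by norm_num, by norm_num, ?_⟩
  · intro C₀ hC₀ Lθ hLθ
    refine ⟨(4 * √Lθ + 1) * C₀, by positivity, fun Lω hLω => ?_⟩
    obtain ⟨c₀, hc₀, C, hC, h⟩ := ErrorConditions.real_omegaHat_le hC₀ hLθ hLω
    refine ⟨c₀, hc₀, C, hC, ?_⟩
    intro δ hδ n p hn hp s ε Ω hΩ S _ P _ X hX βhat hE A hA hθ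
    exact ⟨hE.real_thetaHat_le hC₀ hδ hn hp hΩ hX hA hθ,
      fun hω hs hsc => h hδ hn hp hΩ hX hE hA hθ hω hs hsc⟩
  · intro M hM ε hε
    have hM0 : 0 < M := by linarith
    obtain ⟨c, C₀, hc, hC₀, hE⟩ := exists_errorConditions hM hε
    -- In the class the diagonals of both `theta` and `block` are at most `M`, so `M` serves as `Lθ`
    -- and `Lω`.
    obtain ⟨c', hc', C, hC, h⟩ := ErrorConditions.real_omegaHat_le hC₀ hM0 hM0
    refine ⟨min c c', lt_min hc hc', C₀, (4 * √M + 1) * C₀, C, hC₀, by positivity, hC, ?_⟩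
    -- The remainder does not depend on `δ`, because `δ ≥ 1` was used to bound `p^{-εδ}` by
    -- `p^{-ε}`.
    refine fun δ hδ => ⟨lassoRemainder ε, tendsto_lassoRemainder hε, ?_⟩
    intro n p hn hp s hs Ω hΩ S _ P _ X hX βhat hβ
    have hL := log_natCast_pos hp
    have hL0 : 0 < Real.log p := by linarith
    have hδ0 : 0 < δ := by linarith
    have hmono : ∀ a, min c c' ≤ a → s ≤ a / δ * n / Real.log p := fun a ha =>
      hs.trans (by gcongr)
    obtain ⟨hs1, hcond⟩ := hE hδ hn hp (hmono c (min_le_left _ _)) hΩ hX hβ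
    have hpd := cappedBall_posDef hM0 hΩ
    refine ⟨hcond, fun A hA => ?_⟩
    have hθ := fun m => ((theta_quadFormBounds hM0 hΩ A).diag m).2
    have hω := fun m => ((block_quadFormBounds hΩ A).diag m).2
    exact ⟨hcond.real_thetaHat_le hC₀ hδ hn hp hpd hX hA hθ,
      h hδ hn hp hpd hX hcond hA hθ hω hs1 (hmono c' (min_le_right _ _))⟩
  · intro n p hn Ω hΩ S _ P _ X hX i j hij
    exact hX.exists_normal_approx_oracle hΩ hn hij
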